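/- Let $G=(V,E)$ be a finite connected simple graph with at least two circuits (a circuit is a cyclic sequence of $\ell\ge 3$ distinct vertices, consecutive ones adjacent; for this count circuits with the same edge set are identified), let $N\ge 1$ and $p,q\in\mathbb R$. Let $W_1(k)=k^p$ and $W_2(k)=k^q$ for integers $k\ge 1$, let $W_2(0)>0$ be arbitrary, and put $W(k)=W_1(k)$ for $k>0$ and $W(k)=W_2(-k)$ for $k\le 0$. The multi-particle Ant random walk with $N$ walkers is the process $(X_1(n),\dots,X_N(n))_{n\ge 0}$ in $V^N$, with an arbitrary distribution of $(X_1(0),\dots,X_N(0))$, that evolves as follows. Let the crossing number $c_n(u,v)$ be the number of jumps of all walkers from $u$ to $v$ minus the number of jumps from $v$ to $u$ up to time $n$. Given the past up to time $n$, an index $i\in\{1,\dots,N\}$ is chosen uniformly at random, the walker $i$ jumps from $x=X_i(n)$ to the neighbour $u$ of $x$ with probability $W(c_n(x,u))/\sum_{w\sim x}W(c_n(x,w))$, and the other walkers stay put. Let $\mathrm{Monot}$ be the event that there is $m$ such that for every directed edge $(u,v)$ the function $n\mapsto c_n(u,v)$ is monotone (non-decreasing or non-increasing) on $n\ge m$.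 Call a directed circuit trapping if some walker eventually spins around it forever, i.e. from some time on this walker stays on the circuit, all its jumps follow the circuit in its direction, and it jumps infinitely often. Let $\mathrm{LocTrapp}$ be the event that $\mathrm{Monot}$ occurs and there are $K\le N$ and pairwise vertex-disjoint trapping circuits $C_1,\dots,C_K$ such that the set of vertices visited infinitely often is $\bigcup_i V(C_i)$, the set of edges crossed infinitely often is $\bigcup_i E(C_i)$, and each walker eventually spins around one of the $C_i$; and, moreover, every directed circuit all of whose directed edges are crossed infinitely often is trapping. Then: 1. if $p\le 1+q$, then $\mathbb P(\mathrm{Monot})=0$; 2. if $p>1+\max\{q,0\}$, then $\mathbb P(\mathrm{LocTrapp})=1$. -/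

import Mathlib

open MeasureTheory Filter

namespace AntRW

/-! A trajectory of `N` walkers on the vertex set `V` is a map `x : ℕ → Fin N → V`;
`x n i` is the position of walker `i` at time `n`. -/

section Model

variable {V : Type*} [DecidableEq V] {N : ℕ}

/-- The number of jumps of walker `i` from `u` to `v` minus the number of its jumps from `v` to `u`,
up to time `n`. -/
def walkerCrossing (x : ℕ → Fin N → V) (i : Fin N) (n : ℕ) (u v : V) : ℤ :=
  ∑ m ∈ Finset.range n,
    ((if x m i = u ∧ x (m + 1) i = v then 1 else 0) -
      (if x m i = v ∧ x (m + 1) i = u then 1 else 0))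

/-- The collective crossing number `c_n(u, v)`. -/
def crossing (x : ℕ → Fin N → V) (n : ℕ) (u v : V) : ℤ :=
  ∑ i, walkerCrossing x i n u v

/-- The weight `W : ℤ → ℝ` built from `W₁` (positive crossing numbers) and `W₂` (the others). -/
def weight (W₁ W₂ : ℕ → ℝ) (k : ℤ) : ℝ :=
  if 0 < k then W₁ k.toNat else W₂ (-k).toNat

variable [Fintype V] (G : SimpleGraph V) [DecidableRel G.Adj]

/-- The probability that walker `i`, if it is the one selected to move after time `n`,
jumps to `u`, given the trajectory up to time `n`. -/
noncomputable def jumpProb (W : ℤ → ℝ) (x : ℕ → Fin N → V) (n : ℕ) (i : Fin N) (u : V) : ℝ :=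
  if G.Adj (x n i) u then
    W (crossing x n (x n i) u) / ∑ w ∈ G.neighborFinset (x n i), W (crossing x n (x n i) w)
  else 0

/-- The conditional probability that the configuration at time `n + 1` is `y`, given the
trajectory up to time `n`: a walker is selected uniformly at random, and jumps. -/
noncomputable def transProb (W : ℤ → ℝ) (x : ℕ → Fin N → V) (n : ℕ) (y : Fin N → V) : ℝ :=
  ∑ i : Fin N, (1 / (N : ℝ)) *
    ∑ u : V, if y = Function.update (x n) i u then jumpProb G W x n i u else 0

/-- `X` is a multi-particle Ant random walk with weight `W` under `μ`, with an arbitrary law of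
`X 0`: on every (finite) history the next configuration has the prescribed conditional law. -/
structure IsAntRW {Ω : Type*} [MeasurableSpace Ω] (μ : Measure Ω) (W : ℤ → ℝ)
    (X : ℕ → Ω → Fin N → V) : Prop where
  measurableSet_eq : ∀ (n : ℕ) (y : Fin N → V), MeasurableSet {ω | X n ω = y}
  transition : ∀ (n : ℕ) (x : ℕ → Fin N → V) (y : Fin N → V),
    μ {ω | (∀ m ≤ n, X m ω = x m) ∧ X (n + 1) ω = y} =
      μ {ω | ∀ m ≤ n, X m ω = x m} * ENNReal.ofReal (transProb G W x n y)

end Model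

section Circuits

variable {V : Type*} (G : SimpleGraph V)

/-- A circuit of `G` with a starting point and a direction of travel. -/
structure Circuit where
  base : V
  walk : G.Walk base base
  isCycle : walk.IsCycle

variable {G}

/-- The vertices of a circuit. -/
def Circuit.verts (C : Circuit G) : Set V := {v | v ∈ C.walk.support}

/-- The undirected edges of a circuit. -/
def Circuit.edges (C : Circuit G) : Set (Sym2 V) := {e | e ∈ C.walk.edges}

/-- `(u, v)` is a directed edge of the circuit, in its direction of travel. -/
def Circuit.Step (C : Circuit G) (u v : V) : Prop :=
  ∃ d ∈ C.walk.darts, d.fst = u ∧ d.snd = v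

variable (G)

/-- `G` has at least two circuits; undirected circuits are told apart by their edge sets, so that
the starting point and the direction do not matter. -/
def HasTwoCircuits : Prop := ∃ C C' : Circuit G, C.edges ≠ C'.edges

end Circuits

section Events

variable {V : Type*} {N : ℕ}

/-- Every crossing number is a monotone function of time from some common time on. -/
def Monot [DecidableEq V] (G : SimpleGraph V) (x : ℕ → Fin N → V) : Prop :=
  ∃ m : ℕ, ∀ u v : V, G.Adj u v →
    MonotoneOn (fun n => crossing x n u v) (Set.Ici m) ∨
      AntitoneOn (fun n => crossing x n u v) (Set.Ici m)

/-- Vertices visited infinitely often. -/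
def vertsInf (x : ℕ → Fin N → V) : Set V :=
  {v | ∃ᶠ n in atTop, ∃ i, x n i = v}

/-- Edges crossed (in either direction) infinitely often. -/
def edgesInf (G : SimpleGraph V) (x : ℕ → Fin N → V) : Set (Sym2 V) :=
  {e | e ∈ G.edgeSet ∧ ∃ᶠ n in atTop, ∃ i, s(x n i, x (n + 1) i) = e}

variable {G : SimpleGraph V}

/-- From some time on, walker `i` is on `C` and each of its jumps follows `C` in the direction
of `C` (it rests when another walker is selected); and it jumps infinitely often. -/
def Spins (x : ℕ → Fin N → V) (i : Fin N) (C : Circuit G) : Prop :=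
  (∀ᶠ n in atTop, x n i ∈ C.verts ∧ (x (n + 1) i = x n i ∨ C.Step (x n i) (x (n + 1) i))) ∧
    ∃ᶠ n in atTop, x (n + 1) i ≠ x n i

/-- Some walker eventually spins around `C` forever. -/
def IsTrapping (x : ℕ → Fin N → V) (C : Circuit G) : Prop := ∃ i, Spins x i C

/-- Every directed edge of `C` is crossed infinitely often. -/
def CrossedInf (x : ℕ → Fin N → V) (C : Circuit G) : Prop :=
  ∀ u v, C.Step u v → ∃ᶠ n in atTop, ∃ i, x n i = u ∧ x (n + 1) i = v

variable (G)

/-- Local trapping: the crossing numbers are eventually monotone; there are `K ≤ N` pairwise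
vertex-disjoint trapping circuits which make up exactly the vertices visited and the edges
crossed infinitely often, and around one of which each walker eventually spins; and every circuit
that is crossed infinitely often is a trapping circuit. -/
def LocTrapp [DecidableEq V] (x : ℕ → Fin N → V) : Prop :=
  Monot G x ∧
  (∃ K ≤ N, ∃ C : Fin K → Circuit G,
    (Pairwise fun j k => Disjoint (C j).verts (C k).verts) ∧
    vertsInf x = ⋃ j, (C j).verts ∧
    edgesInf G x = ⋃ j, (C j).edges ∧
    (∀ j, IsTrapping x (C j)) ∧
    ∀ i, ∃ j, Spins x i (C j)) ∧
  ∀ C : Circuit G, CrossedInf x C → IsTrapping x C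

end Events

end AntRW

/-!
Call a jump *forward* if the directed edge it follows has a positive crossing number at that time
(`AntRW.Forward`). On a legal trajectory the crossing numbers are eventually monotone only
if the jumps are eventually forward, so that both claims are about the event that from some time on
all jumps are forward. While this lasts, the outflow of a vertex (the sum `F` of its positive
crossing numbers) grows by one with each departure.

If `p ≤ 1 + q`, a vertex that is left infinitely often is also entered infinitely often. Inflow and
outflow differ by at most `N`, so some edge at the vertex carries a negative crossing number of
order `F`, and the reversed jump has weight at least of order `F ^ q`. Charging this weight to the
allowed edges (`backFactor`) gives a nonnegative multiplicative supermartingale which vanishes after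
the first jump that is not forward. As long as all jumps are forward it grows without bound: with
`s = 1 + max (-p) 0`, the factor for a jump along an edge with crossing number `B` exceeds one by at
least a constant times the relative increment of `∑ B ^ s`. Hence the event is null
(`ae_not_eventually_forward`).

If `p > 1 + max q 0`, three facts are combined.

* The jumps are eventually forward (`ae_eventually_forward`). The crossing numbers almost form a
  circulation, so the edges with crossing numbers above a gap between two levels can be followed
  indefinitely; such a gap exists by the pigeonhole principle, if need be after a walker has been
  led around a circuit many times. Thus a configuration from which all walkers can follow edges with
  positive crossing numbers, while the other edges there have bounded ones (`IsTrap`), is reached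
  from any history in boundedly many steps, with probability bounded below. From then on a walker
  leaves these edges with probability at most of order `F ^ (max q 0 - p)`, which is summable in
  `F`, and so all jumps stay forward with probability bounded below. Lévy's zero-one law concludes.
* No vertex is left along two edges infinitely often (`ae_not_branches`). This is Rubin's argument:
  `∑ B ^ (-p)` converges, so two competing exponential clocks would have to run out simultaneously.
  The clocks are not constructed. Instead, a complex martingale with mean one encodes the
  characteristic function of their difference; on the event it converges to a number of large
  modulus, and elsewhere its modulus is no larger, which bounds the conditional probability of the
  event away from one.
* Every walker keeps jumping (`ae_frequently_jumps`).

On this almost sure event the edges used infinitely often define a permutation of the vertices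
visited infinitely often. Its cycles are the vertex-disjoint trapping circuits
(`locTrapp_of_forward`).
-/

namespace AntRW

/-! ### Crossing numbers along a trajectory -/

section Paths

set_option linter.unusedSectionVars false

variable {V : Type*} [DecidableEq V] {N : ℕ} {x y : ℕ → Fin N → V} {G : SimpleGraph V}

theorem crossing_congr {n : ℕ} (h : ∀ m ≤ n, x m = y m) (u v : V) :
    crossing x n u v = crossing y n u v := by
  unfold crossing walkerCrossing
  refine Finset.sum_congr rfl fun i _ => Finset.sum_congr rfl fun m hm => ?_
  have hm' := Finset.mem_range.1 hm
  rw [h m hm'.le, h (m + 1) hm']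

theorem crossing_swap (x : ℕ → Fin N → V) (n : ℕ) (u v : V) :
    crossing x n v u = -crossing x n u v := by
  unfold crossing walkerCrossing
  rw [← Finset.sum_neg_distrib]
  refine Finset.sum_congr rfl fun i _ => ?_
  rw [← Finset.sum_neg_distrib]
  exact Finset.sum_congr rfl fun m _ => (neg_sub _ _).symm

/-- At time `k`, walker `i` jumps to the neighbour `b` and the other walkers stay put. -/
def IsMove (G : SimpleGraph V) (x : ℕ → Fin N → V) (k : ℕ) (i : Fin N) (b : V) : Prop :=
  G.Adj (x k i) b ∧ x (k + 1) = Function.update (x k) i b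

/-- Up to time `n`, exactly one walker jumps at each time, and it jumps to a neighbour. -/
def ValidUpTo (G : SimpleGraph V) (x : ℕ → Fin N → V) (n : ℕ) : Prop :=
  ∀ k < n, ∃ i b, IsMove G x k i b

theorem ValidUpTo.mono {m n : ℕ} (h : ValidUpTo G x n) (hmn : m ≤ n) : ValidUpTo G x m :=
  fun k hk => h k (hk.trans_le hmn)

theorem IsMove.congr {k : ℕ} {i : Fin N} {b : V} (h : IsMove G x k i b)
    (hk : x k = y k) (hk' : x (k + 1) = y (k + 1)) : IsMove G y k i b := by
  unfold IsMove at *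
  rwa [hk, hk'] at h

theorem ValidUpTo.congr {n : ℕ} (h : ValidUpTo G x n) (hxy : ∀ m ≤ n, x m = y m) :
    ValidUpTo G y n := fun k hk => by
  obtain ⟨i, b, hm⟩ := h k hk
  exact ⟨i, b, hm.congr (hxy k hk.le) (hxy (k + 1) hk)⟩

theorem IsMove.apply_self {k : ℕ} {i : Fin N} {b : V} (h : IsMove G x k i b) :
    x (k + 1) i = b := by rw [h.2, Function.update_self]

theorem IsMove.apply_ne {k : ℕ} {i j : Fin N} {b : V} (h : IsMove G x k i b) (hj : j ≠ i) :
    x (k + 1) j = x k j := by rw [h.2, Function.update_of_ne hj]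

theorem IsMove.moved_iff {k : ℕ} {i j : Fin N} {b : V} (h : IsMove G x k i b) :
    x (k + 1) j ≠ x k j ↔ j = i := by
  refine ⟨fun hj => ?_, ?_⟩
  · by_contra hne
    exact hj (h.apply_ne hne)
  · rintro rfl
    rw [h.apply_self]
    exact h.1.ne'

theorem crossing_zero (x : ℕ → Fin N → V) (u v : V) : crossing x 0 u v = 0 := by
  simp [crossing, walkerCrossing]

theorem crossing_succ {k : ℕ} {i : Fin N} {b : V} (h : IsMove G x k i b) (u v : V) :
    crossing x (k + 1) u v = crossing x k u v +
      ((if x k i = u ∧ b = v then 1 else 0) - (if x k i = v ∧ b = u then 1 else 0)) := by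
  unfold crossing walkerCrossing
  simp only [Finset.sum_range_succ]
  rw [Finset.sum_add_distrib]
  congr 1
  rw [Finset.sum_eq_single i]
  · rw [h.apply_self]
  · intro j _ hj
    rw [h.apply_ne hj]
    simp only [and_comm, sub_self]
  · simp

theorem crossing_succ_self {k : ℕ} {i : Fin N} {b : V} (h : IsMove G x k i b) :
    crossing x (k + 1) (x k i) b = crossing x k (x k i) b + 1 := by
  rw [crossing_succ h]
  have := h.1.ne
  simp [this]

theorem crossing_succ_of_ne {k : ℕ} {i : Fin N} {b : V} (h : IsMove G x k i b) {u v : V}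
    (h₁ : ¬ (x k i = u ∧ b = v)) (h₂ : ¬ (x k i = v ∧ b = u)) :
    crossing x (k + 1) u v = crossing x k u v := by
  rw [crossing_succ h, if_neg h₁, if_neg h₂]
  simp

theorem abs_crossing_succ_sub_le {k : ℕ} {i : Fin N} {b : V} (h : IsMove G x k i b) (u v : V) :
    |crossing x (k + 1) u v| ≤ |crossing x k u v| + 1 := by
  rw [crossing_succ h]
  refine (abs_add_le _ _).trans (add_le_add le_rfl ?_)
  split_ifs <;> simp

theorem crossing_eq_zero_of_not_adj {n : ℕ} (h : ValidUpTo G x n) {u v : V} (huv : ¬ G.Adj u v) :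
    crossing x n u v = 0 := by
  induction n with
  | zero => exact crossing_zero x u v
  | succ k ih =>
    obtain ⟨i, b, hm⟩ := h k (Nat.lt_succ_self k)
    rw [crossing_succ_of_ne hm, ih (h.mono (Nat.le_succ k))]
    · rintro ⟨rfl, rfl⟩
      exact huv hm.1
    · rintro ⟨rfl, rfl⟩
      exact huv hm.1.symm

theorem adj_of_crossing_ne_zero {n : ℕ} (h : ValidUpTo G x n) {u v : V}
    (huv : crossing x n u v ≠ 0) : G.Adj u v := by
  by_contra hn
  exact huv (crossing_eq_zero_of_not_adj h hn)

/-- The divergence of the crossing numbers at `u` is the number of walkers that started at `u`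
minus the number of walkers that are there now. -/
theorem sum_crossing [Fintype V] (x : ℕ → Fin N → V) (n : ℕ) (u : V) :
    ∑ v, crossing x n u v =
      ∑ i, (if x 0 i = u then 1 else 0 : ℤ) - ∑ i, (if x n i = u then 1 else 0 : ℤ) := by
  unfold crossing walkerCrossing
  rw [Finset.sum_comm, ← Finset.sum_sub_distrib]
  refine Finset.sum_congr rfl fun i _ => ?_
  rw [Finset.sum_comm]
  have : ∀ m ∈ Finset.range n, (∑ v : V, ((if x m i = u ∧ x (m + 1) i = v then 1 else 0 : ℤ) -
      (if x m i = v ∧ x (m + 1) i = u then 1 else 0))) =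
      (fun m => (if x m i = u then 1 else 0 : ℤ)) m -
        (fun m => (if x m i = u then 1 else 0 : ℤ)) (m + 1) := by
    intro m _
    rw [Finset.sum_sub_distrib]
    congr 1
    · by_cases hu : x m i = u <;> simp [hu]
    · by_cases hu : x (m + 1) i = u <;> simp [hu]
  rw [Finset.sum_congr rfl this, Finset.sum_range_sub']

theorem abs_sum_crossing_le [Fintype V] (x : ℕ → Fin N → V) (n : ℕ) (u : V) :
    |∑ v, crossing x n u v| ≤ N := by
  have key : ∀ m, 0 ≤ ∑ i, (if x m i = u then 1 else 0 : ℤ) ∧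
      ∑ i, (if x m i = u then 1 else 0 : ℤ) ≤ N := by
    intro m
    refine ⟨Finset.sum_nonneg fun i _ => by split_ifs <;> simp, ?_⟩
    calc _ ≤ ∑ _i : Fin N, (1 : ℤ) := Finset.sum_le_sum fun i _ => by split_ifs <;> simp
      _ = N := by simp
  rw [sum_crossing, abs_le]
  have h0 := key 0
  have h1 := key n
  constructor <;> linarith [h0.1, h0.2, h1.1, h1.2]

/-- Every jump at time `k` follows an edge that so far has been crossed more often in the direction
of the jump than in the other direction. -/
def Forward (x : ℕ → Fin N → V) (k : ℕ) : Prop :=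
  ∀ i, x (k + 1) i ≠ x k i → 0 < crossing x k (x k i) (x (k + 1) i)

theorem Forward.congr {k : ℕ} (h : Forward x k) (hxy : ∀ m ≤ k + 1, x m = y m) : Forward y k := by
  intro i hi
  rw [← hxy k (Nat.le_succ k), ← hxy (k + 1) le_rfl] at hi ⊢
  rw [← crossing_congr (fun m hm => hxy m (hm.trans (Nat.le_succ k)))]
  exact h i hi

theorem IsMove.forward_iff {k : ℕ} {i : Fin N} {b : V} (h : IsMove G x k i b) :
    Forward x k ↔ 0 < crossing x k (x k i) b := by
  refine ⟨fun hf => ?_, fun hb j hj => ?_⟩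
  · have := hf i (h.moved_iff.2 rfl)
    rwa [h.apply_self] at this
  · obtain rfl := h.moved_iff.1 hj
    rwa [h.apply_self]

/-- A forward jump never decreases a nonnegative crossing number. -/
theorem crossing_le_succ {k : ℕ} (hv : ∃ i b, IsMove G x k i b) (hf : Forward x k) {u v : V}
    (h0 : 0 ≤ crossing x k u v) : crossing x k u v ≤ crossing x (k + 1) u v := by
  obtain ⟨i, b, hm⟩ := hv
  rw [crossing_succ hm]
  have h2 : ¬ (x k i = v ∧ b = u) := by
    rintro ⟨rfl, rfl⟩
    have := hm.forward_iff.1 hf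
    rw [crossing_swap] at this
    omega
  rw [if_neg h2]
  split_ifs <;> simp

theorem crossing_mono_of_forward {n : ℕ} (hv : ∀ k ≥ n, ∃ i b, IsMove G x k i b)
    (hf : ∀ k ≥ n, Forward x k) {u v : V} (h0 : 0 ≤ crossing x n u v) {k l : ℕ} (hk : n ≤ k)
    (hkl : k ≤ l) : 0 ≤ crossing x k u v ∧ crossing x k u v ≤ crossing x l u v := by
  have h1 : ∀ k, n ≤ k → 0 ≤ crossing x k u v := by
    intro k hk
    induction k, hk using Nat.le_induction with
    | base => exact h0
    | succ k hk ih => exact ih.trans (crossing_le_succ (hv k hk) (hf k hk) ih)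
  refine ⟨h1 k hk, ?_⟩
  induction l, hkl using Nat.le_induction with
  | base => exact le_rfl
  | succ l hl ih =>
    exact ih.trans (crossing_le_succ (hv l (hk.trans hl)) (hf l (hk.trans hl)) (h1 l (hk.trans hl)))

theorem monot_of_forward (hv : ∀ k, ∃ i b, IsMove G x k i b)
    (hf : ∀ᶠ k in atTop, Forward x k) : Monot G x := by
  obtain ⟨n, hn⟩ := eventually_atTop.1 hf
  refine ⟨n, fun u v _ => ?_⟩
  rcases le_total 0 (crossing x n u v) with h0 | h0
  · left
    intro k hk l _ hkl
    exact (crossing_mono_of_forward (fun k _ => hv k) hn h0 hk hkl).2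
  · right
    intro k hk l _ hkl
    have := (crossing_mono_of_forward (u := v) (v := u) (fun k _ => hv k) hn
      (by rw [crossing_swap]; omega) hk hkl).2
    rw [crossing_swap, crossing_swap x l] at this
    simpa using this

theorem forward_of_monot [Finite V] (hv : ∀ k, ∃ i b, IsMove G x k i b)
    (hM : Monot G x) : ∀ᶠ k in atTop, Forward x k := by
  obtain ⟨m, hm⟩ := hM
  by_contra hcon
  rw [not_eventually] at hcon
  have h1 : ∃ᶠ k in atTop, ∃ e : Fin N × V × V, IsMove G x k e.1 e.2.2 ∧ x k e.1 = e.2.1 ∧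
      crossing x k e.2.1 e.2.2 ≤ 0 := by
    refine hcon.mono fun k hk => ?_
    obtain ⟨i, b, hmv⟩ := hv k
    rw [hmv.forward_iff, not_lt] at hk
    exact ⟨(i, x k i, b), hmv, rfl, hk⟩
  rw [frequently_exists] at h1
  obtain ⟨⟨i, a, b⟩, h2⟩ := h1
  simp only at h2
  rw [frequently_atTop] at h2
  have hmono : MonotoneOn (fun n => crossing x n a b) (Set.Ici m) := by
    obtain ⟨k, hk, hmv, rfl, -⟩ := h2 m
    rcases hm (x k i) b hmv.1 with h | h
    · exact h
    · have := h (a := k) hk (b := k + 1) (Set.mem_Ici.2 (by omega)) (by omega)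
      simp only [crossing_succ_self hmv] at this
      omega
  have hunb : ∀ j : ℕ, ∃ k ≥ m, crossing x m a b + j ≤ crossing x k a b := by
    intro j
    induction j with
    | zero => exact ⟨m, le_rfl, by simp⟩
    | succ j ih =>
      obtain ⟨k, hk, hj⟩ := ih
      obtain ⟨l, hl, hmv, rfl, -⟩ := h2 k
      refine ⟨l + 1, by omega, ?_⟩
      have := hmono (a := k) hk (b := l) (Set.mem_Ici.2 (by omega)) hl
      simp only at this
      rw [crossing_succ_self hmv]
      push_cast
      omega
  obtain ⟨k, hk, hj⟩ := hunb (|crossing x m a b| + 1).toNat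
  obtain ⟨l, hl, -, -, h0⟩ := h2 k
  have := hmono (a := k) hk (b := l) (Set.mem_Ici.2 (by omega)) hl
  simp only at this
  have h3 := neg_abs_le (crossing x m a b)
  have h4 := abs_nonneg (crossing x m a b)
  omega

end Paths

/-! ### One step of the walk -/

section Step

set_option linter.unusedSectionVars false

variable {V : Type*} [DecidableEq V] [Fintype V] {N : ℕ} {G : SimpleGraph V} [DecidableRel G.Adj]
  {W : ℤ → ℝ} {x y : ℕ → Fin N → V}

theorem jumpProb_nonneg (hW : ∀ k, 0 < W k) (x : ℕ → Fin N → V) (n : ℕ) (i : Fin N) (u : V) :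
    0 ≤ jumpProb G W x n i u := by
  unfold jumpProb
  split_ifs
  · exact div_nonneg (hW _).le (Finset.sum_nonneg fun w _ => (hW _).le)
  · exact le_rfl

theorem sum_weight_pos (hW : ∀ k, 0 < W k) (hd : ∀ a, ∃ b, G.Adj a b) (x : ℕ → Fin N → V) (n : ℕ)
    (a : V) : 0 < ∑ w ∈ G.neighborFinset a, W (crossing x n a w) := by
  obtain ⟨b, hb⟩ := hd a
  exact Finset.sum_pos (fun w _ => hW _) ⟨b, by simpa using hb⟩

/-- Averages over the jump of one walker, written as a quotient of weighted sums. -/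
theorem sum_jumpProb_smul {E : Type*} [AddCommGroup E] [Module ℝ E] (x : ℕ → Fin N → V) (n : ℕ)
    (i : Fin N) (f : V → E) :
    ∑ u, jumpProb G W x n i u • f u =
      (∑ w ∈ G.neighborFinset (x n i), W (crossing x n (x n i) w))⁻¹ •
        ∑ u ∈ G.neighborFinset (x n i), W (crossing x n (x n i) u) • f u := by
  rw [Finset.smul_sum, ← Finset.sum_subset (Finset.subset_univ (G.neighborFinset (x n i)))]
  · refine Finset.sum_congr rfl fun u hu => ?_
    rw [SimpleGraph.mem_neighborFinset] at hu
    rw [jumpProb, if_pos hu, smul_smul, div_eq_inv_mul]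
  · intro u _ hu
    rw [SimpleGraph.mem_neighborFinset] at hu
    rw [jumpProb, if_neg hu, zero_smul]

theorem sum_jumpProb (hW : ∀ k, 0 < W k) (hd : ∀ a, ∃ b, G.Adj a b) (x : ℕ → Fin N → V) (n : ℕ)
    (i : Fin N) : ∑ u, jumpProb G W x n i u = 1 := by
  have h := sum_jumpProb_smul (G := G) (W := W) x n i (fun _ => (1 : ℝ))
  simp only [smul_eq_mul, mul_one] at h
  rw [h, inv_mul_cancel₀ (sum_weight_pos hW hd x n _).ne']

theorem jumpProb_congr {n : ℕ} (h : ∀ m ≤ n, x m = y m) : jumpProb G W x n = jumpProb G W y n := by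
  funext i u
  have h' := h n le_rfl
  unfold jumpProb
  rw [← h']
  simp only [crossing_congr h]

theorem transProb_congr {n : ℕ} (h : ∀ m ≤ n, x m = y m) :
    transProb G W x n = transProb G W y n := by
  funext z
  unfold transProb
  simp only [h n le_rfl, jumpProb_congr h]

theorem transProb_nonneg (hW : ∀ k, 0 < W k) (x : ℕ → Fin N → V) (n : ℕ) (y : Fin N → V) :
    0 ≤ transProb G W x n y := by
  refine Finset.sum_nonneg fun i _ => mul_nonneg (by positivity) (Finset.sum_nonneg fun u _ => ?_)
  split_ifs
  · exact jumpProb_nonneg hW _ _ _ _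
  · exact le_rfl

theorem sum_transProb_smul {E : Type*} [AddCommGroup E] [Module ℝ E] (x : ℕ → Fin N → V) (n : ℕ)
    (f : (Fin N → V) → E) :
    ∑ y, transProb G W x n y • f y =
      ∑ i, (1 / (N : ℝ)) • ∑ u, jumpProb G W x n i u • f (Function.update (x n) i u) := by
  unfold transProb
  simp only [Finset.sum_smul, Finset.mul_sum, Finset.smul_sum]
  rw [Finset.sum_comm]
  refine Finset.sum_congr rfl fun i _ => ?_
  rw [Finset.sum_comm]
  refine Finset.sum_congr rfl fun u _ => ?_
  rw [Finset.sum_eq_single (Function.update (x n) i u)]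
  · simp [smul_smul]
  · intro z _ hz
    simp [hz]
  · simp

theorem transProb_ge (hW : ∀ k, 0 < W k) {k : ℕ} {i : Fin N} {b : V} (h : IsMove G x k i b) :
    1 / (N : ℝ) * jumpProb G W x k i b ≤ transProb G W x k (x (k + 1)) := by
  unfold transProb
  have hnn : ∀ j : Fin N, ∀ u, 0 ≤ if x (k + 1) = Function.update (x k) j u then
      jumpProb G W x k j u else 0 := fun j u => by
    split_ifs
    · exact jumpProb_nonneg hW _ _ _ _
    · exact le_rfl
  refine le_trans ?_ (Finset.single_le_sum (f := fun j => 1 / (N : ℝ) * ∑ u : V,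
    if x (k + 1) = Function.update (x k) j u then jumpProb G W x k j u else 0)
    (fun j _ => mul_nonneg (by positivity) (Finset.sum_nonneg fun u _ => hnn j u))
    (Finset.mem_univ i))
  refine mul_le_mul_of_nonneg_left ?_ (by positivity)
  refine le_trans ?_ (Finset.single_le_sum (f := fun u =>
    if x (k + 1) = Function.update (x k) i u then jumpProb G W x k i u else 0)
    (fun u _ => hnn i u) (Finset.mem_univ b))
  rw [if_pos h.2]

theorem exists_isMove_of_transProb_ne_zero {k : ℕ} (h : transProb G W x k (x (k + 1)) ≠ 0) :
    ∃ i b, IsMove G x k i b := by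
  obtain ⟨i, -, hi⟩ := Finset.exists_ne_zero_of_sum_ne_zero h
  obtain ⟨u, -, hu⟩ := Finset.exists_ne_zero_of_sum_ne_zero (right_ne_zero_of_mul hi)
  have h1 : x (k + 1) = Function.update (x k) i u := by
    by_contra hne
    simp [hne] at hu
  rw [if_pos h1] at hu
  refine ⟨i, u, ?_, h1⟩
  by_contra hne
  simp [jumpProb, hne] at hu

end Step

/-! ### Functions of finitely many positions -/

section Histories

set_option linter.unusedSectionVars false

variable {V : Type*} [DecidableEq V] [Fintype V] {N : ℕ} {G : SimpleGraph V} [DecidableRel G.Adj]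
  {W : ℤ → ℝ} {Ω : Type*} [mΩ : MeasurableSpace Ω] {μ : Measure Ω} {X : ℕ → Ω → Fin N → V}

/-- The event that the walk follows the trajectory `x` up to time `n`. -/
def cylinder (X : ℕ → Ω → Fin N → V) (n : ℕ) (x : ℕ → Fin N → V) : Set Ω :=
  {ω | ∀ m ≤ n, X m ω = x m}

/-- The positions up to time `n`. -/
def hist (X : ℕ → Ω → Fin N → V) (n : ℕ) (ω : Ω) (j : Fin (n + 1)) : Fin N → V := X j ω

/-- A finite history continued by resting forever. -/
def extendHist {n : ℕ} (z : Fin (n + 1) → Fin N → V) (m : ℕ) : Fin N → V :=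
  z ⟨min m n, Nat.lt_succ_of_le (min_le_right m n)⟩

theorem extendHist_hist {n m : ℕ} (hm : m ≤ n) (ω : Ω) : extendHist (hist X n ω) m = X m ω := by
  simp [extendHist, hist, hm]

theorem cylinder_extendHist (n : ℕ) (z : Fin (n + 1) → Fin N → V) :
    cylinder X n (extendHist z) = {ω | hist X n ω = z} := by
  ext ω
  refine ⟨fun h => ?_, ?_⟩
  · funext j
    have h1 := h j (Nat.le_of_lt_succ j.2)
    have h2 : min (j : ℕ) n = j := min_eq_left (Nat.le_of_lt_succ j.2)
    simp only [extendHist, h2] at h1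
    exact h1
  · rintro rfl m hm
    exact (extendHist_hist hm ω).symm

/-- The filtration generated by the walk. -/
def histFiltration (hX : ∀ (n : ℕ) (y : Fin N → V), MeasurableSet {ω | X n ω = y}) :
    Filtration ℕ mΩ where
  seq n := MeasurableSpace.comap (hist X n) ⊤
  mono' := by
    rintro n m hnm s ⟨S, -, rfl⟩
    refine ⟨(fun z (j : Fin (n + 1)) => z (Fin.castLE (Nat.succ_le_succ hnm) j)) ⁻¹' S, trivial, ?_⟩
    rfl
  le' := by
    rintro n s ⟨S, -, rfl⟩
    have : hist X n ⁻¹' S = ⋃ z ∈ S, ⋂ j : Fin (n + 1), {ω | X j ω = z j} := by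
      ext ω
      simp only [Set.mem_preimage, Set.mem_iUnion, Set.mem_iInter, Set.mem_ofPred_eq, exists_prop]
      refine ⟨fun h => ⟨_, h, fun j => rfl⟩, ?_⟩
      rintro ⟨z, hz, h⟩
      have : hist X n ω = z := funext h
      rwa [this]
    rw [this]
    exact MeasurableSet.biUnion (Set.to_countable S) fun z _ => MeasurableSet.iInter fun j => hX _ _

theorem measurableSet_of_congr (hX : ∀ (n : ℕ) (y : Fin N → V), MeasurableSet {ω | X n ω = y})
    (n : ℕ) (P : (ℕ → Fin N → V) → Prop) (hP : ∀ x y, (∀ m ≤ n, x m = y m) → P x → P y) :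
    MeasurableSet[histFiltration hX n] {ω | P (fun k => X k ω)} := by
  refine ⟨{z | P (extendHist z)}, trivial, ?_⟩
  ext ω
  exact ⟨hP _ _ fun m hm => extendHist_hist hm ω, hP _ _ fun m hm => (extendHist_hist hm ω).symm⟩

theorem measurableSet_cylinder (hX : ∀ (n : ℕ) (y : Fin N → V), MeasurableSet {ω | X n ω = y})
    (n : ℕ) (x : ℕ → Fin N → V) : MeasurableSet[histFiltration hX n] (cylinder X n x) :=
  measurableSet_of_congr hX n (fun y => ∀ m ≤ n, y m = x m)
    fun _ _ h h' m hm => (h m hm).symm.trans (h' m hm)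

variable [IsProbabilityMeasure μ]

/-- A function of the positions up to time `n` takes finitely many values. -/
theorem apply_eq_sum_indicator {E : Type*} [AddCommMonoid E] (n : ℕ)
    (F : (ℕ → Fin N → V) → E) (hF : ∀ x y, (∀ m ≤ n, x m = y m) → F x = F y) (ω : Ω) :
    F (fun k => X k ω) =
      ∑ z : Fin (n + 1) → Fin N → V, (cylinder X n (extendHist z)).indicator
        (fun _ => F (extendHist z)) ω := by
  rw [Finset.sum_eq_single (hist X n ω)]
  · rw [Set.indicator_of_mem]
    · exact hF _ _ fun m hm => (extendHist_hist hm ω).symm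
    · rw [cylinder_extendHist]
      rfl
  · intro z _ hz
    rw [Set.indicator_of_notMem]
    rw [cylinder_extendHist]
    exact fun h => hz h.symm
  · simp

theorem integrable_of_congr (hX : ∀ (n : ℕ) (y : Fin N → V), MeasurableSet {ω | X n ω = y})
    {E : Type*} [NormedAddCommGroup E] (n : ℕ)
    (F : (ℕ → Fin N → V) → E) (hF : ∀ x y, (∀ m ≤ n, x m = y m) → F x = F y) :
    Integrable (fun ω => F (fun k => X k ω)) μ := by
  simp_rw [apply_eq_sum_indicator (X := X) n F hF]
  exact integrable_finsetSum _ fun z _ => (integrable_const _).indicator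
    ((histFiltration hX).le n _ (measurableSet_cylinder hX n _))

theorem integral_of_congr (hX : ∀ (n : ℕ) (y : Fin N → V), MeasurableSet {ω | X n ω = y})
    {E : Type*} [NormedAddCommGroup E] [NormedSpace ℝ E] [CompleteSpace E] (n : ℕ)
    (F : (ℕ → Fin N → V) → E) (hF : ∀ x y, (∀ m ≤ n, x m = y m) → F x = F y) :
    ∫ ω, F (fun k => X k ω) ∂μ =
      ∑ z : Fin (n + 1) → Fin N → V, μ.real (cylinder X n (extendHist z)) • F (extendHist z) := by
  have hm : ∀ z : Fin (n + 1) → Fin N → V, MeasurableSet (cylinder X n (extendHist z)) := fun z =>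
    (histFiltration hX).le n _ (measurableSet_cylinder hX n _)
  simp_rw [apply_eq_sum_indicator (X := X) n F hF]
  rw [integral_finsetSum _ fun z _ => (integrable_const _).indicator (hm z)]
  exact Finset.sum_congr rfl fun z _ => integral_indicator_const _ (hm z)

/-- The one-step formula: the next position may be averaged out. -/
theorem integral_succ (hW : ∀ k, 0 < W k) (hX : IsAntRW G μ W X)
    {E : Type*} [NormedAddCommGroup E] [NormedSpace ℝ E] [CompleteSpace E] (n : ℕ)
    (F : (ℕ → Fin N → V) → E) (hF : ∀ x y, (∀ m ≤ n + 1, x m = y m) → F x = F y) :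
    ∫ ω, F (fun k => X k ω) ∂μ =
      ∫ ω, ∑ y, transProb G W (fun k => X k ω) n y •
        F (Function.update (fun k => X k ω) (n + 1) y) ∂μ := by
  have hm : ∀ (z : Fin (n + 1) → Fin N → V) y, MeasurableSet
      (cylinder X n (extendHist z) ∩ {ω | X (n + 1) ω = y}) :=
    fun z y => ((histFiltration hX.measurableSet_eq).le n _
      (measurableSet_cylinder hX.measurableSet_eq n _)).inter (hX.measurableSet_eq _ _)
  have h1 : ∀ ω, F (fun k => X k ω) = ∑ z : Fin (n + 1) → Fin N → V, ∑ y,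
      (cylinder X n (extendHist z) ∩ {ω | X (n + 1) ω = y}).indicator
        (fun _ => F (Function.update (extendHist z) (n + 1) y)) ω := by
    intro ω
    rw [Finset.sum_eq_single (hist X n ω), Finset.sum_eq_single (X (n + 1) ω)]
    · rw [Set.indicator_of_mem]
      · refine hF _ _ fun m hm => ?_
        rcases Nat.le_succ_iff.1 hm with h | h
        · rw [Function.update_of_ne (by omega), extendHist_hist h]
        · rw [h, Function.update_self]
      · rw [cylinder_extendHist]
        exact ⟨rfl, rfl⟩
    · intro y _ hy
      rw [Set.indicator_of_notMem]
      exact fun h => hy h.2.symm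
    · simp
    · intro z _ hz
      refine Finset.sum_eq_zero fun y _ => Set.indicator_of_notMem ?_ _
      rw [cylinder_extendHist]
      exact fun h => hz h.1.symm
    · simp
  rw [integral_of_congr hX.measurableSet_eq n (fun x => ∑ y, transProb G W x n y •
        F (Function.update x (n + 1) y)) ?_]
  · simp_rw [h1]
    rw [integral_finsetSum _ fun z _ => integrable_finsetSum _ fun y _ =>
      (integrable_const _).indicator (hm z y)]
    refine Finset.sum_congr rfl fun z _ => ?_
    rw [integral_finsetSum _ fun y _ => (integrable_const _).indicator (hm z y), Finset.smul_sum]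
    refine Finset.sum_congr rfl fun y _ => ?_
    rw [integral_indicator_const _ (hm z y), smul_smul]
    congr 1
    have := hX.transition n (extendHist z) y
    rw [measureReal_def, measureReal_def]
    have h2 : cylinder X n (extendHist z) ∩ {ω | X (n + 1) ω = y} =
      {ω | (∀ m ≤ n, X m ω = extendHist z m) ∧ X (n + 1) ω = y} := rfl
    rw [h2, this, ENNReal.toReal_mul, ENNReal.toReal_ofReal (transProb_nonneg hW _ _ _)]
    rfl
  · intro x y h
    simp only [transProb_congr h]
    refine Finset.sum_congr rfl fun z _ => congrArg _ (hF _ _ fun m hm => ?_)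
    rcases Nat.le_succ_iff.1 hm with h' | h'
    · rw [Function.update_of_ne (by omega), Function.update_of_ne (by omega), h m h']
    · rw [h', Function.update_self, Function.update_self]

/-- Almost surely, exactly one walker jumps at each time, and it jumps to a neighbour. -/
theorem ae_isMove (hX : IsAntRW G μ W X) :
    ∀ᵐ ω ∂μ, ∀ k, ∃ i b, IsMove G (fun n => X n ω) k i b := by
  rw [ae_all_iff]
  intro k
  rw [ae_iff]
  refine measure_mono_null (t := ⋃ z : Fin (k + 2) → Fin N → V, {ω | ω ∈ cylinder X (k + 1)
    (extendHist z) ∧ ¬ ∃ i b, IsMove G (extendHist z) k i b}) ?_ ?_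
  · intro ω hω
    simp only [Set.mem_iUnion]
    refine ⟨hist X (k + 1) ω, ?_, ?_⟩
    · rw [cylinder_extendHist]
      rfl
    · rintro ⟨i, b, h⟩
      exact hω ⟨i, b, h.congr (extendHist_hist (Nat.le_succ k) ω) (extendHist_hist le_rfl ω)⟩
  · refine measure_iUnion_null fun z => ?_
    by_cases hz : ∃ i b, IsMove G (extendHist z) k i b
    · simp [hz]
    · have h0 : transProb G W (extendHist z) k (extendHist z (k + 1)) = 0 := by
        by_contra h
        exact hz (exists_isMove_of_transProb_ne_zero h)
      have := hX.transition k (extendHist z) (extendHist z (k + 1))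
      rw [h0, ENNReal.ofReal_zero, mul_zero] at this
      refine measure_mono_null ?_ this
      rintro ω ⟨h, -⟩
      exact ⟨fun m hm => h m (hm.trans (Nat.le_succ k)), h _ le_rfl⟩

end Histories

/-! ### Multiplicative martingales -/

section Products

set_option linter.unusedSectionVars false

variable {V : Type*} [DecidableEq V] [Fintype V] {N : ℕ} {G : SimpleGraph V} [DecidableRel G.Adj]
  {W : ℤ → ℝ} {Ω : Type*} [mΩ : MeasurableSpace Ω] {μ : Measure Ω} {X : ℕ → Ω → Fin N → V}
  {x y : ℕ → Fin N → V}

/-- The factor `ψ k x i b` collected at time `k`, when walker `i` jumps to `b`. -/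
def jumpFactor {R : Type*} [AddCommMonoid R] (ψ : ℕ → (ℕ → Fin N → V) → Fin N → V → R) (k : ℕ)
    (x : ℕ → Fin N → V) : R :=
  ∑ i, if x (k + 1) i = x k i then 0 else ψ k x i (x (k + 1) i)

/-- The product of the factors collected during the time interval `[n, t)`. -/
def jumpProd {R : Type*} [CommSemiring R] (ψ : ℕ → (ℕ → Fin N → V) → Fin N → V → R) (n t : ℕ)
    (x : ℕ → Fin N → V) : R :=
  ∏ k ∈ Finset.Ico n t, jumpFactor ψ k x

theorem IsMove.jumpFactor_eq {R : Type*} [AddCommMonoid R]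
    (ψ : ℕ → (ℕ → Fin N → V) → Fin N → V → R) {k : ℕ} {i : Fin N} {b : V} (h : IsMove G x k i b) :
    jumpFactor ψ k x = ψ k x i b := by
  unfold jumpFactor
  rw [Finset.sum_eq_single i]
  · rw [if_neg (h.moved_iff.2 rfl), h.apply_self]
  · intro j _ hj
    rw [if_pos (h.apply_ne hj)]
  · simp

section
variable {R : Type*} [CommSemiring R] {ψ : ℕ → (ℕ → Fin N → V) → Fin N → V → R}

theorem jumpProd_self (n : ℕ) (x : ℕ → Fin N → V) : jumpProd ψ n n x = 1 := by
  simp [jumpProd]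

theorem jumpProd_succ {n t : ℕ} (h : n ≤ t) (x : ℕ → Fin N → V) :
    jumpProd ψ n (t + 1) x = jumpProd ψ n t x * jumpFactor ψ t x :=
  Finset.prod_Ico_succ_top h _

theorem jumpProd_congr (hψ : ∀ k x y, (∀ m ≤ k, x m = y m) → ψ k x = ψ k y) {n t : ℕ}
    (h : ∀ m ≤ t, x m = y m) : jumpProd ψ n t x = jumpProd ψ n t y := by
  refine Finset.prod_congr rfl fun k hk => Finset.sum_congr rfl fun i _ => ?_
  have hk' := (Finset.mem_Ico.1 hk).2
  rw [h k hk'.le, h (k + 1) hk', hψ k x y fun m hm => h m (hm.trans hk'.le)]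

end

theorem isMove_update (x : ℕ → Fin N → V) {t : ℕ} {i : Fin N} {b : V} (h : G.Adj (x t i) b) :
    IsMove G (Function.update x (t + 1) (Function.update (x t) i b)) t i b := by
  constructor
  · rwa [Function.update_of_ne (by omega)]
  · rw [Function.update_self, Function.update_of_ne (by omega)]

theorem jumpProd_update {R : Type*} [CommSemiring R] {ψ : ℕ → (ℕ → Fin N → V) → Fin N → V → R}
    (hψ : ∀ k x y, (∀ m ≤ k, x m = y m) → ψ k x = ψ k y) {n t : ℕ} (hnt : n ≤ t) {i : Fin N}
    {b : V} (h : G.Adj (x t i) b) :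
    jumpProd ψ n (t + 1) (Function.update x (t + 1) (Function.update (x t) i b)) =
      jumpProd ψ n t x * ψ t x i b := by
  have h1 : ∀ m ≤ t, Function.update x (t + 1) (Function.update (x t) i b) m = x m :=
    fun m hm => Function.update_of_ne (by omega) _ _
  rw [jumpProd_succ hnt, (isMove_update x h).jumpFactor_eq, jumpProd_congr hψ h1, hψ t _ x h1]

variable [IsProbabilityMeasure μ]

/-- Averaging out the last factor of a product. -/
theorem sum_transProb_jumpProd {𝕜 : Type*} [RCLike 𝕜]
    {ψ : ℕ → (ℕ → Fin N → V) → Fin N → V → 𝕜}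
    (hψ : ∀ k x y, (∀ m ≤ k, x m = y m) → ψ k x = ψ k y) {n t : ℕ} (hnt : n ≤ t)
    (x : ℕ → Fin N → V) :
    ∑ y, transProb G W x t y • jumpProd ψ n (t + 1) (Function.update x (t + 1) y) =
      jumpProd ψ n t x * ∑ i : Fin N, (1 / (N : ℝ)) • ∑ u, jumpProb G W x t i u • ψ t x i u := by
  rw [sum_transProb_smul, Finset.mul_sum]
  refine Finset.sum_congr rfl fun i _ => ?_
  rw [mul_smul_comm, Finset.mul_sum]
  congr 1
  refine Finset.sum_congr rfl fun u _ => ?_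
  by_cases hu : G.Adj (x t i) u
  · rw [jumpProd_update hψ hnt hu, mul_smul_comm]
  · simp [jumpProb, hu]

theorem integral_jumpProd (hN : 1 ≤ N) (hW : ∀ k, 0 < W k) (hX : IsAntRW G μ W X)
    {𝕜 : Type*} [RCLike 𝕜] {ψ : ℕ → (ℕ → Fin N → V) → Fin N → V → 𝕜}
    (hψ : ∀ k x y, (∀ m ≤ k, x m = y m) → ψ k x = ψ k y) (n : ℕ) (x₀ : ℕ → Fin N → V)
    (h1 : ∀ t ≥ n, ∀ x, ValidUpTo G x t → (∀ m ≤ n, x m = x₀ m) → jumpProd ψ n t x ≠ 0 →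
      ∀ i, ∑ u, jumpProb G W x t i u • ψ t x i u = 1) {t : ℕ} (ht : n ≤ t) :
    ∫ ω in cylinder X n x₀, jumpProd ψ n t (fun k => X k ω) ∂μ = μ.real (cylinder X n x₀) := by
  classical
  have hmc : MeasurableSet (cylinder X n x₀) := (histFiltration hX.measurableSet_eq).le n _
    (measurableSet_cylinder hX.measurableSet_eq n _)
  have hind : ∀ t, ∫ ω in cylinder X n x₀, jumpProd ψ n t (fun k => X k ω) ∂μ =
      ∫ ω, (fun x => if ∀ m ≤ n, x m = x₀ m then jumpProd ψ n t x else 0)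
        (fun k => X k ω) ∂μ := by
    intro t
    rw [← integral_indicator hmc]
    refine integral_congr_ae (ae_of_all _ fun ω => ?_)
    by_cases h : ∀ m ≤ n, X m ω = x₀ m
    · rw [Set.indicator_of_mem (show ω ∈ cylinder X n x₀ from h)]
      exact (if_pos h).symm
    · rw [Set.indicator_of_notMem (show ω ∉ cylinder X n x₀ from h)]
      exact (if_neg h).symm
  induction t, ht using Nat.le_induction with
  | base =>
    simp [jumpProd_self, RCLike.real_smul_eq_coe_mul]
  | succ t ht ih =>
    rw [← ih, hind, hind]
    refine (integral_succ hW hX t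
      (fun x => if ∀ m ≤ n, x m = x₀ m then jumpProd ψ n (t + 1) x else 0) ?_).trans ?_
    rotate_left
    · refine integral_congr_ae ?_
      filter_upwards [ae_isMove hX] with ω hω
      have hup : ∀ y, (∀ m ≤ n, Function.update (fun k => X k ω) (t + 1) y m = x₀ m) ↔
          ∀ m ≤ n, X m ω = x₀ m := fun y => forall₂_congr fun m hm => by
        rw [Function.update_of_ne (by omega)]
      simp only [hup]
      by_cases h : ∀ m ≤ n, X m ω = x₀ m
      · simp only [if_pos h]
        rw [sum_transProb_jumpProd hψ ht]
        by_cases h0 : jumpProd ψ n t (fun k => X k ω) = 0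
        · rw [h0, zero_mul]
        · have hN' : (N : ℝ) ≠ 0 := by positivity
          rw [Finset.sum_congr rfl fun i _ => by
            rw [h1 t ht _ (fun k _ => hω k) h h0 i], Finset.sum_const, Finset.card_univ,
            Fintype.card_fin, ← Nat.cast_smul_eq_nsmul ℝ, smul_smul, mul_one_div_cancel hN',
            one_smul, mul_one]
      · simp only [if_neg h, smul_zero, Finset.sum_const_zero]
    · intro x y hxy
      rw [jumpProd_congr hψ hxy]
      refine if_congr (forall₂_congr fun m hm => ?_) rfl rfl
      rw [hxy m (by omega)]

theorem jumpProd_nonneg {ψ : ℕ → (ℕ → Fin N → V) → Fin N → V → ℝ}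
    (h0 : ∀ k x i u, 0 ≤ ψ k x i u) (n t : ℕ) (x : ℕ → Fin N → V) : 0 ≤ jumpProd ψ n t x :=
  Finset.prod_nonneg fun k _ => Finset.sum_nonneg fun i _ => by
    split_ifs
    · exact le_rfl
    · exact h0 _ _ _ _

theorem integral_jumpProd_le (hW : ∀ k, 0 < W k) (hX : IsAntRW G μ W X)
    {ψ : ℕ → (ℕ → Fin N → V) → Fin N → V → ℝ} (h0 : ∀ k x i u, 0 ≤ ψ k x i u)
    (hψ : ∀ k x y, (∀ m ≤ k, x m = y m) → ψ k x = ψ k y) (n : ℕ)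
    (h1 : ∀ t ≥ n, ∀ x, ValidUpTo G x t →
      ∑ i : Fin N, 1 / (N : ℝ) * ∑ u, jumpProb G W x t i u * ψ t x i u ≤ 1) {t : ℕ} (ht : n ≤ t) :
    ∫ ω, jumpProd ψ n t (fun k => X k ω) ∂μ ≤ 1 := by
  induction t, ht using Nat.le_induction with
  | base => simp [jumpProd_self]
  | succ t ht ih =>
    refine le_trans ?_ ih
    rw [integral_succ hW hX t _ fun x y hxy => jumpProd_congr hψ hxy]
    refine integral_mono_ae ?_ ?_ ?_
    · refine integrable_of_congr hX.measurableSet_eq t (fun x => ∑ y, transProb G W x t y •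
        jumpProd ψ n (t + 1) (Function.update x (t + 1) y)) fun x y hxy => ?_
      rw [sum_transProb_jumpProd hψ ht, sum_transProb_jumpProd hψ ht, jumpProd_congr hψ hxy,
        hψ t x y hxy, jumpProb_congr hxy]
    · exact integrable_of_congr hX.measurableSet_eq t _ fun x y hxy => jumpProd_congr hψ hxy
    · filter_upwards [ae_isMove hX] with ω hω
      rw [sum_transProb_jumpProd hψ ht]
      exact mul_le_of_le_one_right (jumpProd_nonneg h0 _ _ _) (h1 t ht _ fun k _ => hω k)

/-- A nonnegative multiplicative supermartingale does not diverge to infinity. -/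
theorem ae_not_tendsto_jumpProd (hW : ∀ k, 0 < W k) (hX : IsAntRW G μ W X)
    {ψ : ℕ → (ℕ → Fin N → V) → Fin N → V → ℝ} (h0 : ∀ k x i u, 0 ≤ ψ k x i u)
    (hψ : ∀ k x y, (∀ m ≤ k, x m = y m) → ψ k x = ψ k y) (n : ℕ)
    (h1 : ∀ t ≥ n, ∀ x, ValidUpTo G x t →
      ∑ i : Fin N, 1 / (N : ℝ) * ∑ u, jumpProb G W x t i u * ψ t x i u ≤ 1) :
    ∀ᵐ ω ∂μ, ¬ Tendsto (fun t => jumpProd ψ n t (fun k => X k ω)) atTop atTop := by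
  have hint : ∀ t, Integrable (fun ω => jumpProd ψ n t (fun k => X k ω)) μ := fun t =>
    integrable_of_congr hX.measurableSet_eq t _ fun x y hxy => jumpProd_congr hψ hxy
  have hle : ∀ t ≥ n, ∫⁻ ω, ENNReal.ofReal (jumpProd ψ n t (fun k => X k ω)) ∂μ ≤ 1 := by
    intro t ht
    rw [← ofReal_integral_eq_lintegral_ofReal (hint t) (ae_of_all _ fun ω =>
      jumpProd_nonneg h0 _ _ _)]
    exact ENNReal.ofReal_le_one.2 (integral_jumpProd_le hW hX h0 hψ n h1 ht)
  have hfatou : ∫⁻ ω, liminf (fun t => ENNReal.ofReal (jumpProd ψ n t (fun k => X k ω))) atTop ∂μ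
      ≤ 1 := by
    refine (lintegral_liminf_le' fun t => (hint t).aemeasurable.ennreal_ofReal).trans ?_
    refine liminf_le_of_le (by isBoundedDefault) fun b hb => ?_
    obtain ⟨t, h2, h3⟩ := (hb.and (eventually_ge_atTop n)).exists
    exact h2.trans (hle t h3)
  have hmeas : AEMeasurable (fun ω => liminf (fun t => ENNReal.ofReal
      (jumpProd ψ n t (fun k => X k ω))) atTop) μ := by
    simp only [liminf_eq_iSup_iInf_of_nat]
    exact AEMeasurable.iSup fun n => AEMeasurable.iInf fun t => AEMeasurable.iInf fun _ =>
      (hint t).aemeasurable.ennreal_ofReal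
  have hae := ae_lt_top' hmeas
    (hfatou.trans_lt ENNReal.one_lt_top).ne
  filter_upwards [hae] with ω hω htend
  have h2 : Tendsto (fun t => ENNReal.ofReal (jumpProd ψ n t (fun k => X k ω))) atTop
      (nhds ⊤) := ENNReal.tendsto_ofReal_atTop.comp htend
  rw [h2.liminf_eq] at hω
  exact lt_irrefl _ hω

end Products

/-! ### Zero-one laws -/

section ZeroOne

set_option linter.unusedSectionVars false

variable {V : Type*} [DecidableEq V] [Fintype V] {N : ℕ} {G : SimpleGraph V} [DecidableRel G.Adj]
  {W : ℤ → ℝ} {Ω : Type*} [mΩ : MeasurableSpace Ω] {μ : Measure Ω} [IsProbabilityMeasure μ]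
  {X : ℕ → Ω → Fin N → V}

/-- A set measurable with respect to the positions up to time `n` is a finite union of
cylinders. -/
theorem measureReal_inter_le_of_cylinder
    (hX : ∀ (n : ℕ) (y : Fin N → V), MeasurableSet {ω | X n ω = y}) {A B : Set Ω} {θ : ℝ}
    (hA : MeasurableSet A) {n : ℕ}
    (h : ∀ x, μ.real (cylinder X n x ∩ A) ≤ θ * μ.real (cylinder X n x))
    (hB : MeasurableSet[histFiltration hX n] B) : μ.real (B ∩ A) ≤ θ * μ.real B := by
  classical
  obtain ⟨S, -, rfl⟩ := hB
  have hmc : ∀ z : Fin (n + 1) → Fin N → V, MeasurableSet (cylinder X n (extendHist z)) :=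
    fun z => (histFiltration hX).le n _ (measurableSet_cylinder hX n _)
  have hun : hist X n ⁻¹' S = ⋃ z ∈ Finset.univ.filter (· ∈ S), cylinder X n (extendHist z) := by
    ext ω
    simp [cylinder_extendHist]
  have hdisj : Set.PairwiseDisjoint (↑(Finset.univ.filter (· ∈ S)))
      fun z : Fin (n + 1) → Fin N → V => cylinder X n (extendHist z) := by
    intro z _ z' _ hne
    simp only [Function.onFun, cylinder_extendHist]
    refine Set.disjoint_left.2 fun ω h1 h2 => hne ?_
    exact (show hist X n ω = z from h1).symm.trans h2
  rw [hun, Set.iUnion₂_inter,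
    measureReal_biUnion_finset (hdisj.mono fun z => Set.inter_subset_left)
      (fun z _ => (hmc z).inter hA),
    measureReal_biUnion_finset hdisj (fun z _ => hmc z), Finset.mul_sum]
  exact Finset.sum_le_sum fun z _ => h _

/-- Lévy's zero-one law: an event of the walk whose conditional probability given the past stays
bounded away from one is null. -/
theorem measure_eq_zero_of_cylinder_le
    (hX : ∀ (n : ℕ) (y : Fin N → V), MeasurableSet {ω | X n ω = y}) {A : Set Ω}
    (hA : MeasurableSet[⨆ n, histFiltration hX n] A) {θ : ℝ} (hθ : θ < 1) (n₀ : ℕ)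
    (h : ∀ n ≥ n₀, ∀ x, μ.real (cylinder X n x ∩ A) ≤ θ * μ.real (cylinder X n x)) : μ A = 0 := by
  have hle : ⨆ n, histFiltration hX n ≤ mΩ := iSup_le fun n => (histFiltration hX).le n
  have hA' : MeasurableSet A := hle _ hA
  set g : Ω → ℝ := A.indicator fun _ => 1 with hg
  have hgi : Integrable g μ := (integrable_const _).indicator hA'
  have hbound : ∀ n ≥ n₀, ∀ᵐ ω ∂μ, μ[g | histFiltration hX n] ω ≤ θ := by
    intro n hn
    have hmn := (histFiltration hX).le n
    have hBm : MeasurableSet[histFiltration hX n] {ω | θ < μ[g | histFiltration hX n] ω} :=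
      stronglyMeasurable_condExp.measurable measurableSet_Ioi
    set B := {ω | θ < μ[g | histFiltration hX n] ω} with hB
    have h1 : ∫ ω in B, μ[g | histFiltration hX n] ω ∂μ = μ.real (B ∩ A) := by
      rw [setIntegral_condExp hmn hgi hBm, hg, integral_indicator_const _ hA', smul_eq_mul, mul_one,
        measureReal_restrict_apply hA', Set.inter_comm]
    have h2 := measureReal_inter_le_of_cylinder (μ := μ) hX hA' (h n hn) hBm
    have h3 : ∫ ω in B, (μ[g | histFiltration hX n] ω - θ) ∂μ ≤ 0 := by
      rw [integral_sub integrable_condExp.integrableOn (integrable_const _), h1, setIntegral_const,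
        smul_eq_mul]
      linarith
    have h4 : ∀ᵐ ω ∂(μ.restrict B), 0 < μ[g | histFiltration hX n] ω - θ := by
      filter_upwards [ae_restrict_mem (hmn _ hBm)] with ω hω
      exact sub_pos.2 hω
    have h5 := (integral_eq_zero_iff_of_nonneg_ae (h4.mono fun ω hω => hω.le)
      ((integrable_condExp.sub (integrable_const _)).integrableOn)).1
      (le_antisymm h3 (integral_nonneg_of_ae (h4.mono fun ω hω => hω.le)))
    have h6 : ∀ᵐ ω ∂(μ.restrict B), False := by
      filter_upwards [h4, h5] with ω h7 h8
      exact h7.ne' h8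
    rw [ae_iff] at h6
    simp only [not_false_eq_true] at h6
    have h7 : μ B = 0 := by simpa using h6
    rw [ae_iff]
    simpa only [not_le] using h7
  have hlim := hgi.tendsto_ae_condExp (ℱ := histFiltration hX)
    (stronglyMeasurable_const.indicator hA)
  have hall : ∀ᵐ ω ∂μ, ∀ n ≥ n₀, μ[g | histFiltration hX n] ω ≤ θ := by
    rw [ae_all_iff]
    intro n
    by_cases hn : n₀ ≤ n
    · filter_upwards [hbound n hn] with ω hω _ using hω
    · exact ae_of_all _ fun ω hn' => absurd hn' hn
  have hfin : ∀ᵐ ω ∂μ, ω ∉ A := by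
    filter_upwards [hlim, hall] with ω h1 h2 hω
    have h3 := le_of_tendsto h1 (eventually_atTop.2 ⟨n₀, fun n hn => h2 n hn⟩)
    rw [hg, Set.indicator_of_mem hω] at h3
    linarith
  simpa [ae_iff] using hfin

/-- Events described by infinitely many conditions, each on finitely many positions. -/
theorem measurableSet_forall_ge (hX : ∀ (n : ℕ) (y : Fin N → V), MeasurableSet {ω | X n ω = y})
    (n : ℕ) (P : ℕ → (ℕ → Fin N → V) → Prop)
    (hP : ∀ k x y, (∀ m ≤ k + 1, x m = y m) → P k x → P k y) :
    MeasurableSet[⨆ n, histFiltration hX n] {ω | ∀ k ≥ n, P k (fun j => X j ω)} := by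
  have : {ω | ∀ k ≥ n, P k (fun j => X j ω)} = ⋂ k, {ω | k ≥ n → P k (fun j => X j ω)} := by
    ext ω
    simp
  rw [this]
  refine MeasurableSet.iInter fun k => ?_
  exact le_iSup (fun n => (histFiltration hX n)) (k + 1) _
    (measurableSet_of_congr hX (k + 1) (fun x => k ≥ n → P k x)
      fun x y h h' hk => hP k x y h (h' hk))

theorem measurableSet_eventually (hX : ∀ (n : ℕ) (y : Fin N → V), MeasurableSet {ω | X n ω = y})
    (P : ℕ → (ℕ → Fin N → V) → Prop)
    (hP : ∀ k x y, (∀ m ≤ k + 1, x m = y m) → P k x → P k y) :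
    MeasurableSet[⨆ n, histFiltration hX n] {ω | ∀ᶠ k in atTop, P k (fun j => X j ω)} := by
  simp only [eventually_atTop, Set.ofPred_exists]
  exact MeasurableSet.iUnion fun n => measurableSet_forall_ge hX n P hP

end ZeroOne

/-! ### Outflow of a vertex under forward jumps -/

section Outflow

set_option linter.unusedSectionVars false

variable {V : Type*} [DecidableEq V] [Fintype V] {N : ℕ} {G : SimpleGraph V}
  {x : ℕ → Fin N → V}

/-- Under a forward jump, a sum over the positive crossing numbers out of `a` changes only if the
jump starts at `a`. -/
theorem sum_crossing_succ {R : Type*} [AddCommGroup R] (f : ℤ → R) (hf : ∀ c ≤ 0, f c = f 0)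
    {k : ℕ} {i : Fin N} {b : V} (h : IsMove G x k i b) (hfw : Forward x k) (a : V) :
    ∑ w, f (crossing x (k + 1) a w) = ∑ w, f (crossing x k a w) +
      if x k i = a then f (crossing x k a b + 1) - f (crossing x k a b) else 0 := by
  by_cases ha : x k i = a
  · subst ha
    rw [if_pos rfl, ← Finset.add_sum_erase _ _ (Finset.mem_univ b),
      ← Finset.add_sum_erase (a := b) _ (fun w => f (crossing x k (x k i) w)) (Finset.mem_univ b),
      crossing_succ_self h]
    have : ∑ w ∈ Finset.univ.erase b, f (crossing x (k + 1) (x k i) w) =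
        ∑ w ∈ Finset.univ.erase b, f (crossing x k (x k i) w) := by
      refine Finset.sum_congr rfl fun w hw => ?_
      rw [crossing_succ_of_ne h]
      · rintro ⟨-, rfl⟩
        exact Finset.ne_of_mem_erase hw rfl
      · rintro ⟨-, h2⟩
        exact h.1.ne h2.symm
    rw [this]
    abel
  · rw [if_neg ha, add_zero]
    refine Finset.sum_congr rfl fun w _ => ?_
    by_cases hw : x k i = w ∧ b = a
    · obtain ⟨rfl, rfl⟩ := hw
      have h0 := h.forward_iff.1 hfw
      have h1 := crossing_succ_self h
      rw [crossing_swap x (k + 1) (x k i), crossing_swap x k (x k i)]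
      exact (hf _ (by omega)).trans (hf _ (by omega)).symm
    · rw [crossing_succ_of_ne h (fun h' => ha h'.1) hw]

/-- The total of the positive crossing numbers out of `a`. -/
def outflow (x : ℕ → Fin N → V) (k : ℕ) (a : V) : ℤ := ∑ w, max (crossing x k a w) 0

theorem outflow_succ {k : ℕ} {i : Fin N} {b : V} (h : IsMove G x k i b) (hfw : Forward x k)
    (a : V) : outflow x (k + 1) a = outflow x k a + if x k i = a then 1 else 0 := by
  unfold outflow
  rw [sum_crossing_succ (fun c => max c 0) (fun c hc => by simp [hc]) h hfw]
  split_ifs with ha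
  · have := h.forward_iff.1 hfw
    rw [ha] at this
    omega
  · rfl

theorem outflow_nonneg (x : ℕ → Fin N → V) (k : ℕ) (a : V) : 0 ≤ outflow x k a :=
  Finset.sum_nonneg fun _ _ => le_max_right _ _

theorem crossing_le_outflow (x : ℕ → Fin N → V) (k : ℕ) (a w : V) :
    crossing x k a w ≤ outflow x k a :=
  (le_max_left _ _).trans (Finset.single_le_sum (f := fun w => max (crossing x k a w) 0)
    (fun _ _ => le_max_right _ _) (Finset.mem_univ w))

theorem outflow_le_card_mul (x : ℕ → Fin N → V) (k : ℕ) (a : V) {B : ℤ} (h0 : 0 ≤ B)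
    (h : ∀ w, crossing x k a w ≤ B) : outflow x k a ≤ Fintype.card V * B := by
  refine (Finset.sum_le_card_nsmul _ _ B fun w _ => max_le (h w) h0).trans ?_
  simp

/-- Inflow and outflow differ by at most the number of walkers. -/
theorem abs_outflow_sub_inflow_le (x : ℕ → Fin N → V) (k : ℕ) (a : V) :
    |outflow x k a - ∑ w, max (crossing x k w a) 0| ≤ N := by
  unfold outflow
  rw [← Finset.sum_sub_distrib]
  convert abs_sum_crossing_le x k a using 3 with w
  rw [crossing_swap x k a w]
  omega

theorem neg_crossing_le_outflow (x : ℕ → Fin N → V) (k : ℕ) (a w : V) :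
    -crossing x k a w ≤ outflow x k a + N := by
  have h1 : crossing x k w a ≤ ∑ w, max (crossing x k w a) 0 :=
    (le_max_left _ _).trans (Finset.single_le_sum (f := fun w => max (crossing x k w a) 0)
      (fun _ _ => le_max_right _ _) (Finset.mem_univ w))
  have h2 := abs_le.1 (abs_outflow_sub_inflow_le x k a)
  rw [← crossing_swap]
  linarith [h2.1]

theorem exists_crossing_lt_of_outflow (x : ℕ → Fin N → V) (k : ℕ) (a : V)
    (h : N < outflow x k a) :
    ∃ w, crossing x k a w < 0 ∧ outflow x k a - N ≤ Fintype.card V * -crossing x k a w := by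
  by_contra! hcon
  have h2 := abs_le.1 (abs_outflow_sub_inflow_le x k a)
  obtain ⟨w, -, hw⟩ := Finset.exists_max_image Finset.univ (fun w => max (crossing x k w a) 0)
    ⟨a, Finset.mem_univ a⟩
  have h3 : ∑ w, max (crossing x k w a) 0 ≤ Fintype.card V * max (crossing x k w a) 0 := by
    refine (Finset.sum_le_card_nsmul _ _ _ fun v _ => hw v (Finset.mem_univ v)).trans ?_
    simp
  rcases le_or_gt (crossing x k w a) 0 with h0 | h0
  · rw [max_eq_right h0] at h3
    linarith [h2.2]
  · rw [max_eq_left h0.le] at h3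
    have := hcon w (by rw [crossing_swap]; omega)
    rw [← crossing_swap] at this
    linarith [h2.2]

theorem exists_frequently_departure (hv : ∀ k, ∃ i b, IsMove G x k i b) :
    ∃ a, ∃ᶠ k in atTop, ∃ i b, IsMove G x k i b ∧ x k i = a := by
  have : ∃ᶠ k in (atTop : Filter ℕ), ∃ a, ∃ i b, IsMove G x k i b ∧ x k i = a :=
    Frequently.of_forall fun k => by
      obtain ⟨i, b, h⟩ := hv k
      exact ⟨x k i, i, b, h, rfl⟩
  exact frequently_exists.1 this

theorem tendsto_outflow {n : ℕ} (hv : ∀ k, ∃ i b, IsMove G x k i b)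
    (hfw : ∀ k ≥ n, Forward x k) {a : V} (ha : ∃ᶠ k in atTop, ∃ i b, IsMove G x k i b ∧ x k i = a) :
    Tendsto (fun k => outflow x k a) atTop atTop := by
  have hmono : ∀ k ≥ n, outflow x k a ≤ outflow x (k + 1) a := by
    intro k hk
    obtain ⟨i, b, h⟩ := hv k
    rw [outflow_succ h (hfw k hk)]
    split_ifs <;> simp
  have hmono' : ∀ k ≥ n, ∀ l ≥ k, outflow x k a ≤ outflow x l a := by
    intro k hk l hl
    induction l, hl using Nat.le_induction with
    | base => exact le_rfl
    | succ l hl ih => exact ih.trans (hmono l (hk.trans hl))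
  have hunb : ∀ j : ℕ, ∃ k ≥ n, (j : ℤ) ≤ outflow x k a := by
    intro j
    induction j with
    | zero => exact ⟨n, le_rfl, by simpa using outflow_nonneg x n a⟩
    | succ j ih =>
      obtain ⟨k, hk, hj⟩ := ih
      obtain ⟨l, hl, i, b, h, hi⟩ := frequently_atTop.1 ha k
      refine ⟨l + 1, by omega, ?_⟩
      rw [outflow_succ h (hfw l (hk.trans hl)), if_pos hi]
      have := hmono' k hk l hl
      push_cast
      linarith
  refine tendsto_atTop.2 fun c => ?_
  obtain ⟨k, hk, hc⟩ := hunb c.toNat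
  filter_upwards [eventually_ge_atTop k] with l hl
  have := hmono' k hk l hl
  have := Int.self_le_toNat c
  omega

end Outflow

/-! ### No monotone regime when `p ≤ 1 + q` -/

section NotMonot

set_option linter.unusedSectionVars false

variable {V : Type*} [DecidableEq V] [Fintype V] {N : ℕ} {G : SimpleGraph V} [DecidableRel G.Adj]
  {W : ℤ → ℝ} {Ω : Type*} [mΩ : MeasurableSpace Ω] {μ : Measure Ω} [IsProbabilityMeasure μ]
  {X : ℕ → Ω → Fin N → V} {x y : ℕ → Fin N → V}

/-- The total weight of the edges at `a` that so far have mostly been crossed towards `a`. -/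
noncomputable def backWeight (G : SimpleGraph V) [DecidableRel G.Adj] (W : ℤ → ℝ) (k : ℕ)
    (x : ℕ → Fin N → V) (a : V) : ℝ :=
  ∑ w ∈ G.neighborFinset a, if crossing x k a w < 0 then W (crossing x k a w) else 0

/-- The factor is zero for jumps that are not forward; the mass that the forbidden jumps against
the flow would carry is distributed evenly over the forward edges. -/
noncomputable def backFactor (G : SimpleGraph V) [DecidableRel G.Adj] (W : ℤ → ℝ) (k : ℕ)
    (x : ℕ → Fin N → V) (i : Fin N) (u : V) : ℝ :=
  if 0 < crossing x k (x k i) u then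
    1 + backWeight G W k x (x k i) / (Fintype.card V * W (crossing x k (x k i) u)) else 0

theorem backWeight_nonneg (hW : ∀ k, 0 < W k) (k : ℕ) (x : ℕ → Fin N → V) (a : V) :
    0 ≤ backWeight G W k x a :=
  Finset.sum_nonneg fun w _ => by
    split_ifs
    · exact (hW _).le
    · exact le_rfl

theorem backFactor_congr {k : ℕ} (h : ∀ m ≤ k, x m = y m) :
    backFactor G W k x = backFactor G W k y := by
  have h' := h k le_rfl
  funext i u
  unfold backFactor backWeight
  rw [← h']
  simp only [crossing_congr h]

theorem backFactor_nonneg (hW : ∀ k, 0 < W k) (k : ℕ) (x : ℕ → Fin N → V) (i : Fin N) (u : V) :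
    0 ≤ backFactor G W k x i u := by
  unfold backFactor
  split_ifs
  · have := backWeight_nonneg (G := G) hW k x (x k i)
    have := (hW (crossing x k (x k i) u)).le
    positivity
  · exact le_rfl

theorem sum_jumpProb_backFactor_le (hW : ∀ k, 0 < W k) (hd : ∀ a, ∃ b, G.Adj a b) (k : ℕ)
    (x : ℕ → Fin N → V) (i : Fin N) :
    ∑ u, jumpProb G W x k i u * backFactor G W k x i u ≤ 1 := by
  have h := sum_jumpProb_smul (G := G) (W := W) x k i (fun u => backFactor G W k x i u)
  simp only [smul_eq_mul] at h
  rw [h]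
  have hS := sum_weight_pos hW hd x k (x k i)
  rw [inv_mul_le_iff₀ hS, mul_one]
  have : Nonempty V := ⟨x k i⟩
  have hM : (0 : ℝ) < Fintype.card V := by exact_mod_cast Fintype.card_pos
  set A := backWeight G W k x (x k i) with hA
  have hA0 : 0 ≤ A := backWeight_nonneg hW _ _ _
  have h1 : ∀ u ∈ G.neighborFinset (x k i), W (crossing x k (x k i) u) * backFactor G W k x i u +
      (if crossing x k (x k i) u < 0 then W (crossing x k (x k i) u) else 0) ≤
      W (crossing x k (x k i) u) + A / Fintype.card V := by
    intro u _
    have hu := hW (crossing x k (x k i) u)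
    have hAM : 0 ≤ A / Fintype.card V := by positivity
    unfold backFactor
    rcases lt_trichotomy (crossing x k (x k i) u) 0 with h0 | h0 | h0
    · rw [if_neg (by omega), if_pos h0]
      linarith
    · rw [if_neg (by omega), if_neg (by omega)]
      linarith
    · rw [if_pos h0, if_neg (by omega), ← hA]
      apply le_of_eq
      field_simp
      ring
  have h2 := Finset.sum_le_sum h1
  rw [Finset.sum_add_distrib, Finset.sum_add_distrib] at h2
  have h3 : ∑ _u ∈ G.neighborFinset (x k i), A / (Fintype.card V : ℝ) ≤ A := by
    rw [Finset.sum_const, nsmul_eq_mul]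
    have : ((G.neighborFinset (x k i)).card : ℝ) ≤ Fintype.card V := by
      exact_mod_cast Finset.card_le_univ _
    calc _ ≤ (Fintype.card V : ℝ) * (A / Fintype.card V) := by gcongr
      _ = A := by field_simp
  have h4 : ∑ u ∈ G.neighborFinset (x k i),
    (if crossing x k (x k i) u < 0 then W (crossing x k (x k i) u) else 0) = A := rfl
  linarith

theorem one_add_sum_le_prod {f g : ℕ → ℝ} {n : ℕ} (hg : ∀ k ≥ n, 0 ≤ g k)
    (hf : ∀ k ≥ n, 1 + g k ≤ f k) {t : ℕ} (ht : n ≤ t) :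
    1 + ∑ k ∈ Finset.Ico n t, g k ≤ ∏ k ∈ Finset.Ico n t, f k := by
  induction t, ht using Nat.le_induction with
  | base => simp
  | succ t ht ih =>
    rw [Finset.sum_Ico_succ_top ht, Finset.prod_Ico_succ_top ht]
    have h0 : 0 ≤ ∑ k ∈ Finset.Ico n t, g k :=
      Finset.sum_nonneg fun k hk => hg k (Finset.mem_Ico.1 hk).1
    have h1 := hg t ht
    calc _ ≤ (1 + ∑ k ∈ Finset.Ico n t, g k) * (1 + g t) := by nlinarith
      _ ≤ _ := mul_le_mul ih (hf t ht) (by linarith) (by linarith)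

theorem rpow_succ_sub_le {s B : ℝ} (hs : 1 ≤ s) (hB : 1 ≤ B) :
    (B + 1) ^ s - B ^ s ≤ 2 ^ s * B ^ (s - 1) := by
  have hB0 : 0 < B := by linarith
  have ht : 0 ≤ 1 - B⁻¹ := by
    have := inv_le_one_of_one_le₀ hB
    linarith
  have h1 := (convexOn_rpow hs).2 (x := 1) (y := 2) (by simp) (by simp)
    ht (inv_nonneg.2 hB0.le) (by ring)
  simp only [smul_eq_mul, mul_one, Real.one_rpow] at h1
  have h2 : B + 1 = B * (1 - B⁻¹ + B⁻¹ * 2) := by field_simp; ring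
  rw [h2, Real.mul_rpow hB0.le (by positivity), Real.rpow_sub hB0, Real.rpow_one]
  have hBs : 0 < B ^ s := Real.rpow_pos_of_pos hB0 s
  have h3 : B ^ s * (1 - B⁻¹ + B⁻¹ * 2) ^ s ≤ B ^ s * (1 - B⁻¹ + B⁻¹ * 2 ^ s) :=
    mul_le_mul_of_nonneg_left h1 hBs.le
  have h4 : B ^ s * (1 - B⁻¹ + B⁻¹ * 2 ^ s) = B ^ s - B ^ s * B⁻¹ + 2 ^ s * (B ^ s / B) := by
    field_simp
  have h5 : 0 ≤ B ^ s * B⁻¹ := by positivity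
  linarith

/-- This is where `p ≤ 1 + q` enters: with outflow `F` at a vertex and `B` on the edge taken, the
weight `F ^ q` of the reversed edges relative to `B ^ p` is at least the relative increment of
`∑ B ^ s`, up to a constant. -/
theorem rpow_sub_one_mul_le {p q B F : ℝ} (hpq : p ≤ 1 + q) (hB : 1 ≤ B) (hBF : B ≤ F) :
    B ^ (1 + max (-p) 0 - 1) * F ^ (-(1 + max (-p) 0)) ≤ F ^ q * B ^ (-p) := by
  have hB0 : 0 < B := by linarith
  have hF0 : 0 < F := by linarith
  have hF1 : 1 ≤ F := hB.trans hBF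
  rcases le_total p 0 with h | h
  · rw [max_eq_left (by linarith), mul_comm (F ^ q)]
    refine mul_le_mul (le_of_eq (by ring_nf)) ?_ (by positivity) (by positivity)
    exact Real.rpow_le_rpow_of_exponent_le hF1 (by linarith)
  · rw [max_eq_right (by linarith)]
    simp only [add_zero, sub_self, Real.rpow_zero, one_mul]
    calc F ^ (-1 : ℝ) = F ^ (p - 1) * F ^ (-p) := by
          rw [← Real.rpow_add hF0]; ring_nf
      _ ≤ F ^ q * B ^ (-p) := mul_le_mul (Real.rpow_le_rpow_of_exponent_le hF1 (by linarith))
          (Real.rpow_le_rpow_of_nonpos hB0 hBF (by linarith)) (by positivity) (by positivity)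

/-- As long as all jumps are forward, the factors at a vertex that is left infinitely often
multiply up to infinity. -/
theorem tendsto_jumpProd_backFactor {p q : ℝ} (hpq : p ≤ 1 + q) (hW : ∀ k, 0 < W k)
    (hWp : ∀ k : ℤ, 0 < k → W k = (k : ℝ) ^ p) (hWq : ∀ k : ℤ, 0 < k → W (-k) = (k : ℝ) ^ q)
    (hv : ∀ k, ∃ i b, IsMove G x k i b) {n : ℕ} (hfw : ∀ k ≥ n, Forward x k) :
    Tendsto (fun t => jumpProd (backFactor G W) n t x) atTop atTop := by
  obtain ⟨a, ha⟩ := exists_frequently_departure hv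
  have hF := tendsto_outflow hv hfw ha
  have : Nonempty V := ⟨a⟩
  set M : ℝ := (Fintype.card V : ℝ) with hM
  have hM0 : 0 < M := by
    rw [hM]
    exact_mod_cast Fintype.card_pos
  have hM1 : 1 ≤ M := by
    rw [hM]
    exact_mod_cast Fintype.card_pos
  set s : ℝ := 1 + max (-p) 0 with hs
  have hs1 : 1 ≤ s := by
    have := le_max_right (-p) 0
    linarith
  set f : ℤ → ℝ := fun c => (max (c : ℝ) 0) ^ s with hf
  have hf0 : ∀ c ≤ 0, f c = f 0 := by
    intro c hc
    have : (c : ℝ) ≤ 0 := by exact_mod_cast hc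
    simp [hf, this]
  have hfpos : ∀ c, 0 ≤ f c := fun c => Real.rpow_nonneg (le_max_right _ _) _
  set Q : ℕ → ℝ := fun k => ∑ w, f (crossing x k a w) with hQ
  have hQF : ∀ k, ((outflow x k a : ℝ) / M) ^ s ≤ Q k := by
    intro k
    obtain ⟨w, -, hw⟩ := Finset.exists_max_image Finset.univ (fun w => max (crossing x k a w) 0)
      ⟨a, Finset.mem_univ a⟩
    have h1 : outflow x k a ≤ Fintype.card V * max (crossing x k a w) 0 := by
      refine (Finset.sum_le_card_nsmul _ _ _ fun v _ => hw v (Finset.mem_univ v)).trans ?_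
      simp
    have h2 : (outflow x k a : ℝ) ≤ M * max (crossing x k a w : ℝ) 0 := by
      have : (outflow x k a : ℝ) ≤ ((Fintype.card V * max (crossing x k a w) 0 : ℤ) : ℝ) := by
        exact_mod_cast h1
      push_cast at this
      exact this
    have h3 : (outflow x k a : ℝ) / M ≤ max (crossing x k a w : ℝ) 0 := by
      rw [div_le_iff₀ hM0]
      linarith
    have h0 : (0 : ℝ) ≤ outflow x k a := by exact_mod_cast outflow_nonneg x k a
    refine (Real.rpow_le_rpow (by positivity) h3 (by linarith)).trans ?_
    exact Finset.single_le_sum (f := fun w => f (crossing x k a w)) (fun _ _ => hfpos _)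
      (Finset.mem_univ w)
  obtain ⟨n₁, hn₁⟩ := eventually_atTop.1 (hF.eventually_ge_atTop (2 * N + 1))
  set α : ℝ := min ((1 / (2 * M)) ^ q) (2 ^ q) with hα
  have hα0 : 0 < α := lt_min (by positivity) (by positivity)
  set κ : ℝ := α / (M * (2 ^ s * M ^ s)) with hκ
  have hκ0 : 0 < κ := by positivity
  set g : ℕ → ℝ := fun k => jumpFactor (backFactor G W) k x - 1 with hg
  have hg0 : ∀ k ≥ n, 0 ≤ g k := by
    intro k hk
    obtain ⟨i, b, h⟩ := hv k
    simp only [hg]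
    rw [h.jumpFactor_eq, backFactor, if_pos (h.forward_iff.1 (hfw k hk))]
    have := backWeight_nonneg (G := G) hW k x (x k i)
    have := (hW (crossing x k (x k i) b)).le
    have : 0 ≤ backWeight G W k x (x k i) /
      ((Fintype.card V : ℝ) * W (crossing x k (x k i) b)) := by positivity
    linarith
  have hlog : ∀ k ≥ max n n₁, κ * (Real.log (Q (k + 1)) - Real.log (Q k)) ≤ g k := by
    intro k hk
    have hkn : n ≤ k := (le_max_left _ _).trans hk
    have hF1 := hn₁ k ((le_max_right _ _).trans hk)
    obtain ⟨i, b, h⟩ := hv k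
    have hfk := hfw k hkn
    have hstep : Q (k + 1) = Q k + _ := sum_crossing_succ f hf0 h hfk a
    by_cases hi : x k i = a
    · rw [if_pos hi] at hstep
      have hB := h.forward_iff.1 hfk
      rw [hi] at hB
      set B : ℝ := (crossing x k a b : ℝ) with hBdef
      set F : ℝ := (outflow x k a : ℝ) with hFdef
      have hB1 : 1 ≤ B := by
        rw [hBdef]
        exact_mod_cast hB
      have hBF : B ≤ F := by
        rw [hBdef, hFdef]
        exact_mod_cast crossing_le_outflow x k a b
      have hF0 : 0 < F := by linarith
      have hFN : 2 * (N : ℝ) + 1 ≤ F := by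
        rw [hFdef]
        exact_mod_cast hF1
      have hQk := hQF k
      have hFM : 0 < (F / M) ^ s := by positivity
      have hQ0 : 0 < Q k := hFM.trans_le hQk
      have hdiff : f (crossing x k a b + 1) - f (crossing x k a b) ≤ 2 ^ s * B ^ (s - 1) := by
        have e1 : f (crossing x k a b) = B ^ s := by
          simp only [hf]
          rw [max_eq_left (by linarith)]
        have e2 : f (crossing x k a b + 1) = (B + 1) ^ s := by
          simp only [hf]
          push_cast
          rw [max_eq_left (by linarith)]
        rw [e1, e2]
        exact rpow_succ_sub_le hs1 hB1
      have hdiff0 : 0 ≤ f (crossing x k a b + 1) - f (crossing x k a b) := by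
        refine sub_nonneg.2 (Real.rpow_le_rpow (le_max_right _ _) ?_ (by linarith))
        refine max_le_max ?_ le_rfl
        push_cast
        linarith
      have hlog1 : Real.log (Q (k + 1)) - Real.log (Q k) ≤
          2 ^ s * B ^ (s - 1) / (F / M) ^ s := by
        rw [← Real.log_div (by linarith) hQ0.ne']
        refine (Real.log_le_sub_one_of_pos (div_pos (by linarith) hQ0)).trans ?_
        rw [hstep, add_div, div_self hQ0.ne', add_sub_cancel_left]
        exact div_le_div₀ (by positivity) hdiff hFM hQk
      -- a heavily used reversed edge carries the weight `F ^ q` up to a constant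
      have hA : α * F ^ q ≤ backWeight G W k x a := by
        obtain ⟨w, hw0, hw⟩ := exists_crossing_lt_of_outflow x k a (by omega)
        have hwu := neg_crossing_le_outflow x k a w
        set D : ℝ := -(crossing x k a w : ℝ) with hD
        have hD0 : 0 < D := by
          have : (crossing x k a w : ℝ) < 0 := by exact_mod_cast hw0
          linarith
        have hDl : F - N ≤ M * D := by
          have : ((outflow x k a - N : ℤ) : ℝ) ≤
            ((Fintype.card V * -crossing x k a w : ℤ) : ℝ) := by exact_mod_cast hw
          push_cast at this
          exact this
        have hDu : D ≤ F + N := by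
          have : ((-crossing x k a w : ℤ) : ℝ) ≤ ((outflow x k a + N : ℤ) : ℝ) := by
            exact_mod_cast hwu
          push_cast at this
          exact this
        have hN0 : (0 : ℝ) ≤ N := Nat.cast_nonneg N
        have hWD : W (crossing x k a w) = D ^ q := by
          have := hWq (-crossing x k a w) (by omega)
          rw [neg_neg] at this
          rw [this]
          push_cast
          rfl
        have hsingle : D ^ q ≤ backWeight G W k x a := by
          have hmem : w ∈ G.neighborFinset a := by
            rw [SimpleGraph.mem_neighborFinset]
            exact adj_of_crossing_ne_zero (fun j _ => hv j : ValidUpTo G x k) hw0.ne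
          refine le_trans ?_ (Finset.single_le_sum (f := fun w => if crossing x k a w < 0 then
            W (crossing x k a w) else 0) (fun v _ => ?_) hmem)
          · simp only [if_pos hw0, hWD, le_refl]
          · split_ifs
            · exact (hW _).le
            · exact le_rfl
        refine le_trans ?_ hsingle
        rcases le_total q 0 with hq | hq
        · calc α * F ^ q ≤ 2 ^ q * F ^ q := by
                gcongr
                exact min_le_right _ _
            _ = (2 * F) ^ q := (Real.mul_rpow (by norm_num) hF0.le).symm
            _ ≤ D ^ q := Real.rpow_le_rpow_of_nonpos hD0 (by linarith) hq
        · calc α * F ^ q ≤ (1 / (2 * M)) ^ q * F ^ q := by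
                gcongr
                exact min_le_left _ _
            _ = (1 / (2 * M) * F) ^ q := (Real.mul_rpow (by positivity) hF0.le).symm
            _ ≤ D ^ q := by
                refine Real.rpow_le_rpow (by positivity) ?_ hq
                rw [one_div_mul_eq_div, div_le_iff₀ (by positivity)]
                nlinarith
      have hgk : g k = backWeight G W k x a / (M * B ^ p) := by
        simp only [hg]
        rw [h.jumpFactor_eq, backFactor, if_pos (h.forward_iff.1 hfk), hi, hWp _ hB]
        ring
      rw [hgk]
      have hkey := rpow_sub_one_mul_le hpq hB1 hBF
      rw [← hs] at hkey
      have hBp : 0 < B ^ p := by positivity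
      calc κ * (Real.log (Q (k + 1)) - Real.log (Q k))
          ≤ κ * (2 ^ s * B ^ (s - 1) / (F / M) ^ s) := by gcongr
        _ = α / M * (B ^ (s - 1) * F ^ (-s)) := by
            rw [hκ, Real.div_rpow hF0.le hM0.le, Real.rpow_neg hF0.le]
            field_simp
        _ ≤ α / M * (F ^ q * B ^ (-p)) := by gcongr
        _ = α * F ^ q / (M * B ^ p) := by
            rw [Real.rpow_neg (by linarith)]
            field_simp
        _ ≤ _ := by gcongr
    · rw [if_neg hi, add_zero] at hstep
      rw [hstep, sub_self, mul_zero]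
      exact hg0 k hkn
  have hQtop : Tendsto Q atTop atTop := by
    refine tendsto_atTop_mono hQF ?_
    refine (tendsto_rpow_atTop (by linarith)).comp ?_
    refine Tendsto.atTop_div_const hM0 ?_
    exact tendsto_intCast_atTop_atTop.comp hF
  set n₂ := max n n₁ with hn₂
  have hsum : ∀ t ≥ n₂, κ * (Real.log (Q t) - Real.log (Q n₂)) ≤ ∑ k ∈ Finset.Ico n t, g k := by
    intro t ht
    induction t, ht using Nat.le_induction with
    | base =>
      rw [sub_self, mul_zero]
      exact Finset.sum_nonneg fun k hk => hg0 k (Finset.mem_Ico.1 hk).1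
    | succ t ht ih =>
      rw [Finset.sum_Ico_succ_top ((le_max_left n n₁).trans ht)]
      have := hlog t ht
      linarith
  have hprod : ∀ t ≥ n₂, κ * (Real.log (Q t) - Real.log (Q n₂)) ≤
      jumpProd (backFactor G W) n t x := by
    intro t ht
    have := one_add_sum_le_prod (f := fun k => jumpFactor (backFactor G W) k x) hg0
      (fun k _ => by simp [hg]) ((le_max_left n n₁).trans ht)
    have h2 := hsum t ht
    unfold jumpProd
    linarith
  refine tendsto_atTop_mono' _ (eventually_atTop.2 ⟨n₂, hprod⟩) ?_
  refine Tendsto.const_mul_atTop hκ0 ?_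
  exact tendsto_atTop_add_const_right _ _ (Real.tendsto_log_atTop.comp hQtop)

/-- If `p ≤ 1 + q`, then almost surely the jumps do not become forward. -/
theorem ae_not_eventually_forward {p q : ℝ} (hpq : p ≤ 1 + q) (hd : ∀ a, ∃ b, G.Adj a b)
    (hW : ∀ k, 0 < W k) (hWp : ∀ k : ℤ, 0 < k → W k = (k : ℝ) ^ p)
    (hWq : ∀ k : ℤ, 0 < k → W (-k) = (k : ℝ) ^ q) (hX : IsAntRW G μ W X) :
    ∀ᵐ ω ∂μ, ¬ ∀ᶠ k in atTop, Forward (fun n => X n ω) k := by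
  have h : ∀ᵐ ω ∂μ, ∀ n, ¬ Tendsto (fun t => jumpProd (backFactor G W) n t (fun k => X k ω))
      atTop atTop := by
    rw [ae_all_iff]
    intro n
    refine ae_not_tendsto_jumpProd hW hX (backFactor_nonneg hW)
      (fun k x y hxy => backFactor_congr hxy) n fun t _ x _ => ?_
    calc ∑ i : Fin N, 1 / (N : ℝ) * ∑ u, jumpProb G W x t i u * backFactor G W t x i u
        ≤ ∑ _i : Fin N, 1 / (N : ℝ) * 1 := by
          gcongr with i
          exact sum_jumpProb_backFactor_le hW hd t x i
      _ = (N : ℝ) * (N : ℝ)⁻¹ := by simp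
      _ ≤ 1 := mul_inv_le_one
  filter_upwards [h, ae_isMove hX] with ω h1 hv hfw
  obtain ⟨n, hn⟩ := eventually_atTop.1 hfw
  exact h1 n (tendsto_jumpProd_backFactor hpq hW hWp hWq hv hn)

end NotMonot

/-! ### No vertex is left along two edges infinitely often -/

section Oscillation

/-- The partial products `∏ (1 + i l / j ^ p)`. They converge when `p > 1`, and their absolute
values increase. -/
noncomputable def oscProd (p l : ℝ) (b m : ℕ) : ℂ :=
  ∏ j ∈ Finset.Ico b m, (1 + ((l / (j : ℝ) ^ p : ℝ) : ℂ) * Complex.I)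

theorem norm_one_add_mul_I (u : ℝ) : ‖(1 + (u : ℂ) * Complex.I)‖ = √(1 + u ^ 2) := by
  have := Complex.norm_add_mul_I 1 u
  simpa using this

theorem one_le_norm_one_add_mul_I (u : ℝ) : 1 ≤ ‖(1 + (u : ℂ) * Complex.I)‖ := by
  rw [norm_one_add_mul_I]
  exact Real.one_le_sqrt.2 (by nlinarith [sq_nonneg u])

theorem oscProd_succ (p l : ℝ) {b m : ℕ} (h : b ≤ m) :
    oscProd p l b (m + 1) = oscProd p l b m * (1 + ((l / (m : ℝ) ^ p : ℝ) : ℂ) * Complex.I) :=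
  Finset.prod_Ico_succ_top h _

theorem exists_tendsto_oscProd {p : ℝ} (hp : 1 < p) (l : ℝ) (b : ℕ) :
    ∃ f : ℂ, Tendsto (oscProd p l b) atTop (nhds f) := by
  have hsum : Summable fun j : ℕ => ‖((l / ((b + j : ℕ) : ℝ) ^ p : ℝ) : ℂ) * Complex.I‖ := by
    have h1 : Summable fun j : ℕ => ‖((l / (j : ℝ) ^ p : ℝ) : ℂ) * Complex.I‖ := by
      simp only [norm_mul, Complex.norm_real, Complex.norm_I, mul_one, norm_div]
      refine ((Real.summable_one_div_nat_rpow.2 hp).mul_left ‖l‖).congr fun j => ?_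
      rw [Real.norm_of_nonneg (Real.rpow_nonneg (Nat.cast_nonneg j) p)]
      ring
    simpa only [add_comm b] using (summable_nat_add_iff b).2 h1
  have hmul := Complex.multipliable_one_add_of_summable hsum.of_norm
  refine ⟨_, (hmul.hasProd.tendsto_prod_nat.comp (tendsto_sub_atTop_nat b)).congr fun m => ?_⟩
  rw [oscProd, Finset.prod_Ico_eq_prod_range]
  rfl

theorem norm_oscProd_mono (p l : ℝ) (b : ℕ) : Monotone fun m => ‖oscProd p l b m‖ := by
  refine monotone_nat_of_le_succ fun m => ?_
  rcases le_or_gt b m with h | h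
  · rw [oscProd_succ p l h, norm_mul]
    exact le_mul_of_one_le_right (norm_nonneg _) (one_le_norm_one_add_mul_I _)
  · simp only [oscProd]
    rw [Finset.Ico_eq_empty (by omega), Finset.Ico_eq_empty (by omega)]

theorem norm_oscProd_le {p l : ℝ} {b : ℕ} {f : ℂ} (hf : Tendsto (oscProd p l b) atTop (nhds f))
    (m : ℕ) : ‖oscProd p l b m‖ ≤ ‖f‖ :=
  (norm_oscProd_mono p l b).ge_of_tendsto hf.norm m

theorem le_norm_of_tendsto_oscProd {p l : ℝ} {b : ℕ} {f : ℂ}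
    (hf : Tendsto (oscProd p l b) atTop (nhds f)) : |l / (b : ℝ) ^ p| ≤ ‖f‖ ∧ 1 ≤ ‖f‖ := by
  constructor
  · refine le_trans ?_ (norm_oscProd_le hf (b + 1))
    rw [oscProd_succ p l le_rfl]
    simp only [oscProd, Finset.Ico_self, Finset.prod_empty, one_mul]
    rw [norm_one_add_mul_I]
    exact Real.abs_le_sqrt (by linarith)
  · refine le_trans ?_ (norm_oscProd_le hf b)
    simp [oscProd]

end Oscillation

section Branching

set_option linter.unusedSectionVars false

variable {V : Type*} [DecidableEq V] [Fintype V] {N : ℕ} {G : SimpleGraph V} [DecidableRel G.Adj]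
  {W : ℤ → ℝ} {Ω : Type*} [mΩ : MeasurableSpace Ω] {μ : Measure Ω} [IsProbabilityMeasure μ]
  {X : ℕ → Ω → Fin N → V} {x y : ℕ → Fin N → V}

/-- All jumps during the time interval `[n, k)` are forward. -/
def ForwardOn (x : ℕ → Fin N → V) (n k : ℕ) : Prop := ∀ j ∈ Set.Ico n k, Forward x j

theorem ForwardOn.congr {n k : ℕ} (h : ForwardOn x n k) (hxy : ∀ m ≤ k, x m = y m) :
    ForwardOn y n k :=
  fun j hj => (h j hj).congr fun m hm => hxy m (hm.trans hj.2)

theorem forwardOn_succ {n k : ℕ} (hnk : n ≤ k) :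
    ForwardOn x n (k + 1) ↔ ForwardOn x n k ∧ Forward x k := by
  refine ⟨fun h => ⟨fun j hj => h j ⟨hj.1, hj.2.trans (Nat.lt_succ_self k)⟩,
    h k ⟨hnk, Nat.lt_succ_self k⟩⟩, fun h j hj => ?_⟩
  rcases Nat.lt_succ_iff_lt_or_eq.1 hj.2 with h' | rfl
  · exact h.1 j ⟨hj.1, h'⟩
  · exact h.2

/-- Some walker is at `a` at time `k` and at `b` at time `k + 1`. -/
def Jumps (x : ℕ → Fin N → V) (k : ℕ) (a b : V) : Prop := ∃ i, x k i = a ∧ x (k + 1) i = b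

theorem Jumps.congr {k : ℕ} {a b : V} (h : Jumps x k a b) (hxy : ∀ m ≤ k + 1, x m = y m) :
    Jumps y k a b := by
  obtain ⟨i, h1, h2⟩ := h
  exact ⟨i, by rw [← hxy k (Nat.le_succ k), h1], by rw [← hxy (k + 1) le_rfl, h2]⟩

theorem Jumps.exists_isMove {k : ℕ} {a b : V} (h : Jumps x k a b) (hab : a ≠ b)
    (hv : ∃ i b, IsMove G x k i b) : ∃ i, IsMove G x k i b ∧ x k i = a := by
  obtain ⟨j, hj⟩ := hv
  obtain ⟨c, hm⟩ := hj
  obtain ⟨i, rfl, rfl⟩ := h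
  obtain rfl := hm.moved_iff.1 hab.symm
  rw [hm.apply_self]
  exact ⟨i, hm, rfl⟩

open Classical in
/-- The factors of a complex martingale. The edges from `a` to `w₁` and `w₂` compete like two sums
of independent exponential clocks with the rates `W j`. The factors `1 ± i l / W j` are the inverse
characteristic functions of these clocks at frequency `l`, with opposite signs because the
difference of the two sums matters. The martingale is frozen after the first jump that is not forward. -/
noncomputable def clockFactor (W : ℤ → ℝ) (n : ℕ) (a w₁ w₂ : V) (l : ℝ) (k : ℕ)
    (x : ℕ → Fin N → V) (i : Fin N) (u : V) : ℂ :=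
  if ForwardOn x n k ∧ x k i = a then
    if u = w₁ then 1 + ((l / W (crossing x k a w₁) : ℝ) : ℂ) * Complex.I
    else if u = w₂ then 1 + ((-l / W (crossing x k a w₂) : ℝ) : ℂ) * Complex.I
    else 1
  else 1

open Classical in
theorem clockFactor_congr (n : ℕ) (a w₁ w₂ : V) (l : ℝ) {k : ℕ} (h : ∀ m ≤ k, x m = y m) :
    clockFactor W n a w₁ w₂ l k x = clockFactor W n a w₁ w₂ l k y := by
  have h1 : ForwardOn x n k ↔ ForwardOn y n k :=
    ⟨fun h' => h'.congr h, fun h' => h'.congr fun m hm => (h m hm).symm⟩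
  funext i u
  simp only [clockFactor, crossing_congr h]
  exact if_congr (and_congr h1 (by rw [h k le_rfl])) rfl rfl

theorem sum_jumpProb_clockFactor (hW : ∀ k, 0 < W k) (hd : ∀ a, ∃ b, G.Adj a b)
    (n : ℕ) {a w₁ w₂ : V} (h1 : G.Adj a w₁) (h2 : G.Adj a w₂) (hne : w₁ ≠ w₂) (l : ℝ) (k : ℕ)
    (x : ℕ → Fin N → V) (i : Fin N) :
    ∑ u, jumpProb G W x k i u • clockFactor W n a w₁ w₂ l k x i u = 1 := by
  have hS := sum_weight_pos hW hd x k (x k i)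
  rw [sum_jumpProb_smul]
  have key : ∑ u ∈ G.neighborFinset (x k i), W (crossing x k (x k i) u) •
      clockFactor W n a w₁ w₂ l k x i u =
      ((∑ u ∈ G.neighborFinset (x k i), W (crossing x k (x k i) u) : ℝ) : ℂ) := by
    by_cases hc : ForwardOn x n k ∧ x k i = a
    · have hm : ∀ u ∈ G.neighborFinset (x k i), W (crossing x k (x k i) u) •
          clockFactor W n a w₁ w₂ l k x i u = ((W (crossing x k (x k i) u) : ℝ) : ℂ) +
            ((if u = w₁ then (l : ℂ) * Complex.I else 0) -
              (if u = w₂ then (l : ℂ) * Complex.I else 0)) := by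
        intro u _
        rw [clockFactor, if_pos hc, hc.2]
        have hWu : ((W (crossing x k a u) : ℝ) : ℂ) ≠ 0 := by
          exact_mod_cast (hW _).ne'
        by_cases hu1 : u = w₁
        · rw [if_pos hu1, if_pos hu1, if_neg (by rw [hu1]; exact hne)]
          subst hu1
          rw [Complex.real_smul]
          push_cast
          field_simp
          ring
        · by_cases hu2 : u = w₂
          · rw [if_neg hu1, if_neg hu1, if_pos hu2, if_pos hu2]
            subst hu2
            rw [Complex.real_smul]
            push_cast
            field_simp
            ring
          · rw [if_neg hu1, if_neg hu1, if_neg hu2, if_neg hu2]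
            simp
      rw [Finset.sum_congr rfl hm, Finset.sum_add_distrib, Finset.sum_sub_distrib,
        Finset.sum_ite_eq', Finset.sum_ite_eq', if_pos, if_pos, sub_self, add_zero]
      · push_cast
        rfl
      · rw [SimpleGraph.mem_neighborFinset, hc.2]
        exact h2
      · rw [SimpleGraph.mem_neighborFinset, hc.2]
        exact h1
    · simp only [clockFactor, if_neg hc]
      push_cast
      exact Finset.sum_congr rfl fun u _ => by rw [Complex.real_smul, mul_one]
  rw [key, Complex.real_smul, ← Complex.ofReal_mul, inv_mul_cancel₀ hS.ne', Complex.ofReal_one]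

/-- A positive crossing number does not change under forward jumps elsewhere. -/
theorem crossing_succ_of_forward {k : ℕ} {i : Fin N} {b : V} (h : IsMove G x k i b)
    (hf : Forward x k) {a w : V} (h0 : 0 < crossing x k a w) (hne : ¬ (x k i = a ∧ b = w)) :
    crossing x (k + 1) a w = crossing x k a w := by
  refine crossing_succ_of_ne h hne ?_
  rintro ⟨rfl, rfl⟩
  have := h.forward_iff.1 hf
  rw [crossing_swap] at this
  omega

/-- The value of the martingale before the first jump that is not forward, and a bound at all
times. -/
theorem jumpProd_clockFactor {p : ℝ} (hWp : ∀ k : ℤ, 0 < k → W k = (k : ℝ) ^ p)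
    (hv : ∀ k, ∃ i b, IsMove G x k i b) {n : ℕ} {a w₁ w₂ : V} (hne : w₁ ≠ w₂) (l : ℝ)
    {b₁ b₂ : ℕ} (hb₁ : 0 < b₁) (hb₂ : 0 < b₂) (h1 : crossing x n a w₁ = b₁)
    (h2 : crossing x n a w₂ = b₂) {f₁ f₂ : ℂ} (hf₁ : Tendsto (oscProd p l b₁) atTop (nhds f₁))
    (hf₂ : Tendsto (oscProd p (-l) b₂) atTop (nhds f₂)) {t : ℕ} (ht : n ≤ t) :
    (ForwardOn x n t → ∃ m₁ ≥ b₁, ∃ m₂ ≥ b₂, crossing x t a w₁ = m₁ ∧ crossing x t a w₂ = m₂ ∧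
      jumpProd (clockFactor W n a w₁ w₂ l) n t x = oscProd p l b₁ m₁ * oscProd p (-l) b₂ m₂) ∧
    ‖jumpProd (clockFactor W n a w₁ w₂ l) n t x‖ ≤ ‖f₁ * f₂‖ := by
  have hbd : ∀ m₁ m₂, ‖oscProd p l b₁ m₁ * oscProd p (-l) b₂ m₂‖ ≤ ‖f₁ * f₂‖ := by
    intro m₁ m₂
    rw [norm_mul, norm_mul]
    exact mul_le_mul (norm_oscProd_le hf₁ m₁) (norm_oscProd_le hf₂ m₂) (norm_nonneg _)
      (norm_nonneg _)
  induction t, ht using Nat.le_induction with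
  | base =>
    have h0 : jumpProd (clockFactor W n a w₁ w₂ l) n n x =
        oscProd p l b₁ b₁ * oscProd p (-l) b₂ b₂ := by simp [jumpProd, oscProd]
    refine ⟨fun _ => ⟨b₁, le_rfl, b₂, le_rfl, h1, h2, h0⟩, ?_⟩
    rw [h0]
    exact hbd _ _
  | succ t ht ih =>
    obtain ⟨i, b, hm⟩ := hv t
    by_cases hfo : ForwardOn x n t
    · obtain ⟨m₁, hm₁, m₂, hm₂, hc₁, hc₂, heq⟩ := ih.1 hfo
      have hpos₁ : 0 < crossing x t a w₁ := by omega
      have hpos₂ : 0 < crossing x t a w₂ := by omega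
      have hW₁ : W (crossing x t a w₁) = (m₁ : ℝ) ^ p := by
        rw [hWp _ hpos₁, hc₁]
        push_cast
        rfl
      have hW₂ : W (crossing x t a w₂) = (m₂ : ℝ) ^ p := by
        rw [hWp _ hpos₂, hc₂]
        push_cast
        rfl
      have hs := jumpProd_succ (ψ := clockFactor W n a w₁ w₂ l) ht x
      rw [hm.jumpFactor_eq, clockFactor] at hs
      by_cases hi : x t i = a
      · rw [if_pos ⟨hfo, hi⟩, hW₁, hW₂] at hs
        by_cases hbw₁ : b = w₁
        · rw [if_pos hbw₁] at hs
          have hfw : Forward x t := hm.forward_iff.2 (by rw [hi, hbw₁]; exact hpos₁)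
          have heq' : jumpProd (clockFactor W n a w₁ w₂ l) n (t + 1) x =
              oscProd p l b₁ (m₁ + 1) * oscProd p (-l) b₂ m₂ := by
            rw [hs, heq, oscProd_succ p l hm₁]
            ring
          refine ⟨fun _ => ⟨m₁ + 1, by omega, m₂, hm₂, ?_, ?_, heq'⟩, ?_⟩
          · rw [← hi, ← hbw₁, crossing_succ_self hm, hi, hbw₁, hc₁]
            push_cast
            rfl
          · rw [crossing_succ_of_forward hm hfw hpos₂, hc₂]
            rintro ⟨-, rfl⟩
            exact hne hbw₁.symm
          · rw [heq']
            exact hbd _ _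
        · rw [if_neg hbw₁] at hs
          by_cases hbw₂ : b = w₂
          · rw [if_pos hbw₂] at hs
            have hfw : Forward x t := hm.forward_iff.2 (by rw [hi, hbw₂]; exact hpos₂)
            have heq' : jumpProd (clockFactor W n a w₁ w₂ l) n (t + 1) x =
                oscProd p l b₁ m₁ * oscProd p (-l) b₂ (m₂ + 1) := by
              rw [hs, heq, oscProd_succ p (-l) hm₂]
              ring
            refine ⟨fun _ => ⟨m₁, hm₁, m₂ + 1, by omega, ?_, ?_, heq'⟩, ?_⟩
            · rw [crossing_succ_of_forward hm hfw hpos₁ (fun h => hbw₁ h.2), hc₁]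
            · rw [← hi, ← hbw₂, crossing_succ_self hm, hi, hbw₂, hc₂]
              push_cast
              rfl
            · rw [heq']
              exact hbd _ _
          · rw [if_neg hbw₂, mul_one] at hs
            rw [hs]
            refine ⟨fun hfo' => ⟨m₁, hm₁, m₂, hm₂, ?_, ?_, heq⟩, ih.2⟩
            · rw [crossing_succ_of_forward hm ((forwardOn_succ ht).1 hfo').2 hpos₁
                (fun h => hbw₁ h.2), hc₁]
            · rw [crossing_succ_of_forward hm ((forwardOn_succ ht).1 hfo').2 hpos₂
                (fun h => hbw₂ h.2), hc₂]
      · rw [if_neg (fun h => hi h.2), mul_one] at hs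
        rw [hs]
        refine ⟨fun hfo' => ⟨m₁, hm₁, m₂, hm₂, ?_, ?_, heq⟩, ih.2⟩
        · rw [crossing_succ_of_forward hm ((forwardOn_succ ht).1 hfo').2 hpos₁
            (fun h => hi h.1), hc₁]
        · rw [crossing_succ_of_forward hm ((forwardOn_succ ht).1 hfo').2 hpos₂
            (fun h => hi h.1), hc₂]
    · refine ⟨fun h => absurd ((forwardOn_succ ht).1 h).1 hfo, ?_⟩
      rw [jumpProd_succ ht, hm.jumpFactor_eq, clockFactor, if_neg (fun h => hfo h.1), mul_one]
      exact ih.2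

/-- From time `n` on all jumps are forward, and walkers jump infinitely often from `a` to `w₁` and
from `a` to `w₂`. -/
def Branches (n : ℕ) (a w₁ w₂ : V) (x : ℕ → Fin N → V) : Prop :=
  (∀ k ≥ n, Forward x k) ∧ (∃ᶠ k in atTop, Jumps x k a w₁) ∧ ∃ᶠ k in atTop, Jumps x k a w₂

theorem measurableSet_branches (hX : ∀ (n : ℕ) (y : Fin N → V), MeasurableSet {ω | X n ω = y})
    (n : ℕ) (a w₁ w₂ : V) :
    MeasurableSet[⨆ n, histFiltration hX n] {ω | Branches n a w₁ w₂ (fun k => X k ω)} := by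
  have h1 := measurableSet_forall_ge hX n (fun k x => Forward x k) fun k x y h h' => h'.congr h
  have h2 : ∀ w, MeasurableSet[⨆ n, histFiltration hX n]
      {ω | ∃ᶠ k in atTop, Jumps (fun j => X j ω) k a w} := by
    intro w
    have := (measurableSet_eventually hX (fun k x => ¬ Jumps x k a w)
      fun k x y h h' h'' => h' (h''.congr fun m hm => (h m hm).symm)).compl
    exact this
  exact @MeasurableSet.inter _ _ _ _ h1 (@MeasurableSet.inter _ _ _ _ (h2 w₁) (h2 w₂))

/-- A walker that jumps infinitely often along an edge pushes its crossing number to infinity. -/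
theorem tendsto_crossing (hv : ∀ k, ∃ i b, IsMove G x k i b) {n : ℕ}
    (hfw : ∀ k ≥ n, Forward x k) {a w : V} (haw : a ≠ w) (h : ∃ᶠ k in atTop, Jumps x k a w) :
    0 < crossing x n a w ∧ Tendsto (fun k => crossing x k a w) atTop atTop := by
  have h0 : 0 < crossing x n a w := by
    by_contra hcon
    obtain ⟨k, hk, hj⟩ := frequently_atTop.1 h n
    obtain ⟨i, hm, rfl⟩ := hj.exists_isMove haw (hv k)
    have h1 := hm.forward_iff.1 (hfw k hk)
    have h2 := (crossing_mono_of_forward (fun k _ => hv k) hfw (u := w) (v := x k i)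
      (by rw [crossing_swap]; omega) hk le_rfl).1
    rw [crossing_swap] at h2
    omega
  refine ⟨h0, ?_⟩
  have hmono := fun k (hk : n ≤ k) l (hl : k ≤ l) =>
    (crossing_mono_of_forward (fun k _ => hv k) hfw h0.le hk hl).2
  have hunb : ∀ j : ℕ, ∃ k ≥ n, (j : ℤ) ≤ crossing x k a w := by
    intro j
    induction j with
    | zero => exact ⟨n, le_rfl, by simpa using h0.le⟩
    | succ j ih =>
      obtain ⟨k, hk, hj⟩ := ih
      obtain ⟨l, hl, hjl⟩ := frequently_atTop.1 h k
      obtain ⟨i, hm, rfl⟩ := hjl.exists_isMove haw (hv l)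
      refine ⟨l + 1, by omega, ?_⟩
      rw [crossing_succ_self hm]
      have := hmono k hk l hl
      push_cast
      linarith
  refine tendsto_atTop.2 fun c => ?_
  obtain ⟨k, hk, hc⟩ := hunb c.toNat
  filter_upwards [eventually_ge_atTop k] with l hl
  have := hmono k hk l hl
  have := Int.self_le_toNat c
  omega

/-- Whatever the past, the two competing clocks fail to run out simultaneously with probability
at least `3 / 8`. -/
theorem measureReal_cylinder_inter_branches_le {p : ℝ} (hp : 1 < p) (hN : 1 ≤ N)
    (hd : ∀ a, ∃ b, G.Adj a b) (hW : ∀ k, 0 < W k)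
    (hWp : ∀ k : ℤ, 0 < k → W k = (k : ℝ) ^ p) (hX : IsAntRW G μ W X) (n : ℕ) {a w₁ w₂ : V}
    (h1 : G.Adj a w₁) (h2 : G.Adj a w₂) (hne : w₁ ≠ w₂) (x₀ : ℕ → Fin N → V) :
    μ.real (cylinder X n x₀ ∩ {ω | Branches n a w₁ w₂ (fun k => X k ω)}) ≤
      5 / 8 * μ.real (cylinder X n x₀) := by
  set A : Set Ω := {ω | Branches n a w₁ w₂ (fun k => X k ω)} with hA
  set H : Set Ω := cylinder X n x₀ with hH
  have hmH : MeasurableSet H := (histFiltration hX.measurableSet_eq).le n _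
    (measurableSet_cylinder hX.measurableSet_eq n _)
  have hmA : MeasurableSet A := (iSup_le fun n => (histFiltration hX.measurableSet_eq).le n) _
    (measurableSet_branches hX.measurableSet_eq n a w₁ w₂)
  by_cases hb : 0 < crossing x₀ n a w₁ ∧ 0 < crossing x₀ n a w₂
  swap
  · have hnull : μ (H ∩ A) = 0 := by
      have : ∀ᵐ ω ∂μ, ω ∉ H ∩ A := by
        filter_upwards [ae_isMove hX] with ω hv hω
        refine hb ⟨?_, ?_⟩
        · rw [← crossing_congr (x := fun k => X k ω) hω.1]
          exact (tendsto_crossing hv hω.2.1 h1.ne hω.2.2.1).1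
        · rw [← crossing_congr (x := fun k => X k ω) hω.1]
          exact (tendsto_crossing hv hω.2.1 h2.ne hω.2.2.2).1
      simpa [ae_iff] using this
    rw [measureReal_def, hnull]
    simp only [ENNReal.toReal_zero]
    positivity
  obtain ⟨b₁, hb₁⟩ := Int.eq_ofNat_of_zero_le hb.1.le
  obtain ⟨b₂, hb₂⟩ := Int.eq_ofNat_of_zero_le hb.2.le
  have hb₁0 : 0 < b₁ := by have := hb.1; omega
  have hb₂0 : 0 < b₂ := by have := hb.2; omega
  -- a large frequency makes the limit large
  set l : ℝ := 4 * (b₁ : ℝ) ^ p with hl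
  obtain ⟨f₁, hf₁⟩ := exists_tendsto_oscProd hp l b₁
  obtain ⟨f₂, hf₂⟩ := exists_tendsto_oscProd hp (-l) b₂
  have hL : 4 ≤ ‖f₁ * f₂‖ := by
    have e1 := (le_norm_of_tendsto_oscProd hf₁).1
    have e2 := (le_norm_of_tendsto_oscProd hf₂).2
    have hbp : 0 < (b₁ : ℝ) ^ p := by positivity
    rw [hl, mul_div_assoc, div_self hbp.ne', mul_one] at e1
    norm_num at e1
    rw [norm_mul]
    nlinarith [norm_nonneg f₁]
  set M : ℕ → Ω → ℂ := fun t ω => jumpProd (clockFactor W n a w₁ w₂ l) n t (fun k => X k ω)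
    with hM
  have hψ : ∀ k (x y : ℕ → Fin N → V), (∀ m ≤ k, x m = y m) →
      clockFactor W n a w₁ w₂ l k x = clockFactor W n a w₁ w₂ l k y :=
    fun k x y h => clockFactor_congr n a w₁ w₂ l h
  have hMint : ∀ t, Integrable (M t) μ := fun t =>
    integrable_of_congr hX.measurableSet_eq t _ fun x y hxy => jumpProd_congr hψ hxy
  have hmean : ∀ t ≥ n, ∫ ω in H, M t ω ∂μ = μ.real H := fun t ht =>
    integral_jumpProd hN hW hX hψ n x₀ (fun t _ x _ _ _ i =>
      sum_jumpProb_clockFactor hW hd n h1 h2 hne l t x i) ht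
  have hdet : ∀ᵐ ω ∂μ, ω ∈ H → ∀ t ≥ n,
      (ForwardOn (fun k => X k ω) n t → ∃ m₁ ≥ b₁, ∃ m₂ ≥ b₂,
        crossing (fun k => X k ω) t a w₁ = m₁ ∧ crossing (fun k => X k ω) t a w₂ = m₂ ∧
        M t ω = oscProd p l b₁ m₁ * oscProd p (-l) b₂ m₂) ∧ ‖M t ω‖ ≤ ‖f₁ * f₂‖ := by
    filter_upwards [ae_isMove hX] with ω hv hω t ht
    exact jumpProd_clockFactor hWp hv hne l hb₁0 hb₂0
      ((crossing_congr hω _ _).trans hb₁) ((crossing_congr hω _ _).trans hb₂) hf₁ hf₂ ht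
  -- with `α` the conditional probability of `A` and `f = f₁ * f₂`, the mean one of the martingale
  -- gives `α * ‖f‖ ≤ 1 + (1 - α) * ‖f‖`
  have hsplit : ∀ t ≥ n, ∫ ω in H ∩ A, M t ω ∂μ = μ.real H - ∫ ω in H \ A, M t ω ∂μ := by
    intro t ht
    rw [← hmean t ht, ← integral_inter_add_sdiff (s := H) hmA (hMint t).integrableOn,
      add_sub_cancel_right]
  have hlim : Tendsto (fun t => ∫ ω in H ∩ A, M t ω ∂μ) atTop
      (nhds (∫ _ω in H ∩ A, f₁ * f₂ ∂μ)) := by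
    refine tendsto_integral_filter_of_dominated_convergence (fun _ => ‖f₁ * f₂‖) ?_ ?_ ?_ ?_
    · exact Eventually.of_forall fun t => (hMint t).aestronglyMeasurable.restrict
    · filter_upwards [eventually_ge_atTop n] with t ht
      rw [ae_restrict_iff' (hmH.inter hmA)]
      filter_upwards [hdet] with ω h hω
      exact (h hω.1 t ht).2
    · exact integrable_const _
    · rw [ae_restrict_iff' (hmH.inter hmA)]
      filter_upwards [hdet, ae_isMove hX] with ω h hv hω
      have hfo : ∀ t, ForwardOn (fun k => X k ω) n t := fun t j hj => hω.2.1 j hj.1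
      choose m₁ _ m₂ _ hm₁ hm₂ heq using fun t (ht : n ≤ t) => (h hω.1 t ht).1 (hfo t)
      have ht₁ := (tendsto_crossing hv hω.2.1 h1.ne hω.2.2.1).2
      have ht₂ := (tendsto_crossing hv hω.2.1 h2.ne hω.2.2.2).2
      have key : ∀ {m : ∀ t, n ≤ t → ℕ} {w : V}
          (_ : ∀ t ht, crossing (fun k => X k ω) t a w = m t ht), Tendsto
            (fun t => crossing (fun k => X k ω) t a w) atTop atTop →
          Tendsto (fun t => (crossing (fun k => X k ω) t a w).toNat) atTop atTop := by
        intro m w _ hw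
        refine tendsto_atTop.2 fun c => ?_
        filter_upwards [hw.eventually_ge_atTop (c : ℤ)] with t ht
        omega
      have hP := (hf₁.comp (key hm₁ ht₁)).mul (hf₂.comp (key hm₂ ht₂))
      refine hP.congr' ?_
      filter_upwards [eventually_ge_atTop n] with t ht
      rw [heq t ht]
      simp only [Function.comp]
      rw [hm₁ t ht, hm₂ t ht]
      simp
  rw [setIntegral_const] at hlim
  have hbound : ∀ t ≥ n, ‖∫ ω in H ∩ A, M t ω ∂μ‖ ≤ μ.real H + ‖f₁ * f₂‖ * μ.real (H \ A) := by
    intro t ht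
    rw [hsplit t ht]
    refine (norm_sub_le _ _).trans (add_le_add ?_ ?_)
    · rw [Complex.norm_real, Real.norm_of_nonneg measureReal_nonneg]
    · refine norm_setIntegral_le_of_norm_le_const_ae (measure_lt_top _ _) ?_
      rw [ae_restrict_iff' (hmH.diff hmA)]
      filter_upwards [hdet] with ω h hω
      exact (h hω.1 t ht).2
  have hfin := le_of_tendsto hlim.norm (eventually_atTop.2 ⟨n, hbound⟩)
  rw [norm_smul, Real.norm_of_nonneg measureReal_nonneg] at hfin
  have hdiff : μ.real (H \ A) = μ.real H - μ.real (H ∩ A) := by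
    have := measureReal_inter_add_sdiff (μ := μ) (s := H) hmA
    linarith
  rw [hdiff] at hfin
  have hH0 : 0 ≤ μ.real H := measureReal_nonneg
  have hle : μ.real (H ∩ A) ≤ μ.real H := measureReal_mono Set.inter_subset_left
  nlinarith

/-- If `p > 1`, then almost surely no vertex is left infinitely often along two edges while all
jumps are forward. -/
theorem ae_not_branches {p : ℝ} (hp : 1 < p) (hN : 1 ≤ N)
    (hd : ∀ a, ∃ b, G.Adj a b) (hW : ∀ k, 0 < W k)
    (hWp : ∀ k : ℤ, 0 < k → W k = (k : ℝ) ^ p) (hX : IsAntRW G μ W X) :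
    ∀ᵐ ω ∂μ, ∀ n a w₁ w₂, G.Adj a w₁ → G.Adj a w₂ → w₁ ≠ w₂ →
      ¬ Branches n a w₁ w₂ (fun k => X k ω) := by
  simp only [ae_all_iff]
  intro n a w₁ w₂ h1 h2 hne
  have := measure_eq_zero_of_cylinder_le (μ := μ) hX.measurableSet_eq
    (measurableSet_branches hX.measurableSet_eq n a w₁ w₂) (θ := 5 / 8) (by norm_num) n
    fun m hm x => ?_
  · simpa [ae_iff] using this
  · refine le_trans (measureReal_mono ?_)
      (measureReal_cylinder_inter_branches_le hp hN hd hW hWp hX m h1 h2 hne x)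
    exact Set.inter_subset_inter_right _ fun ω hω => ⟨fun k hk => hω.1 k (hm.trans hk), hω.2⟩

end Branching

/-! ### From a well prepared configuration all jumps are forward with positive probability -/

section Trap

set_option linter.unusedSectionVars false

variable {V : Type*} [DecidableEq V] [Fintype V] {N : ℕ} {G : SimpleGraph V} [DecidableRel G.Adj]
  {W : ℤ → ℝ} {Ω : Type*} [mΩ : MeasurableSpace Ω] {μ : Measure Ω} [IsProbabilityMeasure μ]
  {X : ℕ → Ω → Fin N → V} {x y : ℕ → Fin N → V}

/-- The configuration at time `n` is prepared for following the directed edges in `D` forever: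
these edges have positive crossing numbers and can be followed indefinitely from the position of
each walker, and the other edges at their tails have crossing numbers at most `L`. -/
structure IsTrap (G : SimpleGraph V) (x : ℕ → Fin N → V) (n : ℕ) (L : ℤ) (D : V → V → Prop) :
    Prop where
  adj : ∀ u v, D u v → G.Adj u v
  pos : ∀ u v, D u v → 0 < crossing x n u v
  closed : ∀ u v, D u v → ∃ w, D v w
  walkers : ∀ i, ∃ w, D (x n i) w
  low : ∀ u v w, D u v → ¬ D u w → crossing x n u w ≤ L

theorem IsTrap.congr {n : ℕ} {L : ℤ} {D : V → V → Prop} (h : IsTrap G x n L D)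
    (hxy : ∀ m ≤ n, x m = y m) : IsTrap G y n L D where
  adj := h.adj
  pos u v huv := by rw [← crossing_congr hxy]; exact h.pos u v huv
  closed := h.closed
  walkers i := by rw [← hxy n le_rfl]; exact h.walkers i
  low u v w huv huw := by rw [← crossing_congr hxy]; exact h.low u v w huv huw

theorem IsTrap.succ {k : ℕ} {L : ℤ} {D : V → V → Prop} (h : IsTrap G x k L D) {i : Fin N} {b : V}
    (hm : IsMove G x k i b) (hD : D (x k i) b) : IsTrap G x (k + 1) L D where
  adj := h.adj
  pos u v huv := by
    have h0 := h.pos u v huv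
    rw [crossing_succ hm, if_neg (c := x k i = v ∧ b = u)]
    · split_ifs <;> omega
    · rintro ⟨rfl, rfl⟩
      have := h.pos _ _ hD
      rw [crossing_swap] at this
      omega
  closed := h.closed
  walkers j := by
    by_cases hj : j = i
    · subst hj
      rw [hm.apply_self]
      exact h.closed _ _ hD
    · rw [hm.apply_ne hj]
      exact h.walkers j
  low u v w huv huw := by
    have h0 := h.low u v w huv huw
    rw [crossing_succ hm, if_neg (c := x k i = u ∧ b = w)]
    · split_ifs <;> omega
    · rintro ⟨rfl, rfl⟩
      exact huw hD

open Classical in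
/-- The inverse probability of following `D`, when the jump follows `D`. -/
noncomputable def trapFactor (G : SimpleGraph V) [DecidableRel G.Adj] (W : ℤ → ℝ)
    (D : V → V → Prop) (k : ℕ) (x : ℕ → Fin N → V) (i : Fin N) (u : V) : ℝ :=
  if D (x k i) u then
    (∑ w ∈ G.neighborFinset (x k i), W (crossing x k (x k i) w)) /
      ∑ w ∈ G.neighborFinset (x k i) with D (x k i) w, W (crossing x k (x k i) w)
  else 0

theorem trapFactor_congr (D : V → V → Prop) {k : ℕ} (h : ∀ m ≤ k, x m = y m) :
    trapFactor G W D k x = trapFactor G W D k y := by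
  have h' := h k le_rfl
  funext i u
  unfold trapFactor
  rw [← h']
  simp only [crossing_congr h]

open Classical in
theorem IsTrap.sum_jumpProb_trapFactor {k : ℕ} {L : ℤ} {D : V → V → Prop}
    (h : IsTrap G x k L D) (hW : ∀ k, 0 < W k) (i : Fin N) :
    ∑ u, jumpProb G W x k i u • trapFactor G W D k x i u = 1 := by
  obtain ⟨w, hw⟩ := h.walkers i
  have hwm : w ∈ G.neighborFinset (x k i) := by
    rw [SimpleGraph.mem_neighborFinset]
    exact h.adj _ _ hw
  have hS : 0 < ∑ w ∈ G.neighborFinset (x k i), W (crossing x k (x k i) w) :=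
    Finset.sum_pos (fun _ _ => hW _) ⟨w, hwm⟩
  have hg : 0 < ∑ w ∈ G.neighborFinset (x k i) with D (x k i) w, W (crossing x k (x k i) w) :=
    Finset.sum_pos (fun _ _ => hW _) ⟨w, Finset.mem_filter.2 ⟨hwm, hw⟩⟩
  rw [sum_jumpProb_smul]
  simp only [trapFactor, smul_eq_mul, mul_ite, mul_zero]
  rw [← Finset.sum_filter, ← Finset.sum_mul]
  field_simp

theorem IsTrap.of_jumpProd_ne_zero {n : ℕ} {L : ℤ} {D : V → V → Prop} (h : IsTrap G x n L D)
    {t : ℕ} (ht : n ≤ t) (hv : ValidUpTo G x t) (h0 : jumpProd (trapFactor G W D) n t x ≠ 0) :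
    IsTrap G x t L D ∧ ForwardOn x n t := by
  induction t, ht using Nat.le_induction with
  | base => exact ⟨h, fun j hj => absurd hj.1 (not_le.2 hj.2)⟩
  | succ t ht ih =>
    rw [jumpProd_succ ht] at h0
    obtain ⟨ih1, ih2⟩ := ih (hv.mono (Nat.le_succ t)) (left_ne_zero_of_mul h0)
    obtain ⟨i, b, hm⟩ := hv t (Nat.lt_succ_self t)
    have hD : D (x t i) b := by
      by_contra hD
      rw [hm.jumpFactor_eq, trapFactor, if_neg hD] at h0
      simp at h0
    exact ⟨ih1.succ hm hD, (forwardOn_succ ht).2 ⟨ih2, hm.forward_iff.2 (ih1.pos _ _ hD)⟩⟩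

/-- With outflow `F` at its position, a walker leaves `D` with a probability of order at most
`F ^ (max q 0 - p)`. -/
theorem exists_trapFactor_le (G : SimpleGraph V) [DecidableRel G.Adj] (N : ℕ) {p q : ℝ}
    (hp : 0 < p) (hW : ∀ k, 0 < W k)
    (hWp : ∀ k : ℤ, 0 < k → W k = (k : ℝ) ^ p) (hWq : ∀ k : ℤ, 0 < k → W (-k) = (k : ℝ) ^ q)
    {L : ℤ} (hL : 1 ≤ L) :
    ∃ C : ℝ, 0 ≤ C ∧ ∀ (x : ℕ → Fin N → V) (k : ℕ) (D : V → V → Prop), IsTrap G x k L D →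
      ∀ i u, trapFactor G W D k x i u ≤ 1 + C * (outflow x k (x k i) : ℝ) ^ (max q 0 - p) := by
  classical
  set M : ℝ := (Fintype.card V : ℝ) with hM
  set q' : ℝ := max q 0 with hq'
  have hq'0 : 0 ≤ q' := le_max_right _ _
  have hL0 : (0 : ℝ) < L := by
    have : (1 : ℝ) ≤ L := by exact_mod_cast hL
    linarith
  set K : ℝ := (L : ℝ) ^ p + W 0 + (1 + N : ℝ) ^ q' with hK
  have hW0 := hW 0
  have hKL : 0 ≤ (L : ℝ) ^ p := by positivity
  have hKN : 0 ≤ (1 + N : ℝ) ^ q' := by positivity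
  refine ⟨M * K * (M * L) ^ p, by positivity, fun x k D h i u => ?_⟩
  set a := x k i with ha
  have : Nonempty V := ⟨a⟩
  have hM1 : 1 ≤ M := by
    rw [hM]
    exact_mod_cast Fintype.card_pos
  obtain ⟨w₀, hw₀⟩ := h.walkers i
  set F : ℝ := (outflow x k a : ℝ) with hF
  have hF1 : 1 ≤ F := by
    have h1 := h.pos _ _ hw₀
    rw [← ha] at h1
    have h2 := crossing_le_outflow x k a w₀
    rw [hF]
    exact_mod_cast (by omega : 1 ≤ outflow x k a)
  have hF0 : 0 < F := by linarith
  have hr : 0 ≤ M * K * (M * L) ^ p * F ^ (q' - p) := by positivity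
  by_cases hu : D a u
  swap
  · rw [trapFactor, if_neg hu]
    linarith
  -- the most used edge of `D` at `a`
  obtain ⟨w, hw, hwmax⟩ := Finset.exists_max_image (Finset.univ.filter (D a)) (crossing x k a)
    ⟨w₀, by simpa using hw₀⟩
  have hDw : D a w := (Finset.mem_filter.1 hw).2
  set b : ℝ := (crossing x k a w : ℝ) with hb
  have hcw := h.pos _ _ hDw
  have hb1 : 1 ≤ b := by
    rw [hb]
    exact_mod_cast hcw
  have hFb : F ≤ M * L * b := by
    have h1 : outflow x k a ≤ Fintype.card V * (L * crossing x k a w) := by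
      refine outflow_le_card_mul x k a (by positivity) fun v => ?_
      by_cases hv : D a v
      · have := hwmax v (by simpa using hv)
        nlinarith
      · have := h.low a w v hDw hv
        nlinarith
    have h2 : (outflow x k a : ℝ) ≤ ((Fintype.card V * (L * crossing x k a w) : ℤ) : ℝ) := by
      exact_mod_cast h1
    push_cast at h2
    rw [mul_assoc]
    exact h2
  set g : ℝ := ∑ w ∈ G.neighborFinset a with D a w, W (crossing x k a w) with hg
  have hgb : b ^ p ≤ g := by
    rw [hb, ← hWp _ hcw]
    exact Finset.single_le_sum (f := fun w => W (crossing x k a w)) (fun v _ => (hW _).le)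
      (Finset.mem_filter.2 ⟨(SimpleGraph.mem_neighborFinset _ _ _).2 (h.adj _ _ hDw), hDw⟩)
  have hb0 : 0 < b ^ p := by positivity
  have hg0 : 0 < g := hb0.trans_le hgb
  have hbad : ∑ w ∈ G.neighborFinset a with ¬ D a w, W (crossing x k a w) ≤ M * (K * F ^ q') := by
    have hFq : 1 ≤ F ^ q' := Real.one_le_rpow hF1 hq'0
    have hterm : ∀ v ∈ (G.neighborFinset a).filter (fun w => ¬ D a w),
        W (crossing x k a v) ≤ K * F ^ q' := by
      intro v hv
      have hlow := h.low a w v hDw (Finset.mem_filter.1 hv).2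
      have hup := neg_crossing_le_outflow x k a v
      rcases lt_trichotomy (crossing x k a v) 0 with h0 | h0 | h0
      · have h1 := hWq (-crossing x k a v) (by omega)
        rw [neg_neg] at h1
        rw [h1]
        set d : ℝ := ((-crossing x k a v : ℤ) : ℝ) with hd
        have hd1 : 1 ≤ d := by
          rw [hd]
          exact_mod_cast (by omega : 1 ≤ -crossing x k a v)
        have hdF : d ≤ F + N := by
          have : ((-crossing x k a v : ℤ) : ℝ) ≤ ((outflow x k a + N : ℤ) : ℝ) := by
            exact_mod_cast hup
          push_cast at this ⊢
          rw [hd]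
          push_cast
          exact this
        have hN0 : (0 : ℝ) ≤ N := Nat.cast_nonneg N
        calc d ^ q ≤ d ^ q' := Real.rpow_le_rpow_of_exponent_le hd1 (le_max_left _ _)
          _ ≤ ((1 + N) * F) ^ q' := by
              refine Real.rpow_le_rpow (by linarith) ?_ hq'0
              nlinarith
          _ = (1 + N : ℝ) ^ q' * F ^ q' := Real.mul_rpow (by positivity) hF0.le
          _ ≤ K * F ^ q' := by
              refine mul_le_mul_of_nonneg_right ?_ (by linarith)
              rw [hK]
              linarith
      · rw [h0]
        calc W 0 ≤ K := by rw [hK]; linarith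
          _ ≤ K * F ^ q' := le_mul_of_one_le_right (by positivity) hFq
      · rw [hWp _ h0]
        calc ((crossing x k a v : ℤ) : ℝ) ^ p ≤ (L : ℝ) ^ p := by
              refine Real.rpow_le_rpow ?_ ?_ hp.le
              · exact_mod_cast h0.le
              · exact_mod_cast hlow
          _ ≤ K := by rw [hK]; linarith
          _ ≤ K * F ^ q' := le_mul_of_one_le_right (by positivity) hFq
    refine (Finset.sum_le_card_nsmul _ _ _ hterm).trans ?_
    rw [nsmul_eq_mul]
    refine mul_le_mul_of_nonneg_right ?_ (by positivity)
    rw [hM]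
    exact_mod_cast Finset.card_le_univ _
  rw [trapFactor, if_pos hu, ← ha, ← Finset.sum_filter_add_sum_filter_not _ (D a), add_div, ← hg,
    div_self hg0.ne']
  refine add_le_add le_rfl ?_
  calc (∑ w ∈ G.neighborFinset a with ¬ D a w, W (crossing x k a w)) / g
      ≤ M * (K * F ^ q') / b ^ p := div_le_div₀ (by positivity) hbad hb0 hgb
    _ ≤ M * (K * F ^ q') / (F / (M * L)) ^ p := by
        refine div_le_div_of_nonneg_left (by positivity) (by positivity) ?_
        refine Real.rpow_le_rpow (by positivity) ?_ hp.le
        rw [div_le_iff₀ (by positivity)]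
        linarith
    _ = M * K * (M * L) ^ p * F ^ (q' - p) := by
        rw [Real.div_rpow hF0.le (by positivity), Real.rpow_sub hF0]
        field_simp

/-- Since the outflow of a vertex grows by one with each departure, the product of the factors
stays bounded when `p > 1 + max q 0`. -/
theorem exists_jumpProd_trapFactor_le (G : SimpleGraph V) [DecidableRel G.Adj] (N : ℕ) {p q : ℝ}
    (hpq : 1 + max q 0 < p) (hW : ∀ k, 0 < W k)
    (hWp : ∀ k : ℤ, 0 < k → W k = (k : ℝ) ^ p) (hWq : ∀ k : ℤ, 0 < k → W (-k) = (k : ℝ) ^ q)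
    {L : ℤ} (hL : 1 ≤ L) :
    ∃ R : ℝ, 0 < R ∧ ∀ (x : ℕ → Fin N → V) (n : ℕ) (D : V → V → Prop), IsTrap G x n L D →
      ∀ t ≥ n, ValidUpTo G x t → jumpProd (trapFactor G W D) n t x ≤ R := by
  have hp : 0 < p := by
    have := le_max_right q 0
    linarith
  obtain ⟨C, hC0, hC⟩ := exists_trapFactor_le G N hp hW hWp hWq hL
  set T : ℕ → ℝ := fun m => ∑ j ∈ Finset.range m, C * (j : ℝ) ^ (max q 0 - p) with hT
  have hsum : Summable fun j : ℕ => C * (j : ℝ) ^ (max q 0 - p) :=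
    (Real.summable_nat_rpow.2 (by linarith)).mul_left C
  set Z : ℝ := ∑' j : ℕ, C * (j : ℝ) ^ (max q 0 - p) with hZ
  have hTZ : ∀ m, T m ≤ Z := fun m => hsum.sum_le_tsum _ fun j _ => by positivity
  have hT0 : ∀ m, 0 ≤ T m := fun m => Finset.sum_nonneg fun j _ => by positivity
  refine ⟨Real.exp (Fintype.card V * Z), Real.exp_pos _, fun x n D h t ht hv => ?_⟩
  suffices hs : jumpProd (trapFactor G W D) n t x ≤
      Real.exp (∑ a, T (outflow x t a).toNat) by
    refine hs.trans (Real.exp_le_exp.2 ?_)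
    refine (Finset.sum_le_card_nsmul _ _ Z fun a _ => hTZ _).trans ?_
    simp
  induction t, ht using Nat.le_induction with
  | base =>
    rw [jumpProd_self]
    exact Real.one_le_exp (Finset.sum_nonneg fun a _ => hT0 _)
  | succ t ht ih =>
    by_cases h0 : jumpProd (trapFactor G W D) n (t + 1) x = 0
    · rw [h0]
      exact (Real.exp_pos _).le
    have hf := ((h.of_jumpProd_ne_zero (ht.trans (Nat.le_succ t)) hv h0).2) t
      ⟨ht, Nat.lt_succ_self t⟩
    rw [jumpProd_succ ht] at h0 ⊢
    have hv' := hv.mono (Nat.le_succ t)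
    have htrap := (h.of_jumpProd_ne_zero ht hv' (left_ne_zero_of_mul h0)).1
    obtain ⟨i, b, hm⟩ := hv t (Nat.lt_succ_self t)
    have hstep : ∑ a, T (outflow x (t + 1) a).toNat = ∑ a, T (outflow x t a).toNat +
        C * (outflow x t (x t i) : ℝ) ^ (max q 0 - p) := by
      rw [← Finset.add_sum_erase _ _ (Finset.mem_univ (x t i)),
        ← Finset.add_sum_erase _ (fun a => T (outflow x t a).toNat) (Finset.mem_univ (x t i))]
      have h1 : ∑ a ∈ Finset.univ.erase (x t i), T (outflow x (t + 1) a).toNat =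
          ∑ a ∈ Finset.univ.erase (x t i), T (outflow x t a).toNat := by
        refine Finset.sum_congr rfl fun a ha => ?_
        rw [outflow_succ hm hf, if_neg (Finset.ne_of_mem_erase ha).symm, add_zero]
      have hnn := outflow_nonneg x t (x t i)
      have h2 : (outflow x (t + 1) (x t i)).toNat = (outflow x t (x t i)).toNat + 1 := by
        rw [outflow_succ hm hf, if_pos rfl]
        omega
      have h3 : (((outflow x t (x t i)).toNat : ℕ) : ℝ) = (outflow x t (x t i) : ℝ) := by
        exact_mod_cast Int.toNat_of_nonneg hnn
      rw [h1, h2]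
      simp only [hT]
      rw [Finset.sum_range_succ, h3]
      ring
    rw [hstep, Real.exp_add, hm.jumpFactor_eq]
    refine mul_le_mul (ih hv') ((hC x t D htrap i b).trans ?_) ?_ (Real.exp_pos _).le
    · rw [add_comm]
      exact Real.add_one_le_exp _
    · unfold trapFactor
      split_ifs
      · exact div_nonneg (Finset.sum_nonneg fun _ _ => (hW _).le)
          (Finset.sum_nonneg fun _ _ => (hW _).le)
      · exact le_rfl

theorem exists_le_measureReal_forward_of_isTrap (hN : 1 ≤ N) {p q : ℝ} (hpq : 1 + max q 0 < p)
    (hW : ∀ k, 0 < W k) (hWp : ∀ k : ℤ, 0 < k → W k = (k : ℝ) ^ p)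
    (hWq : ∀ k : ℤ, 0 < k → W (-k) = (k : ℝ) ^ q) (hX : IsAntRW G μ W X) {L : ℤ} (hL : 1 ≤ L) :
    ∃ δ : ℝ, 0 < δ ∧ ∀ (n : ℕ) (x₀ : ℕ → Fin N → V) (D : V → V → Prop), IsTrap G x₀ n L D →
      δ * μ.real (cylinder X n x₀) ≤
        μ.real (cylinder X n x₀ ∩ {ω | ∀ k ≥ n, Forward (fun j => X j ω) k}) := by
  obtain ⟨R, hR0, hR⟩ := exists_jumpProd_trapFactor_le G N hpq hW hWp hWq hL
  refine ⟨R⁻¹, inv_pos.2 hR0, fun n x₀ D h => ?_⟩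
  set H := cylinder X n x₀ with hH
  have hmH : MeasurableSet H := (histFiltration hX.measurableSet_eq).le n _
    (measurableSet_cylinder hX.measurableSet_eq n _)
  have hmF : ∀ t, MeasurableSet {ω | ForwardOn (fun j => X j ω) n t} := fun t =>
    (histFiltration hX.measurableSet_eq).le t _ (measurableSet_of_congr hX.measurableSet_eq t
      (fun x => ForwardOn x n t) fun x y hxy h' => h'.congr hxy)
  have hψ : ∀ k (x y : ℕ → Fin N → V), (∀ m ≤ k, x m = y m) →
      trapFactor G W D k x = trapFactor G W D k y := fun k x y hxy => trapFactor_congr D hxy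
  have hfin : ∀ t ≥ n, R⁻¹ * μ.real H ≤ μ.real (H ∩ {ω | ForwardOn (fun j => X j ω) n t}) := by
    intro t ht
    have h1 := integral_jumpProd hN hW hX hψ n x₀ (fun t ht x hv hx h0 i =>
      ((h.congr fun m hm => (hx m hm).symm).of_jumpProd_ne_zero ht hv
        h0).1.sum_jumpProb_trapFactor hW i) ht
    have h2 : ∫ ω in H, jumpProd (trapFactor G W D) n t (fun k => X k ω) ∂μ ≤
        ∫ ω in H, {ω | ForwardOn (fun j => X j ω) n t}.indicator (fun _ => R) ω ∂μ := by
      refine setIntegral_mono_ae_restrict ?_ ?_ ?_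
      · exact (integrable_of_congr hX.measurableSet_eq t _
          fun x y hxy => jumpProd_congr hψ hxy).integrableOn
      · exact ((integrable_const R).indicator (hmF t)).integrableOn
      · rw [EventuallyLE, ae_restrict_iff' hmH]
        filter_upwards [ae_isMove hX] with ω hv hω
        have htr : IsTrap G (fun k => X k ω) n L D := h.congr fun m hm => (hω m hm).symm
        by_cases h0 : jumpProd (trapFactor G W D) n t (fun k => X k ω) = 0
        · rw [h0]
          exact Set.indicator_nonneg (fun _ _ => hR0.le) _
        · have hfo := (htr.of_jumpProd_ne_zero ht (fun k _ => hv k) h0).2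
          rw [Set.indicator_of_mem (show ω ∈ {ω | ForwardOn (fun j => X j ω) n t} from hfo)]
          exact hR _ _ _ htr t ht fun k _ => hv k
    rw [integral_indicator_const _ (hmF t), measureReal_restrict_apply (hmF t),
      Set.inter_comm, smul_eq_mul] at h2
    simp only [RCLike.ofReal_real_eq_id, id_eq] at h1
    rw [h1] at h2
    rw [inv_mul_le_iff₀ hR0]
    linarith
  have hInter : H ∩ {ω | ∀ k ≥ n, Forward (fun j => X j ω) k} =
      ⋂ t, H ∩ {ω | ForwardOn (fun j => X j ω) n t} := by
    ext ω
    simp only [Set.mem_inter_iff, Set.mem_iInter]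
    refine ⟨fun hω t => ⟨hω.1, fun j hj => hω.2 j hj.1⟩, fun hω => ⟨(hω 0).1, fun k hk => ?_⟩⟩
    exact (hω (k + 1)).2 k ⟨hk, Nat.lt_succ_self k⟩
  have hanti : Antitone fun t => H ∩ {ω | ForwardOn (fun j => X j ω) n t} := fun s t hst =>
    Set.inter_subset_inter_right _ fun ω hω j hj => hω j ⟨hj.1, hj.2.trans_le hst⟩
  have hlim := tendsto_measure_iInter_atTop (μ := μ)
    (fun t => (hmH.inter (hmF t)).nullMeasurableSet) hanti ⟨0, measure_ne_top _ _⟩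
  rw [← hInter] at hlim
  have hlim' := (ENNReal.tendsto_toReal (measure_ne_top _ _)).comp hlim
  exact ge_of_tendsto hlim' (eventually_atTop.2 ⟨n, hfin⟩)

end Trap

/-! ### Preparing a configuration in boundedly many steps -/

section Reach

set_option linter.unusedSectionVars false

variable {V : Type*} [DecidableEq V] [Fintype V] {N : ℕ} {G : SimpleGraph V} [DecidableRel G.Adj]
  {W : ℤ → ℝ} {κ : ℝ} {x y z : ℕ → Fin N → V} {n m l : ℕ}

/-- The trajectory `y` up to time `m` continues `x` up to time `n`, and each additional step is a
legal move of conditional probability at least `κ`. -/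
structure Reaches (G : SimpleGraph V) [DecidableRel G.Adj] (W : ℤ → ℝ) (κ : ℝ)
    (x : ℕ → Fin N → V) (n : ℕ) (y : ℕ → Fin N → V) (m : ℕ) : Prop where
  le : n ≤ m
  agree : ∀ k ≤ n, y k = x k
  step : ∀ k ∈ Set.Ico n m, (∃ i b, IsMove G y k i b) ∧ κ ≤ transProb G W y k (y (k + 1))

theorem Reaches.refl (x : ℕ → Fin N → V) (n : ℕ) : Reaches G W κ x n x n :=
  ⟨le_rfl, fun _ _ => rfl, fun _ hk => absurd hk.1 (not_le.2 hk.2)⟩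

theorem Reaches.trans (h₁ : Reaches G W κ x n y m) (h₂ : Reaches G W κ y m z l) :
    Reaches G W κ x n z l where
  le := h₁.le.trans h₂.le
  agree k hk := (h₂.agree k (hk.trans h₁.le)).trans (h₁.agree k hk)
  step k hk := by
    by_cases hkm : k < m
    · obtain ⟨⟨i, b, hm⟩, hκ⟩ := h₁.step k ⟨hk.1, hkm⟩
      refine ⟨⟨i, b, hm.congr (h₂.agree k hkm.le).symm (h₂.agree _ hkm).symm⟩, ?_⟩
      rwa [h₂.agree _ hkm, transProb_congr fun j hj => h₂.agree j (hj.trans hkm.le)]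
    · exact h₂.step k ⟨not_lt.1 hkm, hk.2⟩

theorem Reaches.valid (h : Reaches G W κ x n y m) (hv : ValidUpTo G x n) : ValidUpTo G y m := by
  intro k hk
  by_cases hkn : k < n
  · obtain ⟨i, b, hm⟩ := hv k hkn
    exact ⟨i, b, hm.congr (h.agree k hkn.le).symm (h.agree _ hkn).symm⟩
  · exact (h.step k ⟨not_lt.1 hkn, hk⟩).1

theorem Reaches.abs_crossing_le (h : Reaches G W κ x n y m) (u v : V) :
    |crossing y m u v| ≤ |crossing x n u v| + (m - n : ℕ) := by
  have key : ∀ k, n ≤ k → k ≤ m → |crossing y k u v| ≤ |crossing x n u v| + (k - n : ℕ) := by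
    intro k hk
    induction k, hk using Nat.le_induction with
    | base =>
      intro _
      rw [crossing_congr fun j hj => h.agree j hj]
      simp
    | succ k hk ih =>
      intro hkm
      obtain ⟨i, b, hm⟩ := (h.step k ⟨hk, hkm⟩).1
      have h1 := abs_crossing_succ_sub_le hm u v
      have h2 := ih (by omega)
      omega
  exact key m h.le le_rfl

/-- Where the crossing numbers are bounded, all jumps have conditional probabilities bounded
below. -/
theorem exists_jump_prob_bound (hN : 1 ≤ N) (G : SimpleGraph V) [DecidableRel G.Adj]
    (hW : ∀ k, 0 < W k) (B : ℤ) :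
    ∃ κ : ℝ, 0 < κ ∧ κ ≤ 1 ∧ ∀ (x : ℕ → Fin N → V) (n : ℕ) (i : Fin N) (b : V),
      G.Adj (x n i) b → (∀ w, |crossing x n (x n i) w| ≤ B) →
      ∃ y, Reaches G W κ x n y (n + 1) ∧ IsMove G y n i b := by
  rcases isEmpty_or_nonempty V with hV | hV
  · exact ⟨1, one_pos, le_rfl, fun x n i b => (hV.false b).elim⟩
  rcases lt_or_ge B 0 with hB | hB
  · exact ⟨1, one_pos, le_rfl, fun x n i b _ h =>
      absurd (h b) (not_le.2 (hB.trans_le (abs_nonneg _)))⟩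
  have hne : (Finset.Icc (-B) B).Nonempty := ⟨0, by simp [hB]⟩
  obtain ⟨c₁, -, hc₁⟩ := Finset.exists_min_image _ W hne
  obtain ⟨c₂, -, hc₂⟩ := Finset.exists_max_image _ W hne
  set M : ℝ := (Fintype.card V : ℝ) with hM
  have hM0 : 0 < M := by
    rw [hM]
    exact_mod_cast Fintype.card_pos
  have hN0 : (0 : ℝ) < N := by exact_mod_cast hN
  have h1 := hW c₁
  have h2 := hW c₂
  refine ⟨min 1 (1 / N * (W c₁ / (M * W c₂))), lt_min one_pos (by positivity), min_le_left _ _,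
    fun x n i b hadj hb => ?_⟩
  set y := Function.update x (n + 1) (Function.update (x n) i b) with hy
  have hyx : ∀ k ≤ n, y k = x k := fun k hk => Function.update_of_ne (by omega) _ _
  have hmv : IsMove G y n i b := isMove_update x hadj
  have hmem : ∀ w, crossing x n (x n i) w ∈ Finset.Icc (-B) B := fun w =>
    Finset.mem_Icc.2 (abs_le.1 (hb w))
  refine ⟨y, ⟨Nat.le_succ n, hyx, fun k hk => ?_⟩, hmv⟩
  obtain rfl : k = n := le_antisymm (Nat.lt_succ_iff.1 hk.2) hk.1
  refine ⟨⟨i, b, hmv⟩, (min_le_right _ _).trans (le_trans ?_ (transProb_ge hW hmv))⟩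
  rw [jumpProb_congr hyx, jumpProb, if_pos hadj]
  gcongr
  · exact (hW _).le
  · exact Finset.sum_pos (fun _ _ => hW _) ⟨b, (SimpleGraph.mem_neighborFinset _ _ _).2 hadj⟩
  · exact hc₁ _ (hmem b)
  · refine (Finset.sum_le_card_nsmul _ _ _ fun w _ => hc₂ _ (hmem w)).trans ?_
    rw [nsmul_eq_mul]
    refine mul_le_mul_of_nonneg_right ?_ h2.le
    rw [hM]
    exact_mod_cast Finset.card_le_univ _

/-- Jumps out of configurations with crossing numbers at most `B` at the position of the walker
have probability at least `κ`. -/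
def JumpBound (N : ℕ) (G : SimpleGraph V) [DecidableRel G.Adj] (W : ℤ → ℝ) (B : ℤ) (κ : ℝ) :
    Prop :=
  ∀ (x : ℕ → Fin N → V) (n : ℕ) (i : Fin N) (b : V),
    G.Adj (x n i) b → (∀ w, |crossing x n (x n i) w| ≤ B) →
    ∃ y, Reaches G W κ x n y (n + 1) ∧ IsMove G y n i b

/-- A walker can be led along a walk; crossing numbers off the walk do not change. -/
theorem exists_reaches_walk {B : ℤ} (hκ : JumpBound N G W B κ) {a b : V} (p : G.Walk a b) :
    ∀ (x : ℕ → Fin N → V) (n : ℕ) (i : Fin N), x n i = a →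
      (∀ u v, |crossing x n u v| + p.length ≤ B) →
      ∃ y, Reaches G W κ x n y (n + p.length) ∧ y (n + p.length) i = b ∧
        ∀ u v, s(u, v) ∉ p.edges → crossing y (n + p.length) u v = crossing x n u v := by
  induction p with
  | nil =>
    intro x n i hi _
    exact ⟨x, Reaches.refl x n, hi, fun u v _ => rfl⟩
  | @cons a c b h p ih =>
    intro x n i hi hB
    subst hi
    simp only [SimpleGraph.Walk.length_cons] at hB ⊢
    obtain ⟨y, hy, hm⟩ := hκ x n i c h fun w => by
      have := hB (x n i) w
      push_cast at this
      omega
    obtain ⟨z, hz, hzi, hzc⟩ := ih y (n + 1) i hm.apply_self fun u v => by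
      have h1 := hy.abs_crossing_le u v
      have h2 := hB u v
      have h3 : n + 1 - n = 1 := by omega
      rw [h3] at h1
      push_cast at h1 h2
      omega
    have harr : n + 1 + p.length = n + (p.length + 1) := by omega
    rw [harr] at hz hzi hzc
    refine ⟨z, hy.trans hz, hzi, fun u v huv => ?_⟩
    rw [SimpleGraph.Walk.edges_cons, List.mem_cons, not_or] at huv
    rw [hzc u v huv.2, crossing_succ_of_ne hm, crossing_congr fun k hk => hy.agree k hk]
    · rw [hy.agree n le_rfl]
      rintro ⟨rfl, rfl⟩
      exact huv.1 rfl
    · rw [hy.agree n le_rfl]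
      rintro ⟨rfl, rfl⟩
      exact huv.1 Sym2.eq_swap

/-- A walker can be led into `S` through vertices outside `S`. -/
theorem exists_reaches_mem {B : ℤ} (hκ : JumpBound N G W B κ) {S : Set V} {a s : V}
    (p : G.Walk a s) (hs : s ∈ S) :
    ∀ (x : ℕ → Fin N → V) (n : ℕ) (i : Fin N), x n i = a →
      (∀ u ∉ S, ∀ v, |crossing x n u v| + p.length ≤ B) →
      ∃ y m, Reaches G W κ x n y m ∧ m ≤ n + p.length ∧ y m i ∈ S ∧ (∀ j ≠ i, y m j = x n j) ∧
        ∀ u ∈ S, ∀ v ∈ S, crossing y m u v = crossing x n u v := by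
  induction p with
  | nil =>
    intro x n i hi _
    exact ⟨x, n, Reaches.refl x n, by simp, by rwa [hi], fun j _ => rfl, fun u _ v _ => rfl⟩
  | @cons a c b h p ih =>
    intro x n i hi hB
    subst hi
    by_cases ha : x n i ∈ S
    · exact ⟨x, n, Reaches.refl x n, by omega, ha, fun j _ => rfl, fun u _ v _ => rfl⟩
    simp only [SimpleGraph.Walk.length_cons] at hB ⊢
    obtain ⟨y, hy, hm⟩ := hκ x n i c h fun w => by
      have := hB (x n i) ha w
      push_cast at this
      omega
    obtain ⟨z, m, hz, hmn, hzi, hzj, hzc⟩ := ih hs y (n + 1) i hm.apply_self fun u hu v => by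
      have h1 := hy.abs_crossing_le u v
      have h2 := hB u hu v
      have h3 : n + 1 - n = 1 := by omega
      rw [h3] at h1
      push_cast at h1 h2
      omega
    refine ⟨z, m, hy.trans hz, by omega, hzi, fun j hj => ?_, fun u hu v hv => ?_⟩
    · rw [hzj j hj, hm.apply_ne hj, hy.agree n le_rfl]
    · rw [hzc u hu v hv, crossing_succ_of_ne hm, crossing_congr fun k hk => hy.agree k hk]
      · rw [hy.agree n le_rfl]
        rintro ⟨rfl, rfl⟩
        exact ha hu
      · rw [hy.agree n le_rfl]
        rintro ⟨rfl, rfl⟩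
        exact ha hv

theorem exists_walk_length_le (hconn : G.Connected) (a b : V) :
    ∃ p : G.Walk a b, p.length ≤ Fintype.card V := by
  obtain ⟨p, hp⟩ := (hconn a b).exists_isPath
  exact ⟨p, hp.length_lt.le⟩

/-- All walkers can be led into `S`. -/
theorem exists_reaches_forall_mem {B : ℤ} (hκ : JumpBound N G W B κ) (hconn : G.Connected)
    {S : Set V} (hS : S.Nonempty) (x : ℕ → Fin N → V) (n : ℕ)
    (hB : ∀ u ∉ S, ∀ v, |crossing x n u v| + (N * Fintype.card V : ℕ) ≤ B) :
    ∃ y m, Reaches G W κ x n y m ∧ m ≤ n + N * Fintype.card V ∧ (∀ i, y m i ∈ S) ∧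
      ∀ u ∈ S, ∀ v ∈ S, crossing y m u v = crossing x n u v := by
  classical
  obtain ⟨s, hs⟩ := hS
  have key : ∀ t : Finset (Fin N), ∃ y m, Reaches G W κ x n y m ∧
      m ≤ n + t.card * Fintype.card V ∧ (∀ i ∈ t, y m i ∈ S) ∧
      ∀ u ∈ S, ∀ v ∈ S, crossing y m u v = crossing x n u v := by
    intro t
    induction t using Finset.induction_on with
    | empty => exact ⟨x, n, Reaches.refl x n, by simp, by simp, fun u _ v _ => rfl⟩
    | insert i t hi ih =>
      obtain ⟨y, m, hy, hm, hyt, hyc⟩ := ih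
      obtain ⟨p, hp⟩ := exists_walk_length_le hconn (y m i) s
      have hcard : t.card + 1 ≤ N := by
        have := Finset.card_le_univ (insert i t)
        rwa [Finset.card_insert_of_notMem hi, Fintype.card_fin] at this
      have hmul : t.card * Fintype.card V + Fintype.card V ≤ N * Fintype.card V := by
        rw [← Nat.succ_mul]
        exact Nat.mul_le_mul_right _ hcard
      obtain ⟨z, l, hz, hl, hzi, hzj, hzc⟩ := exists_reaches_mem hκ p hs y m i rfl
        fun u hu v => by
          have h1 := hy.abs_crossing_le u v
          have h2 := hB u hu v
          omega
      refine ⟨z, l, hy.trans hz, ?_, ?_, fun u hu v hv => (hzc u hu v hv).trans (hyc u hu v hv)⟩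
      · rw [Finset.card_insert_of_notMem hi, Nat.succ_mul]
        omega
      · intro j hj
        by_cases hji : j = i
        · rw [hji]
          exact hzi
        · rw [hzj j hji]
          exact hyt j ((Finset.mem_insert.1 hj).resolve_left hji)
  obtain ⟨y, m, hy, hm, hyt, hyc⟩ := key Finset.univ
  exact ⟨y, m, hy, by simpa using hm, fun i => hyt i (Finset.mem_univ i), hyc⟩

/-- If no crossing number lies between the levels `l` and `l' = |V| l + N`, the edges above the
gap can be followed indefinitely, because the crossing numbers almost form a circulation. -/
theorem exists_reaches_isTrap_of_gap {B l l' : ℤ} (hκ : JumpBound N G W B κ)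
    (hconn : G.Connected) (hl : 1 ≤ l) (hl' : l' = Fintype.card V * l + N)
    (hB : l + (N * Fintype.card V : ℕ) ≤ B) (x : ℕ → Fin N → V) (n : ℕ) (hv : ValidUpTo G x n)
    (hgap : ∀ u v, l ≤ |crossing x n u v| → l' ≤ |crossing x n u v|)
    (hex : ∃ u v, l' ≤ crossing x n u v) :
    ∃ y m D, Reaches G W κ x n y m ∧ m ≤ n + N * Fintype.card V ∧
      IsTrap G y m (l + (N * Fintype.card V : ℕ)) D := by
  have : Nonempty V := hex.nonempty
  have hM : (1 : ℤ) ≤ Fintype.card V := by exact_mod_cast Fintype.card_pos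
  have hll' : l ≤ l' := by nlinarith [Int.natCast_nonneg N]
  set D : V → V → Prop := fun u v => l' ≤ crossing x n u v with hD
  set S : Set V := {u | ∃ w, D u w} with hS
  have hclosed : ∀ u v, D u v → v ∈ S := by
    intro u v huv
    have h1 : l' ≤ ∑ w, max (crossing x n w v) 0 :=
      (huv.trans (le_max_left _ _)).trans (Finset.single_le_sum
        (f := fun w => max (crossing x n w v) 0) (fun _ _ => le_max_right _ _) (Finset.mem_univ u))
    have h2 := abs_le.1 (abs_outflow_sub_inflow_le x n v)
    by_contra hcon
    have h3 : ∀ w, crossing x n v w ≤ l - 1 := by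
      intro w
      by_contra hw
      refine hcon ⟨w, ?_⟩
      have h4 := hgap v w (by rw [abs_of_nonneg (by omega)]; omega)
      rwa [abs_of_nonneg (by omega)] at h4
    have h5 := outflow_le_card_mul x n v (by omega) h3
    nlinarith [h2.1]
  have hout : ∀ u ∉ S, ∀ v, |crossing x n u v| < l := by
    intro u hu v
    by_contra hcon
    have h1 := hgap u v (not_lt.1 hcon)
    rcases le_abs.1 h1 with h2 | h2
    · exact hu ⟨v, h2⟩
    · exact hu (hclosed v u (by rw [hD]; simp only; rw [crossing_swap]; exact h2))
  obtain ⟨u₀, v₀, h₀⟩ := hex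
  obtain ⟨y, m, hy, hm, hyS, hyc⟩ := exists_reaches_forall_mem hκ hconn (S := S) ⟨u₀, v₀, h₀⟩ x n
    fun u hu v => by
      have := hout u hu v
      omega
  refine ⟨y, m, D, hy, hm, ?_, ?_, hclosed, hyS, ?_⟩
  · intro u v huv
    have huv' : l' ≤ crossing x n u v := huv
    exact adj_of_crossing_ne_zero hv (by omega)
  · intro u v huv
    have huv' : l' ≤ crossing x n u v := huv
    rw [hyc u ⟨v, huv⟩ v (hclosed u v huv)]
    omega
  · intro u v w huv huw
    have h1 : crossing x n u w < l' := not_le.1 huw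
    by_cases hwS : w ∈ S
    · rw [hyc u ⟨v, huv⟩ w hwS]
      by_contra hcon
      have h2 := hgap u w (by rw [abs_of_nonneg (by omega)]; omega)
      rw [abs_of_nonneg (by omega)] at h2
      omega
    · have h2 := hy.abs_crossing_le w u
      have h3 := hout w hwS u
      have h4 := neg_abs_le (crossing y m w u)
      rw [crossing_swap y m w u]
      omega

/-- The levels between which a gap is looked for. -/
def level (M N : ℕ) : ℕ → ℤ
  | 0 => 1
  | j + 1 => M * level M N j + N

theorem one_le_level {M : ℕ} (hM : 1 ≤ M) (N j : ℕ) : 1 ≤ level M N j := by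
  induction j with
  | zero => exact le_rfl
  | succ j ih =>
    have : (1 : ℤ) ≤ M := by exact_mod_cast hM
    simp only [level]
    nlinarith [Int.natCast_nonneg N]

theorem level_mono {M : ℕ} (hM : 1 ≤ M) (N : ℕ) : Monotone (level M N) := by
  refine monotone_nat_of_le_succ fun j => ?_
  have h1 : (1 : ℤ) ≤ M := by exact_mod_cast hM
  have h2 := one_le_level hM N j
  simp only [level]
  nlinarith [Int.natCast_nonneg N]

/-- There are more levels than edges, so one of the intervals between levels is free of crossing
numbers. -/
theorem exists_gap (x : ℕ → Fin N → V) (n : ℕ)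
    (hex : ∃ u v, level (Fintype.card V) N (Fintype.card V ^ 2) ≤ |crossing x n u v|) :
    ∃ j < Fintype.card V ^ 2,
      (∀ u v, level (Fintype.card V) N j ≤ |crossing x n u v| →
        level (Fintype.card V) N (j + 1) ≤ |crossing x n u v|) := by
  obtain ⟨u₀, v₀, h₀⟩ := hex
  have : Nonempty V := ⟨u₀⟩
  have hM : 1 ≤ Fintype.card V := Fintype.card_pos
  by_contra! hcon
  have hall : ∀ j : Fin (Fintype.card V ^ 2 + 1), ∃ e : V × V,
      level (Fintype.card V) N j ≤ |crossing x n e.1 e.2| ∧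
      ((j : ℕ) < Fintype.card V ^ 2 →
        |crossing x n e.1 e.2| < level (Fintype.card V) N (j + 1)) := by
    intro j
    rcases Nat.lt_succ_iff_lt_or_eq.1 j.2 with h | h
    · obtain ⟨u, v, h1, h2⟩ := hcon j h
      exact ⟨(u, v), h1, fun _ => h2⟩
    · refine ⟨(u₀, v₀), by rw [h]; exact h₀, fun h' => absurd h' (by omega)⟩
  choose e he₁ he₂ using hall
  have hlt : ∀ j k : Fin (Fintype.card V ^ 2 + 1), j < k → e j ≠ e k := by
    intro j k hjk hejk
    have h1 := he₂ j (by have := k.2; have : (j : ℕ) < k := hjk; omega)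
    have h2 := he₁ k
    rw [← hejk] at h2
    have h3 : level (Fintype.card V) N (j + 1) ≤ level (Fintype.card V) N k :=
      level_mono hM N hjk
    omega
  have hinj : Function.Injective e := by
    intro j k hjk
    rcases lt_trichotomy j k with h | h | h
    · exact absurd hjk (hlt j k h)
    · exact h
    · exact absurd hjk.symm (hlt k j h)
  have := Fintype.card_le_of_injective e hinj
  rw [Fintype.card_fin, Fintype.card_prod, sq] at this
  omega

/-- Leading a walker around a circuit `r` times raises the crossing number of its first edge
by `r`. -/
theorem exists_reaches_laps {B : ℤ} (hκ : JumpBound N G W B κ) {a c : V} (h : G.Adj a c)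
    (p : G.Walk c a) (hp : s(a, c) ∉ p.edges) (r : ℕ) :
    ∀ (x : ℕ → Fin N → V) (n : ℕ) (i : Fin N), x n i = a →
      (∀ u v, |crossing x n u v| + (r * (p.length + 1) : ℕ) ≤ B) →
      ∃ y, Reaches G W κ x n y (n + r * (p.length + 1)) ∧
        crossing y (n + r * (p.length + 1)) a c = crossing x n a c + r := by
  induction r with
  | zero =>
    intro x n i _ _
    exact ⟨x, by simpa using Reaches.refl x n, by simp⟩
  | succ r ih =>
    intro x n i hi hB
    have hlen : (r + 1) * (p.length + 1) = r * (p.length + 1) + p.length + 1 := by ring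
    rw [hlen] at hB ⊢
    subst hi
    obtain ⟨y, hy, hm⟩ := hκ x n i c h fun w => by
      have := hB (x n i) w
      push_cast at this
      nlinarith [Int.natCast_nonneg r, Int.natCast_nonneg p.length]
    obtain ⟨z, hz, hzi, hzc⟩ := exists_reaches_walk hκ p y (n + 1) i hm.apply_self fun u v => by
      have h1 := hy.abs_crossing_le u v
      have h2 := hB u v
      have h3 : n + 1 - n = 1 := by omega
      rw [h3] at h1
      push_cast at h1 h2 ⊢
      nlinarith [Int.natCast_nonneg r, Int.natCast_nonneg p.length]
    have hxz := hy.trans hz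
    obtain ⟨w, hw, hwc⟩ := ih z (n + 1 + p.length) i hzi fun u v => by
      have h1 := hxz.abs_crossing_le u v
      have h2 := hB u v
      have h3 : n + 1 + p.length - n = p.length + 1 := by omega
      rw [h3] at h1
      push_cast at h1 h2 ⊢
      linarith
    have harr : n + 1 + p.length + r * (p.length + 1) =
      n + (r * (p.length + 1) + p.length + 1) := by ring
    rw [harr] at hw hwc
    refine ⟨w, hxz.trans hw, ?_⟩
    have h4 := crossing_succ_self hm
    rw [hy.agree n le_rfl, crossing_congr fun k hk => hy.agree k hk] at h4
    rw [hwc, hzc _ _ hp, h4]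
    push_cast
    ring

/-- From any history, a prepared configuration is reached in boundedly many steps of
conditional probability bounded below. -/
theorem exists_reaches_isTrap (hN : 1 ≤ N) (hconn : G.Connected) (C : Circuit G)
    (hW : ∀ k, 0 < W k) :
    ∃ κ : ℝ, 0 < κ ∧ κ ≤ 1 ∧ ∃ (T : ℕ) (L : ℤ), 1 ≤ L ∧
      ∀ (x : ℕ → Fin N → V) (n : ℕ), ValidUpTo G x n → ∃ y m D, Reaches G W κ x n y m ∧
        m ≤ n + T ∧ IsTrap G y m L D := by
  obtain ⟨a, q, hq⟩ := C
  have : Nonempty V := ⟨a⟩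
  have hM : 1 ≤ Fintype.card V := Fintype.card_pos
  cases q with
  | nil => exact absurd rfl hq.ne_nil
  | @cons _ c _ h p =>
  have hp := ((SimpleGraph.Walk.cons_isCycle_iff p h).1 hq).2
  set Λ : ℤ := level (Fintype.card V) N (Fintype.card V ^ 2) with hΛ
  have hΛ1 : 1 ≤ Λ := one_le_level hM N _
  -- enough laps to lift a crossing number from `-(Λ + |V|)` to `Λ`
  set r : ℕ := (2 * Λ + Fintype.card V).toNat with hr
  have hr' : (r : ℤ) = 2 * Λ + Fintype.card V := by omega
  set T₁ : ℕ := Fintype.card V + r * (p.length + 1) with hT₁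
  set B : ℤ := Λ + T₁ + (N * Fintype.card V : ℕ) with hB
  obtain ⟨κ, hκ0, hκ1, hκ⟩ := exists_jump_prob_bound (W := W) hN G hW B
  refine ⟨κ, hκ0, hκ1, T₁ + N * Fintype.card V, Λ + (N * Fintype.card V : ℕ), by omega, ?_⟩
  have hcase : ∀ (x : ℕ → Fin N → V) (n : ℕ), ValidUpTo G x n →
      (∃ u v, Λ ≤ |crossing x n u v|) → ∃ y m D, Reaches G W κ x n y m ∧
        m ≤ n + N * Fintype.card V ∧ IsTrap G y m (Λ + (N * Fintype.card V : ℕ)) D := by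
    intro x n hv hex
    obtain ⟨j, hj, hgap⟩ := exists_gap x n hex
    have h1 : level (Fintype.card V) N j ≤ Λ := level_mono hM N hj.le
    have h2 : level (Fintype.card V) N (j + 1) ≤ Λ := level_mono hM N hj
    obtain ⟨y, m, D, hy, hm, hD⟩ := exists_reaches_isTrap_of_gap
      (l := level (Fintype.card V) N j) (l' := level (Fintype.card V) N (j + 1)) hκ hconn
      (one_le_level hM N j) rfl (by omega) x n hv hgap (by
        obtain ⟨u, v, huv⟩ := hex
        rcases le_abs.1 huv with h3 | h3
        · exact ⟨u, v, by omega⟩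
        · exact ⟨v, u, by rw [crossing_swap]; omega⟩)
    exact ⟨y, m, D, hy, hm, hD.adj, hD.pos, hD.closed, hD.walkers,
      fun u v w huv huw => (hD.low u v w huv huw).trans (by omega)⟩
  intro x n hv
  by_cases hex : ∃ u v, Λ ≤ |crossing x n u v|
  · obtain ⟨y, m, D, hy, hm, hD⟩ := hcase x n hv hex
    exact ⟨y, m, D, hy, by omega, hD⟩
  · push Not at hex
    have i : Fin N := ⟨0, hN⟩
    obtain ⟨w, hw⟩ := exists_walk_length_le hconn (x n i) a
    obtain ⟨y, hy, hyi, -⟩ := exists_reaches_walk hκ w x n i rfl fun u v => by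
      have := hex u v
      omega
    have hbd : ∀ u v, |crossing y (n + w.length) u v| ≤ Λ + Fintype.card V := fun u v => by
      have h1 := hy.abs_crossing_le u v
      have h2 := hex u v
      omega
    obtain ⟨z, hz, hzc⟩ := exists_reaches_laps hκ h p hp r y _ i hyi fun u v => by
      have h1 := hbd u v
      omega
    have hxz := hy.trans hz
    obtain ⟨y', m, D, hy', hm, hD⟩ := hcase z _ (hxz.valid hv) ⟨a, c, by
      have h1 := (abs_le.1 (hbd a c)).1
      rw [hzc]
      refine le_trans ?_ (le_abs_self _)
      omega⟩
    exact ⟨y', m, D, hxz.trans hy', by omega, hD⟩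

end Reach

/-! ### Eventually all jumps are forward -/

section EventuallyForward

set_option linter.unusedSectionVars false

variable {V : Type*} [DecidableEq V] [Fintype V] {N : ℕ} {G : SimpleGraph V} [DecidableRel G.Adj]
  {W : ℤ → ℝ} {Ω : Type*} [mΩ : MeasurableSpace Ω] {μ : Measure Ω} [IsProbabilityMeasure μ]
  {X : ℕ → Ω → Fin N → V} {x y : ℕ → Fin N → V} {n m : ℕ} {κ : ℝ}

theorem Reaches.cylinder_subset (h : Reaches G W κ x n y m) :
    cylinder X m y ⊆ cylinder X n x :=
  fun _ hω k hk => (hω k (hk.trans h.le)).trans (h.agree k hk)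

theorem Reaches.measureReal_cylinder_ge (h : Reaches G W κ x n y m) (hκ : 0 ≤ κ)
    (hW : ∀ k, 0 < W k) (hX : IsAntRW G μ W X) :
    κ ^ (m - n) * μ.real (cylinder X n x) ≤ μ.real (cylinder X m y) := by
  have key : ∀ k, n ≤ k → k ≤ m →
      κ ^ (k - n) * μ.real (cylinder X n x) ≤ μ.real (cylinder X k y) := by
    intro k hk
    induction k, hk using Nat.le_induction with
    | base =>
      intro _
      have : cylinder X n x = cylinder X n y := by
        ext ω
        exact forall₂_congr fun j hj => by rw [h.agree j hj]
      rw [this]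
      simp
    | succ k hk ih =>
      intro hkm
      have h1 := hX.transition k y (y (k + 1))
      have h2 : {ω | (∀ j ≤ k, X j ω = y j) ∧ X (k + 1) ω = y (k + 1)} = cylinder X (k + 1) y := by
        ext ω
        refine ⟨fun hω j hj => ?_, fun hω => ⟨fun j hj => hω j (by omega), hω _ le_rfl⟩⟩
        rcases Nat.le_succ_iff.1 hj with hj' | rfl
        · exact hω.1 j hj'
        · exact hω.2
      have h3 : μ.real (cylinder X (k + 1) y) =
          μ.real (cylinder X k y) * transProb G W y k (y (k + 1)) := by
        rw [measureReal_def, ← h2, h1, ENNReal.toReal_mul,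
          ENNReal.toReal_ofReal (transProb_nonneg hW _ _ _)]
        rfl
      have h4 : k + 1 - n = (k - n) + 1 := by omega
      rw [h3, h4, pow_succ]
      calc κ ^ (k - n) * κ * μ.real (cylinder X n x)
          = (κ ^ (k - n) * μ.real (cylinder X n x)) * κ := by ring
        _ ≤ μ.real (cylinder X k y) * transProb G W y k (y (k + 1)) :=
          mul_le_mul (ih (by omega)) (h.step k ⟨hk, hkm⟩).2 hκ measureReal_nonneg
  exact key m h.le le_rfl

theorem ae_eventually_forward (hN : 1 ≤ N) (hconn : G.Connected) (C : Circuit G) {p q : ℝ}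
    (hpq : 1 + max q 0 < p) (hW : ∀ k, 0 < W k) (hWp : ∀ k : ℤ, 0 < k → W k = (k : ℝ) ^ p)
    (hWq : ∀ k : ℤ, 0 < k → W (-k) = (k : ℝ) ^ q) (hX : IsAntRW G μ W X) :
    ∀ᵐ ω ∂μ, ∀ᶠ k in atTop, Forward (fun n => X n ω) k := by
  obtain ⟨κ, hκ0, hκ1, T, L, hL, hreach⟩ := exists_reaches_isTrap (W := W) hN hconn C hW
  obtain ⟨δ, hδ0, hδ⟩ := exists_le_measureReal_forward_of_isTrap hN hpq hW hWp hWq hX hL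
  set A : Set Ω := {ω | ∀ᶠ k in atTop, Forward (fun n => X n ω) k} with hA
  have hAm : MeasurableSet[⨆ n, histFiltration hX.measurableSet_eq n] A :=
    measurableSet_eventually hX.measurableSet_eq (fun k x => Forward x k)
      fun k x y h h' => h'.congr h
  have hAm' : MeasurableSet A :=
    (iSup_le fun n => (histFiltration hX.measurableSet_eq).le n) _ hAm
  have hδκ : 0 < δ * κ ^ T := by positivity
  have hmain : μ Aᶜ = 0 := by
    refine measure_eq_zero_of_cylinder_le hX.measurableSet_eq
      (@MeasurableSet.compl _ _ (⨆ n, histFiltration hX.measurableSet_eq n) hAm)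
      (θ := 1 - δ * κ ^ T) (by linarith) 0 fun n _ x => ?_
    suffices hs : δ * κ ^ T * μ.real (cylinder X n x) ≤ μ.real (cylinder X n x ∩ A) by
      have h1 := measureReal_inter_add_sdiff (μ := μ) (s := cylinder X n x) hAm'
      rw [Set.sdiff_eq] at h1
      linarith
    by_cases hv : ValidUpTo G x n
    · obtain ⟨y, m, D, hy, hm, hD⟩ := hreach x n hv
      have h1 : κ ^ T * μ.real (cylinder X n x) ≤ μ.real (cylinder X m y) := by
        refine le_trans ?_ (hy.measureReal_cylinder_ge hκ0.le hW hX)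
        refine mul_le_mul_of_nonneg_right ?_ measureReal_nonneg
        exact pow_le_pow_of_le_one hκ0.le hκ1 (by omega)
      calc δ * κ ^ T * μ.real (cylinder X n x) = δ * (κ ^ T * μ.real (cylinder X n x)) := by ring
        _ ≤ δ * μ.real (cylinder X m y) := by gcongr
        _ ≤ _ := hδ m y D hD
        _ ≤ _ := measureReal_mono (Set.inter_subset_inter hy.cylinder_subset
            fun ω hω => eventually_atTop.2 ⟨m, hω⟩)
    · have h0 : μ (cylinder X n x) = 0 := by
        have : ∀ᵐ ω ∂μ, ω ∉ cylinder X n x := by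
          filter_upwards [ae_isMove hX] with ω hω hc
          exact hv ((show ValidUpTo G (fun k => X k ω) n from fun k _ => hω k).congr hc)
        simpa [ae_iff] using this
      rw [measureReal_def, h0]
      simp
  rw [ae_iff]
  exact hmain

end EventuallyForward

/-! ### Circuits traced by an injective map -/

section Orbits

variable {V : Type*} {G : SimpleGraph V}

/-- The forward orbit of `a` under `f`. -/
def orbit (f : V → V) (a : V) : Set V := {v | ∃ j, f^[j] a = v}

theorem self_mem_orbit (f : V → V) (a : V) : a ∈ orbit f a := ⟨0, rfl⟩

theorem apply_mem_orbit {f : V → V} {a v : V} (h : v ∈ orbit f a) : f v ∈ orbit f a := by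
  obtain ⟨j, rfl⟩ := h
  exact ⟨j + 1, Function.iterate_succ_apply' f j a⟩

theorem orbit_subset {f : V → V} {a v : V} (h : v ∈ orbit f a) : orbit f v ⊆ orbit f a := by
  rintro w ⟨k, rfl⟩
  induction k with
  | zero => exact h
  | succ k ih =>
    rw [Function.iterate_succ_apply']
    exact apply_mem_orbit ih

theorem orbit_eq_of_mem [Finite V] {f : V → V} (hf : Function.Injective f) {a v : V}
    (h : v ∈ orbit f a) : orbit f v = orbit f a := by
  refine (orbit_subset h).antisymm (orbit_subset ?_)
  obtain ⟨j, rfl⟩ := h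
  obtain ⟨m, hm, hp⟩ := hf.mem_periodicPts a
  refine ⟨m * j - j, ?_⟩
  rw [← Function.iterate_add_apply, Nat.sub_add_cancel (Nat.le_mul_of_pos_left j hm)]
  exact hp.mul_const j

/-- The walk along the sequence `g` from index `s`, with `m` steps. -/
def seqWalk {g : ℕ → V} (hg : ∀ k, G.Adj (g k) (g (k + 1))) (s : ℕ) : ∀ m, G.Walk (g s) (g (s + m))
  | 0 => SimpleGraph.Walk.nil
  | m + 1 => (seqWalk hg s m).concat (hg (s + m))

theorem support_seqWalk {g : ℕ → V} (hg : ∀ k, G.Adj (g k) (g (k + 1))) (s m : ℕ) :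
    (seqWalk hg s m).support = (List.range (m + 1)).map fun j => g (s + j) := by
  induction m with
  | zero => simp [seqWalk]
  | succ m ih =>
    rw [seqWalk, SimpleGraph.Walk.support_concat, ih, List.range_succ (n := m + 1)]
    simp

theorem mem_darts_seqWalk {g : ℕ → V} (hg : ∀ k, G.Adj (g k) (g (k + 1))) (s m : ℕ) (d : G.Dart) :
    d ∈ (seqWalk hg s m).darts ↔ ∃ j < m, d = ⟨(g (s + j), g (s + j + 1)), hg (s + j)⟩ := by
  induction m with
  | zero => simp [seqWalk]
  | succ m ih =>
    rw [seqWalk, SimpleGraph.Walk.darts_concat, List.concat_eq_append, List.mem_append,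
      List.mem_singleton,
      ih]
    constructor
    · rintro (⟨j, hj, rfl⟩ | rfl)
      · exact ⟨j, by omega, rfl⟩
      · exact ⟨m, by omega, rfl⟩
    · rintro ⟨j, hj, rfl⟩
      rcases Nat.lt_succ_iff_lt_or_eq.1 hj with h | rfl
      · exact Or.inl ⟨j, h, rfl⟩
      · exact Or.inr rfl

/-- The orbit of a periodic point whose successive iterates are adjacent is a circuit, unless its
length is two. -/
theorem exists_circuit_orbit [Finite V] {f : V → V} (hf : Function.Injective f) {a : V}
    (hadj : ∀ j, G.Adj (f^[j] a) (f^[j + 1] a)) (h2 : f (f a) ≠ a) :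
    ∃ C : Circuit G, C.verts = orbit f a ∧
      (∀ u v, C.Step u v ↔ u ∈ orbit f a ∧ v = f u) ∧
      C.edges = {e | ∃ u ∈ orbit f a, e = s(u, f u)} := by
  obtain ⟨r, hr⟩ := Nat.exists_eq_succ_of_ne_zero
    (Function.minimalPeriod_pos_of_mem_periodicPts (hf.mem_periodicPts a)).ne'
  have hper : f^[1 + r] a = a := by
    have := Function.iterate_minimalPeriod (f := f) (x := a)
    rwa [hr, Nat.succ_eq_add_one, add_comm] at this
  have hinj : ∀ j k, j < r + 1 → k < r + 1 → f^[j] a = f^[k] a → j = k := by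
    intro j k hj hk h
    exact (Function.iterate_eq_iterate_iff_of_lt_minimalPeriod (by omega) (by omega)).1 h
  have hmod : ∀ j, f^[j % (r + 1)] a = f^[j] a := by
    intro j
    have := Function.iterate_mod_minimalPeriod_eq (f := f) (x := a) (n := j)
    rwa [hr] at this
  set g : ℕ → V := fun j => f^[j] a with hg
  have hadj' : ∀ k, G.Adj (g k) (g (k + 1)) := hadj
  have hg1 : g 1 = f a := rfl
  have hgr : g (1 + r) = a := hper
  set w : G.Walk (f a) a := (seqWalk hadj' 1 r).copy hg1 hgr with hw
  have hwd : ∀ d, d ∈ w.darts ↔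
      ∃ j < r, d = ⟨(g (1 + j), g (1 + j + 1)), hadj' (1 + j)⟩ := by
    intro d
    rw [hw, SimpleGraph.Walk.darts_copy, mem_darts_seqWalk]
  have hpath : w.IsPath := by
    rw [hw, SimpleGraph.Walk.isPath_copy, SimpleGraph.Walk.isPath_def, support_seqWalk]
    refine List.Nodup.map_on ?_ List.nodup_range
    intro j hj k hk hjk
    rw [List.mem_range] at hj hk
    simp only [hg] at hjk
    rw [add_comm 1, add_comm 1, Function.iterate_succ_apply', Function.iterate_succ_apply'] at hjk
    exact hinj j k hj hk (hf hjk)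
  have hedge : s(a, f a) ∉ w.edges := by
    intro h
    rw [SimpleGraph.Walk.edges, List.mem_map] at h
    obtain ⟨d, hd, he⟩ := h
    obtain ⟨j, hj, rfl⟩ := (hwd d).1 hd
    rw [SimpleGraph.dart_edge_eq_mk'_iff'] at he
    rcases he with ⟨h3, -⟩ | ⟨h3, h4⟩
    · have := hinj (1 + j) 0 (by omega) (by omega) h3
      omega
    · simp only [hg] at h3 h4
      rw [add_comm 1, Function.iterate_succ_apply'] at h3
      have := hinj j 0 (by omega) (by omega) (hf h3)
      subst this
      exact h2 h4
  have h0 : G.Adj a (f a) := hadj 0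
  have hdarts : ∀ d : G.Dart, d ∈ (SimpleGraph.Walk.cons h0 w).darts ↔
      d.fst ∈ orbit f a ∧ d.snd = f d.fst := by
    intro d
    rw [SimpleGraph.Walk.darts_cons, List.mem_cons, hwd]
    constructor
    · rintro (rfl | ⟨j, hj, rfl⟩)
      · exact ⟨self_mem_orbit f a, rfl⟩
      · exact ⟨⟨1 + j, rfl⟩, Function.iterate_succ_apply' f (1 + j) a⟩
    · rintro ⟨⟨j, hj⟩, hs⟩
      rw [← hmod] at hj
      have hlt := Nat.mod_lt j (Nat.succ_pos r)
      generalize j % (r + 1) = l at hj hlt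
      rcases Nat.eq_zero_or_pos l with rfl | hl
      · left
        ext
        · exact hj.symm
        · rw [hs, ← hj]
          rfl
      · right
        refine ⟨l - 1, by omega, ?_⟩
        have hl' : 1 + (l - 1) = l := by omega
        ext
        · simp only [hl', hg]
          exact hj.symm
        · simp only [hl', hg]
          rw [Function.iterate_succ_apply', hj]
          exact hs
  refine ⟨⟨a, .cons h0 w, (SimpleGraph.Walk.cons_isCycle_iff w h0).2 ⟨hpath, hedge⟩⟩, ?_, ?_, ?_⟩
  · ext v
    change v ∈ (SimpleGraph.Walk.cons h0 w).support ↔ _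
    constructor
    · intro hv
      rw [SimpleGraph.Walk.support_cons, List.mem_cons, hw, SimpleGraph.Walk.support_copy,
        support_seqWalk, List.mem_map] at hv
      rcases hv with rfl | ⟨j, -, rfl⟩
      · exact self_mem_orbit f v
      · exact ⟨1 + j, rfl⟩
    · intro hv
      have hav : G.Adj v (f v) := by
        obtain ⟨j, rfl⟩ := hv
        have := hadj j
        rwa [Function.iterate_succ_apply'] at this
      exact SimpleGraph.Walk.dart_fst_mem_support_of_mem_darts _
        ((hdarts ⟨(v, f v), hav⟩).2 ⟨hv, rfl⟩)
  · intro u v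
    constructor
    · rintro ⟨d, hd, rfl, rfl⟩
      exact (hdarts d).1 hd
    · rintro ⟨hu, rfl⟩
      have hav : G.Adj u (f u) := by
        obtain ⟨j, rfl⟩ := hu
        have := hadj j
        rwa [Function.iterate_succ_apply'] at this
      exact ⟨⟨(u, f u), hav⟩, (hdarts _).2 ⟨hu, rfl⟩, rfl, rfl⟩
  · ext e
    change e ∈ (SimpleGraph.Walk.cons h0 w).edges ↔ _
    rw [SimpleGraph.Walk.edges, List.mem_map]
    constructor
    · rintro ⟨d, hd, rfl⟩
      obtain ⟨h3, h4⟩ := (hdarts d).1 hd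
      refine ⟨d.fst, h3, ?_⟩
      rw [← h4]
      rfl
    · rintro ⟨u, hu, rfl⟩
      have hav : G.Adj u (f u) := by
        obtain ⟨j, rfl⟩ := hu
        have := hadj j
        rwa [Function.iterate_succ_apply'] at this
      exact ⟨⟨(u, f u), hav⟩, (hdarts _).2 ⟨hu, rfl⟩, rfl⟩

theorem exists_dart_of_mem_support {u w : V} (p : G.Walk u w) {v : V} (hv : v ∈ p.support) :
    v = w ∨ ∃ d ∈ p.darts, d.fst = v := by
  induction p with
  | nil => simpa using hv
  | cons h p ih =>
    rw [SimpleGraph.Walk.support_cons, List.mem_cons] at hv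
    rcases hv with rfl | hv
    · exact Or.inr ⟨⟨(_, _), h⟩, by simp, rfl⟩
    · rcases ih hv with h1 | ⟨d, hd, h1⟩
      · exact Or.inl h1
      · exact Or.inr ⟨d, by simp [hd], h1⟩

theorem Circuit.exists_step (C : Circuit G) {v : V} (hv : v ∈ C.verts) : ∃ w, C.Step v w := by
  rcases exists_dart_of_mem_support C.walk hv with rfl | ⟨d, hd, rfl⟩
  · obtain ⟨a, q, hq⟩ := C
    cases q with
    | nil => exact absurd rfl hq.ne_nil
    | cons h p => exact ⟨_, ⟨(_, _), h⟩, by simp, rfl, rfl⟩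
  · exact ⟨d.snd, d, hd, rfl, rfl⟩

theorem Circuit.Step.snd_mem {C : Circuit G} {u v : V} (h : C.Step u v) : v ∈ C.verts := by
  obtain ⟨d, hd, -, rfl⟩ := h
  exact SimpleGraph.Walk.dart_snd_mem_support_of_mem_darts _ hd

theorem Circuit.Step.adj {C : Circuit G} {u v : V} (h : C.Step u v) : G.Adj u v := by
  obtain ⟨d, -, rfl, rfl⟩ := h
  exact d.adj

end Orbits

/-! ### Forward motion with unique exits is local trapping -/

section Trapping

set_option linter.unusedSectionVars false

variable {V : Type*} [DecidableEq V] [Fintype V] {N : ℕ} {G : SimpleGraph V}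
  {x : ℕ → Fin N → V}

/-- If eventually all jumps are forward, no vertex is left along two edges infinitely often and
every walker keeps jumping, then the edges used infinitely often form a permutation of the vertices
visited infinitely often, and its cycles are the trapping circuits. -/
theorem locTrapp_of_forward (hv : ∀ k, ∃ i b, IsMove G x k i b)
    (hfw : ∀ᶠ k in atTop, Forward x k)
    (huniq : ∀ a w₁ w₂, G.Adj a w₁ → G.Adj a w₂ → (∃ᶠ k in atTop, Jumps x k a w₁) →
      (∃ᶠ k in atTop, Jumps x k a w₂) → w₁ = w₂)
    (hmove : ∀ i, ∃ᶠ k in atTop, x (k + 1) i ≠ x k i) : LocTrapp G x := by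
  classical
  obtain ⟨n, hn⟩ := eventually_atTop.1 hfw
  set J : V → V → Prop := fun a b => G.Adj a b ∧ ∃ᶠ k in atTop, Jumps x k a b with hJ
  -- from `n₀` on, only edges used infinitely often are used
  obtain ⟨n₀, hn₀⟩ : ∃ n₀, ∀ k ≥ n₀, ∀ i, x (k + 1) i ≠ x k i → J (x k i) (x (k + 1) i) := by
    have h1 : ∀ a b, ∀ᶠ k in atTop, Jumps x k a b → G.Adj a b → J a b := by
      intro a b
      by_cases h : ∃ᶠ k in atTop, Jumps x k a b
      · exact Eventually.of_forall fun k _ hab => ⟨hab, h⟩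
      · rw [not_frequently] at h
        exact h.mono fun k hk hk' => absurd hk' hk
    have h2 : ∀ᶠ k in atTop, ∀ a b, Jumps x k a b → G.Adj a b → J a b :=
      eventually_all.2 fun a => eventually_all.2 fun b => h1 a b
    obtain ⟨n₀, h⟩ := eventually_atTop.1 h2
    refine ⟨n₀, fun k hk i hi => h k hk _ _ ⟨i, rfl, rfl⟩ ?_⟩
    obtain ⟨j, b, hm⟩ := hv k
    obtain rfl := hm.moved_iff.1 hi
    rw [hm.apply_self]
    exact hm.1
  set f : V → V := fun a => if h : ∃ b, J a b then h.choose else a with hf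
  set R : Set V := {a | ∃ b, J a b} with hR
  have hfJ : ∀ a b, J a b → f a = b := by
    intro a b h
    have hex : ∃ b, J a b := ⟨b, h⟩
    simp only [hf, dif_pos hex]
    exact huniq a _ _ hex.choose_spec.1 h.1 hex.choose_spec.2 h.2
  have hRf : ∀ a ∈ R, J a (f a) := by
    rintro a ⟨b, h⟩
    rwa [hfJ a b h]
  have hfR : ∀ a ∉ R, f a = a := fun a ha => dif_neg ha
  have hstep : ∀ k ≥ n₀, ∀ i, x (k + 1) i = x k i ∨ x (k + 1) i = f (x k i) := by
    intro k hk i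
    by_cases h : x (k + 1) i = x k i
    · exact Or.inl h
    · exact Or.inr (hfJ _ _ (hn₀ k hk i h)).symm
  have hmem : ∀ k ≥ n₀, ∀ i, x k i ∈ R := by
    have key : ∀ d k, n₀ ≤ k → ∀ i, x (k + d + 1) i ≠ x (k + d) i → x k i ∈ R := by
      intro d
      induction d with
      | zero => exact fun k hk i h => ⟨_, hn₀ k hk i h⟩
      | succ d ih =>
        intro k hk i h
        by_cases h' : x (k + 1) i = x k i
        · rw [← h']
          refine ih (k + 1) (by omega) i ?_
          have : k + 1 + d = k + (d + 1) := by omega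
          rwa [this]
        · exact ⟨_, hn₀ k hk i h'⟩
    intro k hk i
    obtain ⟨l, hl, hne⟩ := frequently_atTop.1 (hmove i) k
    obtain ⟨d, rfl⟩ := Nat.exists_eq_add_of_le hl
    exact key d k hk i hne
  -- a walker that leaves `a` infinitely often comes back to `a`
  have hback : ∀ a ∈ R, f a ∈ R ∧ ∃ z ∈ R, f z = a := by
    rintro a ⟨b, hab, hfreq⟩
    obtain ⟨i, hi⟩ := frequently_exists.1 hfreq
    obtain ⟨k₀, hk₀, ha₀, hb₀⟩ := frequently_atTop.1 hi n₀
    have hfa : f a = b := hfJ a b ⟨hab, hfreq⟩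
    refine ⟨?_, ?_⟩
    · rw [hfa, ← hb₀]
      exact hmem _ (by omega) i
    · obtain ⟨k₁, hk₁, ha₁, -⟩ := frequently_atTop.1 hi (k₀ + 1)
      have key : ∀ k, k₀ + 1 ≤ k → x k i = a → ∃ z ∈ R, f z = a := by
        intro k hk
        induction k, hk using Nat.le_induction with
        | base =>
          intro h
          exact absurd (hb₀.symm.trans h) hab.ne'
        | succ k hk ih =>
          intro h
          rcases hstep k (by omega) i with h' | h'
          · exact ih (h'.symm.trans h)
          · exact ⟨x k i, hmem k (by omega) i, h'.symm.trans h⟩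
      exact key k₁ hk₁ ha₁
  have hinj : Function.Injective f := by
    rw [Finite.injective_iff_surjective]
    intro a
    by_cases ha : a ∈ R
    · obtain ⟨z, -, hz⟩ := (hback a ha).2
      exact ⟨z, hz⟩
    · exact ⟨a, hfR a ha⟩
  have horb : ∀ a ∈ R, orbit f a ⊆ R := by
    rintro a ha v ⟨j, rfl⟩
    induction j with
    | zero => exact ha
    | succ j ih =>
      rw [Function.iterate_succ_apply']
      exact (hback _ ih).1
  have hcirc : ∀ a ∈ R, ∃ C : Circuit G, C.verts = orbit f a ∧
      (∀ u v, C.Step u v ↔ u ∈ orbit f a ∧ v = f u) ∧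
      C.edges = {e | ∃ u ∈ orbit f a, e = s(u, f u)} := by
    intro a ha
    refine exists_circuit_orbit hinj (fun j => ?_) fun h2 => ?_
    · rw [Function.iterate_succ_apply']
      exact (hRf _ (horb a ha ⟨j, rfl⟩)).1
    · -- an edge cannot be crossed in both directions by forward jumps
      have h3 := hRf a ha
      have h4 := hRf _ (hback a ha).1
      rw [h2] at h4
      have h5 := (tendsto_crossing hv hn h3.1.ne h3.2).1
      have h6 := (tendsto_crossing hv hn h4.1.ne h4.2).1
      rw [crossing_swap] at h6
      omega
  have hwalk : ∀ i, ∀ k ≥ n₀, x k i ∈ orbit f (x n₀ i) := by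
    intro i k hk
    induction k, hk using Nat.le_induction with
    | base => exact self_mem_orbit f _
    | succ k hk ih =>
      rcases hstep k hk i with h | h
      · rwa [h]
      · rw [h]
        exact apply_mem_orbit ih
  have hspin : ∀ i (C : Circuit G), orbit f (x n₀ i) ⊆ C.verts →
      (∀ u ∈ orbit f (x n₀ i), C.Step u (f u)) → Spins x i C := by
    intro i C h1 h2
    refine ⟨eventually_atTop.2 ⟨n₀, fun k hk => ⟨h1 (hwalk i k hk), ?_⟩⟩, hmove i⟩
    rcases hstep k hk i with h | h
    · exact Or.inl h
    · rw [h]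
      exact Or.inr (h2 _ (hwalk i k hk))
  refine ⟨monot_of_forward hv hfw, ?_, ?_⟩
  · set T : Finset (Set V) := Finset.univ.image fun i => orbit f (x n₀ i) with hT
    have hTN : T.card ≤ N := by
      simpa using Finset.card_image_le (s := (Finset.univ : Finset (Fin N)))
        (f := fun i => orbit f (x n₀ i))
    have hrep : ∀ t : T, ∃ i, orbit f (x n₀ i) = t := by
      rintro ⟨t, ht⟩
      obtain ⟨i, -, hi⟩ := Finset.mem_image.1 ht
      exact ⟨i, hi⟩
    choose rep hrep using hrep
    choose C hCv hCs hCe using fun t : T => hcirc (x n₀ (rep t)) (hmem n₀ le_rfl _)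
    simp only [hrep] at hCv hCs hCe
    set e := T.equivFin.symm with he
    have hall : ∀ i, ∃ j, (e j : Set V) = orbit f (x n₀ i) := by
      intro i
      refine ⟨e.symm ⟨orbit f (x n₀ i), Finset.mem_image_of_mem _ (Finset.mem_univ i)⟩, ?_⟩
      rw [Equiv.apply_symm_apply]
    have hTR : ∀ t : T, (t : Set V) ⊆ R := by
      intro t
      rw [← hrep t]
      exact horb _ (hmem n₀ le_rfl _)
    have hspin' : ∀ i (t : T), (t : Set V) = orbit f (x n₀ i) → Spins x i (C t) := by
      intro i t ht
      refine hspin i (C t) ?_ fun u hu => ?_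
      · rw [hCv, ht]
      · rw [hCs, ht]
        exact ⟨hu, rfl⟩
    refine ⟨T.card, hTN, fun j => C (e j), ?_, ?_, ?_, ?_, ?_⟩
    · intro j k hjk
      simp only [hCv]
      refine Set.disjoint_left.2 fun v hj hk => hjk (e.injective (Subtype.ext ?_))
      rw [← hrep (e j)] at hj ⊢
      rw [← hrep (e k)] at hk ⊢
      exact (orbit_eq_of_mem hinj hj).symm.trans (orbit_eq_of_mem hinj hk)
    · ext v
      simp only [Set.mem_iUnion, hCv]
      constructor
      · intro hvis
        obtain ⟨k, hk, i, rfl⟩ := frequently_atTop.1 hvis n₀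
        obtain ⟨j, hj⟩ := hall i
        exact ⟨j, by rw [hj]; exact hwalk i k hk⟩
      · rintro ⟨j, hj⟩
        obtain ⟨b, -, hb⟩ := hTR _ hj
        exact hb.mono fun k hk => hk.imp fun i hi => hi.1
    · ext e'
      simp only [Set.mem_iUnion, hCe]
      constructor
      · rintro ⟨hadj, hfreq⟩
        obtain ⟨k, hk, i, rfl⟩ := frequently_atTop.1 hfreq n₀
        rw [SimpleGraph.mem_edgeSet] at hadj
        obtain ⟨j, hj⟩ := hall i
        refine ⟨j, x k i, by rw [hj]; exact hwalk i k hk, ?_⟩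
        rcases hstep k hk i with h | h
        · exact absurd h.symm hadj.ne
        · rw [h]
      · rintro ⟨j, u, hu, rfl⟩
        have h := hRf u (hTR _ hu)
        exact ⟨h.1, h.2.mono fun k hk => hk.imp fun i hi => by rw [hi.1, hi.2]⟩
    · intro j
      exact ⟨rep (e j), hspin' _ _ (hrep (e j)).symm⟩
    · intro i
      obtain ⟨j, hj⟩ := hall i
      exact ⟨j, hspin' i _ hj⟩
  · intro C hC
    have hCJ : ∀ u v, C.Step u v → J u v := fun u v h => ⟨h.adj, hC u v h⟩
    have hCf : ∀ v ∈ C.verts, C.Step v (f v) := by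
      intro v hvC
      obtain ⟨w, hw⟩ := C.exists_step hvC
      rwa [hfJ v w (hCJ v w hw)]
    have hbase : C.base ∈ C.verts := C.walk.start_mem_support
    have hCorb : orbit f C.base ⊆ C.verts := by
      rintro v ⟨j, rfl⟩
      induction j with
      | zero => exact hbase
      | succ j ih =>
        rw [Function.iterate_succ_apply']
        exact (hCf _ ih).snd_mem
    obtain ⟨k, hk, i, hi, -⟩ := frequently_atTop.1 (hCJ _ _ (hCf _ hbase)).2 n₀
    have horb' : orbit f (x n₀ i) = orbit f C.base := by
      rw [← hi]
      exact (orbit_eq_of_mem hinj (hwalk i k hk)).symm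
    refine ⟨i, hspin i C ?_ ?_⟩
    · rw [horb']
      exact hCorb
    · rw [horb']
      exact fun u hu => hCf u (hCorb hu)

end Trapping

/-! ### Every walker keeps jumping -/

section Final

set_option linter.unusedSectionVars false

variable {V : Type*} [DecidableEq V] [Fintype V] {N : ℕ} {G : SimpleGraph V} [DecidableRel G.Adj]
  {W : ℤ → ℝ} {Ω : Type*} [mΩ : MeasurableSpace Ω] {μ : Measure Ω} [IsProbabilityMeasure μ]
  {X : ℕ → Ω → Fin N → V}

/-- Each walker is selected infinitely often, because a multiplicative supermartingale that grows
with each jump of another walker, and vanishes when the walker jumps, cannot diverge. -/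
theorem ae_frequently_jumps (hN : 1 ≤ N) (hd : ∀ a, ∃ b, G.Adj a b) (hW : ∀ k, 0 < W k)
    (hX : IsAntRW G μ W X) :
    ∀ᵐ ω ∂μ, ∀ i, ∃ᶠ k in atTop, X (k + 1) ω i ≠ X k ω i := by
  have hN0 : (0 : ℝ) < N := by exact_mod_cast hN
  -- the product grows by the factor `1 + 1 / N` with each jump of another walker
  set ψ : Fin N → ℕ → (ℕ → Fin N → V) → Fin N → V → ℝ :=
    fun i _ _ j _ => if j = i then 0 else 1 + 1 / N with hψ
  have h : ∀ᵐ ω ∂μ, ∀ i n, ¬ Tendsto (fun t => jumpProd (ψ i) n t (fun k => X k ω))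
      atTop atTop := by
    simp only [ae_all_iff]
    intro i n
    refine ae_not_tendsto_jumpProd hW hX (fun k x j u => ?_) (fun k x y _ => rfl) n
      fun t _ x _ => ?_
    · simp only [hψ]
      split_ifs <;> positivity
    · have h1 : ∀ j, 1 / (N : ℝ) * ∑ u, jumpProb G W x t j u * ψ i t x j u =
          1 / N * (1 + 1 / N) - if j = i then 1 / (N : ℝ) * (1 + 1 / N) else 0 := by
        intro j
        simp only [hψ]
        rw [← Finset.sum_mul, sum_jumpProb hW hd, one_mul]
        split_ifs <;> simp
      rw [Finset.sum_congr rfl fun j _ => h1 j, Finset.sum_sub_distrib, Finset.sum_ite_eq',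
        if_pos (Finset.mem_univ i), Finset.sum_const, Finset.card_univ, Fintype.card_fin,
        nsmul_eq_mul]
      have h2 : (N : ℝ) * (1 / N * (1 + 1 / N)) - 1 / N * (1 + 1 / N) = 1 - (1 / N) ^ 2 := by
        field_simp
        ring
      rw [h2]
      linarith [sq_nonneg (1 / (N : ℝ))]
  filter_upwards [h, ae_isMove hX] with ω hω hv i
  by_contra hcon
  rw [not_frequently] at hcon
  obtain ⟨n, hn⟩ := eventually_atTop.1 hcon
  refine hω i n ?_
  have hpow : ∀ t ≥ n, jumpProd (ψ i) n t (fun k => X k ω) = (1 + 1 / (N : ℝ)) ^ (t - n) := by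
    intro t ht
    unfold jumpProd
    rw [Finset.prod_congr rfl (g := fun _ => 1 + 1 / (N : ℝ)), Finset.prod_const, Nat.card_Ico]
    intro k hk
    obtain ⟨j, b, hm⟩ := hv k
    rw [hm.jumpFactor_eq]
    simp only [hψ]
    rw [if_neg]
    rintro rfl
    exact hn k (Finset.mem_Ico.1 hk).1 (hm.moved_iff.2 rfl)
  have hone : 1 < 1 + 1 / (N : ℝ) := by
    have : 0 < 1 / (N : ℝ) := by positivity
    linarith
  refine ((tendsto_pow_atTop_atTop_of_one_lt hone).comp (tendsto_sub_atTop_nat n)).congr' ?_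
  filter_upwards [eventually_ge_atTop n] with t ht
  exact (hpow t ht).symm

/-! ### The weights and the conclusion -/

theorem weight_of_pos {p : ℝ} {W₁ W₂ : ℕ → ℝ} (hW₁ : ∀ k : ℕ, 1 ≤ k → W₁ k = (k : ℝ) ^ p)
    (k : ℤ) (hk : 0 < k) : weight W₁ W₂ k = (k : ℝ) ^ p := by
  rw [weight, if_pos hk, hW₁ _ (by omega)]
  congr 1
  exact_mod_cast Int.toNat_of_nonneg hk.le

theorem weight_neg {q : ℝ} {W₁ W₂ : ℕ → ℝ} (hW₂ : ∀ k : ℕ, 1 ≤ k → W₂ k = (k : ℝ) ^ q)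
    (k : ℤ) (hk : 0 < k) : weight W₁ W₂ (-k) = (k : ℝ) ^ q := by
  rw [weight, if_neg (by omega), neg_neg, hW₂ _ (by omega)]
  congr 1
  exact_mod_cast Int.toNat_of_nonneg hk.le

theorem weight_pos {p q : ℝ} {W₁ W₂ : ℕ → ℝ} (hW₁ : ∀ k : ℕ, 1 ≤ k → W₁ k = (k : ℝ) ^ p)
    (hW₂ : ∀ k : ℕ, 1 ≤ k → W₂ k = (k : ℝ) ^ q) (h0 : 0 < W₂ 0) (k : ℤ) :
    0 < weight W₁ W₂ k := by
  rcases lt_trichotomy k 0 with h | rfl | h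
  · rw [← neg_neg k, weight_neg hW₂ (-k) (by omega)]
    exact Real.rpow_pos_of_pos (by exact_mod_cast (by omega : 0 < -k)) q
  · simpa [weight] using h0
  · rw [weight_of_pos hW₁ k h]
    exact Real.rpow_pos_of_pos (by exact_mod_cast h) p

theorem exists_adj_of_circuit (hconn : G.Connected) (C : Circuit G) (a : V) : ∃ b, G.Adj a b := by
  obtain ⟨c, hc⟩ := C.exists_step C.walk.start_mem_support
  have : Nontrivial V := ⟨_, _, hc.adj.ne⟩
  exact hconn.preconnected.exists_adj_of_nontrivial a

end Final

end AntRW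

theorem theorem1p2 {V : Type*} [Fintype V] [DecidableEq V] (G : SimpleGraph V) [DecidableRel G.Adj]
    (hconn : G.Connected) (hG : AntRW.HasTwoCircuits G)
    (N : ℕ) (hN : 1 ≤ N) (p q : ℝ) (W₁ W₂ : ℕ → ℝ)
    (hW₁ : ∀ k : ℕ, 1 ≤ k → W₁ k = (k : ℝ) ^ p)
    (hW₂ : ∀ k : ℕ, 1 ≤ k → W₂ k = (k : ℝ) ^ q) (hW₂_zero : 0 < W₂ 0)
    {Ω : Type*} [MeasurableSpace Ω] (μ : Measure Ω) [IsProbabilityMeasure μ]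
    (X : ℕ → Ω → Fin N → V) (hX : AntRW.IsAntRW G μ (AntRW.weight W₁ W₂) X) :
    (p ≤ 1 + q → ∀ᵐ ω ∂μ, ¬ AntRW.Monot G (fun n => X n ω)) ∧
    (p > 1 + max q 0 → ∀ᵐ ω ∂μ, AntRW.LocTrapp G (fun n => X n ω)) := by
  -- one circuit is enough: it shows that each vertex has a neighbour, and walkers can be led
  -- around it to raise crossing numbers
  obtain ⟨C, -, -⟩ := hG
  have hd := AntRW.exists_adj_of_circuit hconn C
  have hW := AntRW.weight_pos hW₁ hW₂ hW₂_zero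
  have hWp := AntRW.weight_of_pos (W₂ := W₂) hW₁
  have hWq := AntRW.weight_neg (W₁ := W₁) hW₂
  refine ⟨fun hpq => ?_, fun hpq => ?_⟩
  · filter_upwards [AntRW.ae_not_eventually_forward hpq hd hW hWp hWq hX, AntRW.ae_isMove hX]
      with ω h hv hM
    exact h (AntRW.forward_of_monot hv hM)
  · have hp : 1 < p := by
      have := le_max_right q 0
      linarith
    filter_upwards [AntRW.ae_eventually_forward hN hconn C hpq hW hWp hWq hX,
      AntRW.ae_not_branches hp hN hd hW hWp hX, AntRW.ae_frequently_jumps hN hd hW hX,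
      AntRW.ae_isMove hX] with ω hfw hbr hmove hv
    refine AntRW.locTrapp_of_forward hv hfw (fun a w₁ w₂ h₁ h₂ hf₁ hf₂ => ?_) hmove
    obtain ⟨n, hn⟩ := eventually_atTop.1 hfw
    by_contra hne
    exact hbr n a w₁ w₂ h₁ h₂ hne ⟨hn, hf₁, hf₂⟩
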